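/- **Setting.** Let $x_0=0$ and $x_{t+1}=A_*x_t+B_*u_t+w_t$ with $x_t\in\mathbb R^n$, $u_t\in\mathbb R^d$, and write $\Theta_*^\top=[A_*\ B_*]$, $z_t=(x_t,u_t)$. The noise $w_t$ is $\mathcal F_t$-measurable, and, for constants $\sigma_w,\bar\sigma_w>0$, satisfies $\mathbb E[w_t\mid\mathcal F_{t-1}]=0$, $\mathbb E[e^{s w_{t,j}}\mid\mathcal F_{t-1}]\le e^{s^2\sigma_w^2/2}$ for all $s\in\mathbb R$ and all $j$, and $\mathbb E[w_tw_t^\top\mid\mathcal F_{t-1}]=\bar\sigma_w^2I$. Let $Q,R\succ0$. For $\Theta^\top=[A\ B]$ let $P(\Theta)\succ0$ be the positive definite solution of the Riccati equation $P=A^\top PA+Q-A^\top PB(R+B^\top PB)^{-1}B^\top PA$, let $K(\Theta)=-(R+B^\top P(\Theta)B)^{-1}B^\top P(\Theta)A$ and $J(\Theta)=\operatorname{Tr}(\bar\sigma_w^2P(\Theta))$. For $\kappa\ge1$, $0<\gamma\le1$, let $\mathcal S$ be the set of all $\Theta$ with $\|\Theta\|_F\le S$ that are $(\kappa,\gamma)$-stabilizable: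 $P(\Theta)$ exists, $\|K(\Theta)\|\le\kappa$, and $A+BK(\Theta)=HLH^{-1}$ with $H\succ0$, $\|L\|\le1-\gamma$, $\|H\|\|H^{-1}\|\le\kappa$. Assume $\Theta_*\in\mathcal S$. For $\lambda>0$ and $\delta\in(0,1)$ put $V_t=\lambda I+\sum_{s<t}z_sz_s^\top$, $\hat\Theta_t=\arg\min_\Theta\sum_{s<t}\|x_{s+1}-\Theta^\top z_s\|^2+\lambda\|\Theta\|_F^2$, $$\beta_t(\delta)=\sigma_w\sqrt{2n\log\Big(\delta^{-1}\sqrt{\det V_t/\det(\lambda I)}\Big)}+\sqrt\lambda\,S,$$ and $\mathcal C_t(\delta)=\{\Theta:\operatorname{Tr}((\Theta-\hat\Theta_t)^\top V_t(\Theta-\hat\Theta_t))^{1/2}\le\beta_t(\delta)\}$. **Algorithm (StabL).** Start from some $\tilde\Theta_{-1}\in\mathcal S$ and $\tau=0$. At each time $t$, if $\det V_t>2\det V_\tau$ and $t-\tau>H_0:=2\gamma^{-1}\log(2\kappa\sqrt2)$, choose $\tilde\Theta_t\in\arg\min_{\Theta\in\mathcal C_t(\delta)\cap\mathcal S}J(\Theta)$,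 measurably in the past (keep $\tilde\Theta_t=\tilde\Theta_{t-1}$ if this set is empty), and set $\tau=t$; otherwise $\tilde\Theta_t=\tilde\Theta_{t-1}$. Then apply $u_t=K(\tilde\Theta_{t-1})x_t+\nu_t$ if $t\le T_w$ (improved exploration), and $u_t=K(\tilde\Theta_{t-1})x_t$ if $t>T_w$. Here the $\nu_t\sim\mathcal N(0,\sigma_\nu^2I)$ with $\sigma_\nu^2=2\kappa^2\bar\sigma_w^2$ are $\mathcal F_t$-measurable, and each $\nu_t$ is independent of $\mathcal F_{t-1}$ and $w_t$ jointly. **Lemma 2 (Parameter estimation error).** There is a universal polynomial $\mathrm{poly}$ in four variables, and for each choice of $n,d,\sigma_w,\bar\sigma_w,\kappa,S,\lambda$ there is a problem-dependent constant $\sigma_\star>0$, such that the following holds for all $\gamma$, $Q$, $R$, all $\Theta_*\in\mathcal S$, all noise processes as above, every $\delta\in(0,1)$ and every run of StabL. If $T\ge\mathrm{poly}(\sigma_w^2,\sigma_\nu^2,n,\log(1/\delta))$ and the first $T$ time steps ($t=0,\dots,T-1$) all belong to the improved exploration phase, then with probability at least $1-2\delta$ $$\|\hat\Theta_T-\Theta_*\|_2\le\frac{\beta_T(\delta)}{\sigma_\star\sqrt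 T}.$$ -/

import Mathlib

open MeasureTheory ProbabilityTheory Matrix

namespace StabL

/-- The spectral norm (the operator norm between Euclidean spaces) of a real matrix. -/
noncomputable def specNorm {m n : Type*} [Fintype m] [Fintype n] [DecidableEq n]
    (M : Matrix m n ℝ) : ℝ :=
  ‖LinearMap.toContinuousLinearMap (Matrix.toEuclideanLin M)‖

/-- The Frobenius norm of a real matrix. -/
noncomputable def frobNorm {m n : Type*} [Fintype m] [Fintype n] (M : Matrix m n ℝ) : ℝ :=
  Real.sqrt (∑ i, ∑ j, M i j ^ 2)

/-- A model parameter `Θ`, of size `(n + d) × n`, with `Θᵀ = [A B]`. -/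
abbrev Param (n d : ℕ) : Type := Matrix (Fin n ⊕ Fin d) (Fin n) ℝ

/-- The state matrix `A` of `Θᵀ = [A B]`. -/
def stateMat {n d : ℕ} (Θ : Param n d) : Matrix (Fin n) (Fin n) ℝ := (Matrix.toRows₁ Θ)ᵀ

/-- The input matrix `B` of `Θᵀ = [A B]`. -/
def inputMat {n d : ℕ} (Θ : Param n d) : Matrix (Fin n) (Fin d) ℝ := (Matrix.toRows₂ Θ)ᵀ

/-! ### Riccati equation, optimal gain, stabilizability -/

/-- `P` is a positive definite solution of the discrete-time algebraic Riccati equation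
`P = Aᵀ P A + Q - Aᵀ P B (R + Bᵀ P B)⁻¹ Bᵀ P A` of the system `Θᵀ = [A B]`. -/
def IsDARESolution {n d : ℕ} (Q : Matrix (Fin n) (Fin n) ℝ) (R : Matrix (Fin d) (Fin d) ℝ)
    (Θ : Param n d) (P : Matrix (Fin n) (Fin n) ℝ) : Prop :=
  P.PosDef ∧
    P = (stateMat Θ)ᵀ * P * stateMat Θ + Q
      - (stateMat Θ)ᵀ * P * inputMat Θ * (R + (inputMat Θ)ᵀ * P * inputMat Θ)⁻¹
          * (inputMat Θ)ᵀ * P * stateMat Θ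

open Classical in
/-- The positive definite solution `P(Θ)` of the Riccati equation. It is unique when it exists
(`Q`, `R` positive definite); if there is none, the value is `0` and is never used. -/
noncomputable def dareSolution {n d : ℕ} (Q : Matrix (Fin n) (Fin n) ℝ)
    (R : Matrix (Fin d) (Fin d) ℝ) (Θ : Param n d) : Matrix (Fin n) (Fin n) ℝ :=
  if h : ∃ P, IsDARESolution Q R Θ P then h.choose else 0

/-- The optimal feedback gain `K(Θ) = -(R + Bᵀ P(Θ) B)⁻¹ Bᵀ P(Θ) A`. -/
noncomputable def gain {n d : ℕ} (Q : Matrix (Fin n) (Fin n) ℝ) (R : Matrix (Fin d) (Fin d) ℝ)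
    (Θ : Param n d) : Matrix (Fin d) (Fin n) ℝ :=
  -((R + (inputMat Θ)ᵀ * dareSolution Q R Θ * inputMat Θ)⁻¹
      * (inputMat Θ)ᵀ * dareSolution Q R Θ * stateMat Θ)

/-- The optimal average expected cost `J(Θ) = Tr(σ̄_w² P(Θ))`. -/
noncomputable def optCost {n d : ℕ} (Q : Matrix (Fin n) (Fin n) ℝ)
    (R : Matrix (Fin d) (Fin d) ℝ) (σbar : ℝ) (Θ : Param n d) : ℝ :=
  (σbar ^ 2 • dareSolution Q R Θ).trace

/-- `(κ, γ)`-stabilizability: the Riccati equation is solvable, `‖K(Θ)‖ ≤ κ`, and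
`A + B K(Θ) = H L H⁻¹` with `H ≻ 0`, `‖L‖ ≤ 1 - γ` and `‖H‖ ‖H⁻¹‖ ≤ κ`. -/
def IsStabilizable {n d : ℕ} (Q : Matrix (Fin n) (Fin n) ℝ) (R : Matrix (Fin d) (Fin d) ℝ)
    (κ γ : ℝ) (Θ : Param n d) : Prop :=
  (∃ P, IsDARESolution Q R Θ P) ∧
  specNorm (gain Q R Θ) ≤ κ ∧
  ∃ H L : Matrix (Fin n) (Fin n) ℝ, H.PosDef ∧
    stateMat Θ + inputMat Θ * gain Q R Θ = H * L * H⁻¹ ∧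
    specNorm L ≤ 1 - γ ∧ specNorm H * specNorm H⁻¹ ≤ κ

/-- The set `𝒮` of `(κ, γ)`-stabilizable systems with Frobenius norm at most `S`. -/
def stabSet {n d : ℕ} (Q : Matrix (Fin n) (Fin n) ℝ) (R : Matrix (Fin d) (Fin d) ℝ)
    (κ γ S : ℝ) : Set (Param n d) :=
  {Θ | IsStabilizable Q R κ γ Θ ∧ frobNorm Θ ≤ S}

/-! ### Regularized least squares and confidence sets along one trajectory -/

/-- The covariate `z_t = (x_t, u_t)`. -/
def covariate {n d : ℕ} (x : ℕ → Fin n → ℝ) (u : ℕ → Fin d → ℝ) (t : ℕ) : Fin n ⊕ Fin d → ℝ :=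
  Sum.elim (x t) (u t)

/-- The regularized design matrix `V_t = λ I + ∑_{s < t} z_s z_sᵀ`. -/
noncomputable def designMat {n d : ℕ} (lam : ℝ) (x : ℕ → Fin n → ℝ) (u : ℕ → Fin d → ℝ) (t : ℕ) :
    Matrix (Fin n ⊕ Fin d) (Fin n ⊕ Fin d) ℝ :=
  lam • (1 : Matrix (Fin n ⊕ Fin d) (Fin n ⊕ Fin d) ℝ)
    + ∑ s ∈ Finset.range t, Matrix.vecMulVec (covariate x u s) (covariate x u s)

/-- The regularized least-squares estimate
`Θ̂_t = argmin_Θ ∑_{s < t} ‖x_{s+1} - Θᵀ z_s‖² + λ ‖Θ‖_F²`, in closed form. -/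
noncomputable def rlsEstimate {n d : ℕ} (lam : ℝ) (x : ℕ → Fin n → ℝ) (u : ℕ → Fin d → ℝ)
    (t : ℕ) : Param n d :=
  (designMat lam x u t)⁻¹
    * ∑ s ∈ Finset.range t, Matrix.vecMulVec (covariate x u s) (x (s + 1))

/-- The regularized least-squares objective. -/
noncomputable def rlsLoss {n d : ℕ} (lam : ℝ) (x : ℕ → Fin n → ℝ) (u : ℕ → Fin d → ℝ) (t : ℕ)
    (Θ : Param n d) : ℝ :=
  ∑ s ∈ Finset.range t, ∑ i, (x (s + 1) i - (Θᵀ *ᵥ covariate x u s) i) ^ 2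
    + lam * frobNorm Θ ^ 2

theorem designMat_posDef {n d : ℕ} {lam : ℝ} (hl : 0 < lam) (x : ℕ → Fin n → ℝ)
    (u : ℕ → Fin d → ℝ) (t : ℕ) : (designMat lam x u t).PosDef := by
  unfold designMat
  refine Matrix.PosDef.add_posSemidef (Matrix.PosDef.one.smul hl) ?_
  refine Matrix.posSemidef_sum _ fun s _ => ?_
  simpa using Matrix.posSemidef_vecMulVec_self_star (R := ℝ) (covariate x u s)

theorem frobNorm_sq {m n : Type*} [Fintype m] [Fintype n] (M : Matrix m n ℝ) :
    frobNorm M ^ 2 = ∑ i, ∑ j, M i j ^ 2 :=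
  Real.sq_sqrt (Finset.sum_nonneg fun _ _ => Finset.sum_nonneg fun _ _ => sq_nonneg _)

/-- The closed form is a minimizer of the regularized least-squares objective. -/
theorem rlsEstimate_isMin {n d : ℕ} {lam : ℝ} (hl : 0 < lam) (x : ℕ → Fin n → ℝ)
    (u : ℕ → Fin d → ℝ) (t : ℕ) (Θ : Param n d) :
    rlsLoss lam x u t (rlsEstimate lam x u t) ≤ rlsLoss lam x u t Θ := by
  set E := rlsEstimate lam x u t with hE
  have hN : designMat lam x u t * E
      = ∑ s ∈ Finset.range t, Matrix.vecMulVec (covariate x u s) (x (s + 1)) := by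
    rw [hE, rlsEstimate, ← Matrix.mul_assoc, Matrix.mul_nonsing_inv, Matrix.one_mul]
    exact (Matrix.isUnit_iff_isUnit_det _).1 (designMat_posDef hl x u t).isUnit
  have hN' : ∀ k i, lam * E k i + ∑ s ∈ Finset.range t,
      covariate x u s k * (Eᵀ *ᵥ covariate x u s) i
      = ∑ s ∈ Finset.range t, covariate x u s k * x (s + 1) i := by
    intro k i
    have h := congrFun (congrFun hN k) i
    simp only [designMat, Matrix.add_mul, Matrix.smul_mul, Matrix.one_mul, Matrix.add_apply,
      Matrix.smul_apply, smul_eq_mul, Matrix.sum_mul, Matrix.sum_apply,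
      Matrix.vecMulVec_apply] at h
    rw [← h]
    congr 1
    refine Finset.sum_congr rfl fun s _ => ?_
    simp only [Matrix.mul_apply, Matrix.mulVec, dotProduct, Matrix.vecMulVec_apply,
      Matrix.transpose_apply, Finset.mul_sum]
    refine Finset.sum_congr rfl fun l _ => ?_
    ring
  obtain ⟨D, rfl⟩ : ∃ D, Θ = E + D := ⟨Θ - E, by abel⟩
  have hcross : ∑ s ∈ Finset.range t, ∑ i,
      (x (s + 1) i - (Eᵀ *ᵥ covariate x u s) i) * (Dᵀ *ᵥ covariate x u s) i
      = lam * ∑ k, ∑ i, E k i * D k i := by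
    have h1 : ∀ s i, (x (s + 1) i - (Eᵀ *ᵥ covariate x u s) i) * (Dᵀ *ᵥ covariate x u s) i
        = ∑ k, D k i * (covariate x u s k * x (s + 1) i
            - covariate x u s k * (Eᵀ *ᵥ covariate x u s) i) := by
      intro s i
      have : (Dᵀ *ᵥ covariate x u s) i = ∑ k, D k i * covariate x u s k := by
        simp [Matrix.mulVec, dotProduct]
      rw [this, Finset.mul_sum]
      exact Finset.sum_congr rfl fun k _ => by ring
    simp_rw [h1]
    rw [Finset.sum_comm]
    simp_rw [Finset.sum_comm (s := Finset.range t)]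
    simp_rw [← Finset.mul_sum, Finset.sum_sub_distrib, ← hN']
    rw [Finset.sum_comm]
    simp only [add_sub_cancel_right, Finset.mul_sum]
    exact Finset.sum_congr rfl fun k _ => Finset.sum_congr rfl fun i _ => by ring
  have hexp : rlsLoss lam x u t (E + D) = rlsLoss lam x u t E
      + (∑ s ∈ Finset.range t, ∑ i, (Dᵀ *ᵥ covariate x u s) i ^ 2
        + lam * ∑ k, ∑ i, D k i ^ 2) := by
    have e1 : ∀ s i, (x (s + 1) i - ((E + D)ᵀ *ᵥ covariate x u s) i) ^ 2
        = (x (s + 1) i - (Eᵀ *ᵥ covariate x u s) i) ^ 2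
          - 2 * ((x (s + 1) i - (Eᵀ *ᵥ covariate x u s) i) * (Dᵀ *ᵥ covariate x u s) i)
          + (Dᵀ *ᵥ covariate x u s) i ^ 2 := by
      intro s i
      rw [Matrix.transpose_add, Matrix.add_mulVec, Pi.add_apply]
      ring
    have e2 : ∀ k i, (E + D) k i ^ 2 = E k i ^ 2 + 2 * (E k i * D k i) + D k i ^ 2 := by
      intro k i
      rw [Matrix.add_apply]
      ring
    simp only [rlsLoss, frobNorm_sq, e1, e2, Finset.sum_add_distrib, Finset.sum_sub_distrib,
      ← Finset.mul_sum, hcross]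
    ring
  rw [hexp]
  have a1 : 0 ≤ ∑ s ∈ Finset.range t, ∑ i, (Dᵀ *ᵥ covariate x u s) i ^ 2 :=
    Finset.sum_nonneg fun _ _ => Finset.sum_nonneg fun _ _ => sq_nonneg _
  have a2 : 0 ≤ lam * ∑ k, ∑ i, D k i ^ 2 :=
    mul_nonneg hl.le (Finset.sum_nonneg fun _ _ => Finset.sum_nonneg fun _ _ => sq_nonneg _)
  linarith

/-- The confidence radius
`β_t(δ) = σ_w √(2 n log(δ⁻¹ √(det V_t / det (λ I)))) + √λ S`. -/
noncomputable def confRadius {n d : ℕ} (σw lam S δ : ℝ) (x : ℕ → Fin n → ℝ) (u : ℕ → Fin d → ℝ)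
    (t : ℕ) : ℝ :=
  σw * Real.sqrt (2 * n * Real.log (δ⁻¹ * Real.sqrt ((designMat lam x u t).det /
      (lam • (1 : Matrix (Fin n ⊕ Fin d) (Fin n ⊕ Fin d) ℝ)).det)))
    + Real.sqrt lam * S

/-- The confidence set `𝒞_t(δ) = {Θ : ‖Θ - Θ̂_t‖_{V_t} ≤ β_t(δ)}`, where
`‖M‖_V = √Tr(Mᵀ V M)`. -/
def confSet {n d : ℕ} (σw lam S δ : ℝ) (x : ℕ → Fin n → ℝ) (u : ℕ → Fin d → ℝ) (t : ℕ) :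
    Set (Param n d) :=
  {Θ | Real.sqrt (((Θ - rlsEstimate lam x u t)ᵀ * designMat lam x u t
      * (Θ - rlsEstimate lam x u t)).trace) ≤ confRadius σw lam S δ x u t}

/-! ### The algorithm -/

/-- The minimal duration of a policy, `H₀ = 2 γ⁻¹ log(2 κ √2)`. -/
noncomputable def minDuration (κ γ : ℝ) : ℝ := 2 * γ⁻¹ * Real.log (2 * κ * Real.sqrt 2)

/-- The test `det V_t > 2 det V_τ` and `t - τ > H₀` for a policy update at time `t`, where `τ` is
the time of the previous update (`τ = 0` initially, with `V_0 = λ I`). -/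
def UpdateTest {n d : ℕ} (κ γ lam : ℝ) (x : ℕ → Fin n → ℝ) (u : ℕ → Fin d → ℝ) (τ t : ℕ) : Prop :=
  2 * (designMat lam x u τ).det < (designMat lam x u t).det ∧ minDuration κ γ < (t : ℝ) - τ

open Classical in
/-- The value of the register `τ` at the beginning of step `t`. -/
noncomputable def lastUpdate {n d : ℕ} (κ γ lam : ℝ) (x : ℕ → Fin n → ℝ) (u : ℕ → Fin d → ℝ) :
    ℕ → ℕ
  | 0 => 0
  | t + 1 => if UpdateTest κ γ lam x u (lastUpdate κ γ lam x u t) t then t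
      else lastUpdate κ γ lam x u t

/-- The policy is recomputed at time `t`. -/
def UpdatesAt {n d : ℕ} (κ γ lam : ℝ) (x : ℕ → Fin n → ℝ) (u : ℕ → Fin d → ℝ) (t : ℕ) : Prop :=
  UpdateTest κ γ lam x u (lastUpdate κ γ lam x u t) t

/-- The process noise: `ℱ t` is the information available before `w_t` is realized. The `w_t` are
martingale differences, componentwise conditionally `σw²`-sub-Gaussian, with conditional
covariance `σbar² I`. -/
structure IsNoise {Ω : Type*} {mΩ : MeasurableSpace Ω} (P : Measure Ω) (ℱ : Filtration ℕ mΩ)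
    {n : ℕ} (σw σbar : ℝ) (w : ℕ → Ω → Fin n → ℝ) : Prop where
  measurable : ∀ t, Measurable[ℱ (t + 1)] (w t)
  integrable : ∀ t i, Integrable (fun ω => w t ω i) P
  condMean : ∀ t i, P[fun ω => w t ω i | ℱ t] =ᵐ[P] fun _ => 0
  integrable_exp : ∀ t i (s : ℝ), Integrable (fun ω => Real.exp (s * w t ω i)) P
  subGaussian : ∀ t i (s : ℝ),
    P[fun ω => Real.exp (s * w t ω i) | ℱ t] ≤ᵐ[P] fun _ => Real.exp (s ^ 2 * σw ^ 2 / 2)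
  integrable_mul : ∀ t i j, Integrable (fun ω => w t ω i * w t ω j) P
  condCov : ∀ t i j, P[fun ω => w t ω i * w t ω j | ℱ t] =ᵐ[P]
    fun _ => if i = j then σbar ^ 2 else 0

/-- The injected perturbations: i.i.d. `𝒩(0, σν² I)`, where `ν_t` is drawn independently of the
past `ℱ t` and of the process noise `w_t`. -/
structure IsPerturbation {Ω : Type*} {mΩ : MeasurableSpace Ω} (P : Measure Ω)
    (ℱ : Filtration ℕ mΩ) {n d : ℕ} (σνsq : ℝ) (w : ℕ → Ω → Fin n → ℝ)
    (ν : ℕ → Ω → Fin d → ℝ) : Prop where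
  measurable : ∀ t, Measurable[ℱ (t + 1)] (ν t)
  law : ∀ t, P.map (ν t) = Measure.pi fun _ => gaussianReal 0 σνsq.toNNReal
  indep : ∀ t, Indep (MeasurableSpace.comap (ν t) MeasurableSpace.pi)
    (ℱ t ⊔ MeasurableSpace.comap (w t) MeasurableSpace.pi) P

/-- `x`, `u` and `Θt` are the states, the inputs and the optimistic parameters produced by the
algorithm on the system `Θstar`, with exploratory perturbations `ν` up to time `Tw`.
The initial parameter `Θt 0` is any element of `𝒮`; an update with an empty feasible set
`𝒞_t(δ) ∩ 𝒮` leaves the parameter unchanged; the input at time `0` is computed from the initial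
parameter (no update happens at time `0`, so that `Θt (0 - 1) = Θt 0` is the parameter in
force before time `0`). The parameter chosen at time `t`, and hence its controller, is a measurable
function of the information `ℱ t` (in particular the minimizer is selected measurably). -/
structure IsRun {Ω : Type*} {mΩ : MeasurableSpace Ω} (ℱ : Filtration ℕ mΩ) {n d : ℕ}
    (Q : Matrix (Fin n) (Fin n) ℝ) (R : Matrix (Fin d) (Fin d) ℝ)
    (σw σbar κ γ S lam δ : ℝ) (Tw : ℕ) (Θstar : Param n d)
    (w : ℕ → Ω → Fin n → ℝ) (ν : ℕ → Ω → Fin d → ℝ)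
    (x : ℕ → Ω → Fin n → ℝ) (u : ℕ → Ω → Fin d → ℝ) (Θt : ℕ → Ω → Param n d) : Prop where
  init_state : ∀ ω, x 0 ω = 0
  dynamics : ∀ t ω, x (t + 1) ω
    = stateMat Θstar *ᵥ x t ω + inputMat Θstar *ᵥ u t ω + w t ω
  input : ∀ t ω, u t ω = gain Q R (Θt (t - 1) ω) *ᵥ x t ω + if t ≤ Tw then ν t ω else 0
  init_param : ∀ ω, Θt 0 ω ∈ stabSet Q R κ γ S
  optimistic : ∀ t ω, UpdatesAt κ γ lam (fun s => x s ω) (fun s => u s ω) t →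
    (confSet σw lam S δ (fun s => x s ω) (fun s => u s ω) t ∩ stabSet Q R κ γ S).Nonempty →
    Θt t ω ∈ confSet σw lam S δ (fun s => x s ω) (fun s => u s ω) t ∩ stabSet Q R κ γ S ∧
    ∀ Θ ∈ confSet σw lam S δ (fun s => x s ω) (fun s => u s ω) t ∩ stabSet Q R κ γ S,
      optCost Q R σbar (Θt t ω) ≤ optCost Q R σbar Θ
  keep : ∀ t ω, ¬ (UpdatesAt κ γ lam (fun s => x s ω) (fun s => u s ω) t ∧
    (confSet σw lam S δ (fun s => x s ω) (fun s => u s ω) t ∩ stabSet Q R κ γ S).Nonempty) →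
    Θt t ω = Θt (t - 1) ω
  measurable_param : ∀ t i j, Measurable[ℱ t] fun ω => Θt t ω i j
  measurable_gain : ∀ t i j, Measurable[ℱ t] fun ω => gain Q R (Θt t ω) i j

end StabL

/-! Two events are used, each failing with probability at most δ. On the first, the true parameter
lies in every confidence set up to time T. The error of the estimate, weighted by V_T, is then at
most β_T, and the bound follows once V_T dominates σ⋆²T times the identity
(`specNorm_rlsEstimate_sub_le`). On the second, the noise is of size at most T and excites every
direction of a fine net. Both together give the lower bound on V_T.

Confidence. For each noise coordinate the self-normalized exponential is a supermartingale, because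
it is a Gaussian mixture of the exponentials controlled by sub-Gaussianity
(`IsNoiseLaw.lintegral_exp_quad_le`). A maximal inequality for the average over the n coordinates,
followed by Jensen, gives the radius β_t (`maximal_ineq_of_lintegral_le`,
`mem_confSet_of_expProcess_lt`).

Excitation. While the gain K stays fixed for n+1 steps, the combination of the covariates with the
coefficients of the characteristic polynomial of A+BK does not depend on the initial state, by
Cayley–Hamilton (`sum_charpoly_coeff_covariate`). It is a function of K and the noise of the block
alone, whatever the stability of the loop. The polynomial is monic, so in a direction (a,b) the
newest noises contribute (a+Kᵀb)·w + b·ν, and the choice of the variance of ν bounds the second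
moment of this from below. Second and fourth moments yield a conditional small-ball estimate, a
Chernoff bound for each direction, and a net argument for all directions
(`IsRun.lintegral_runExcitation_step_le`, `sum_min_sq_one_ge_of_grid`).

Updates. A block is wasted when the policy changes inside it, so the updates must number at most ηT,
with constants free of γ (`exists_updateCount_le`). If H₀ ≥ 1/η, the minimal duration suffices.
Otherwise γ is bounded below. Each policy comes from a confidence set, so its prediction error on
sufficiently old covariates is bounded; by pigeonhole on directions, the error is large relative to
the state only boundedly often. At all other times a Lyapunov norm contracts, with a weight that
pays for changes of policy. States then grow at most linearly in T, det V_T polynomially, and the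
determinant test makes the updates logarithmic in number.

Constants. For T below a fixed threshold, λI alone gives the lower bound on V_T if σ⋆ is small.
Above it, the second event fails with probability at most exp(-√T), which is at most δ when T ≥
log(1/δ)² + 1; this is the polynomial used. -/

namespace StabL

open scoped MatrixOrder

/-! ### Euclidean norms of coordinate vectors -/

section EuclideanNorm

variable {ι m n : Type*} [Fintype ι] [Fintype m] [Fintype n]

/-- The Euclidean norm of a coordinate vector. -/
noncomputable def eucNorm (v : ι → ℝ) : ℝ := ‖WithLp.toLp 2 v‖

theorem eucNorm_nonneg (v : ι → ℝ) : 0 ≤ eucNorm v := norm_nonneg _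

theorem eucNorm_sq (v : ι → ℝ) : eucNorm v ^ 2 = ∑ i, v i ^ 2 := by
  simp [eucNorm, EuclideanSpace.norm_sq_eq]

theorem eucNorm_sq_eq_dotProduct (v : ι → ℝ) : eucNorm v ^ 2 = v ⬝ᵥ v := by
  rw [eucNorm_sq]
  simp [dotProduct, sq]

theorem eucNorm_add_le (v w : ι → ℝ) : eucNorm (v + w) ≤ eucNorm v + eucNorm w := by
  simpa [eucNorm] using norm_add_le (WithLp.toLp 2 v) (WithLp.toLp 2 w)

theorem eucNorm_smul (c : ℝ) (v : ι → ℝ) : eucNorm (c • v) = |c| * eucNorm v := by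
  simp [eucNorm, WithLp.toLp_smul, norm_smul]

theorem eucNorm_sub_le (v w : ι → ℝ) : eucNorm (v - w) ≤ eucNorm v + eucNorm w := by
  simpa [eucNorm] using norm_sub_le (WithLp.toLp 2 v) (WithLp.toLp 2 w)

@[simp] theorem eucNorm_zero : eucNorm (0 : ι → ℝ) = 0 := by
  simp [eucNorm]

theorem eucNorm_sum_le {κ : Type*} (s : Finset κ) (f : κ → ι → ℝ) :
    eucNorm (∑ k ∈ s, f k) ≤ ∑ k ∈ s, eucNorm (f k) := by
  classical
  induction s using Finset.induction_on with
  | empty => simp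
  | insert a s ha ih =>
    rw [Finset.sum_insert ha, Finset.sum_insert ha]
    exact (eucNorm_add_le _ _).trans (by linarith)

theorem abs_dotProduct_le (v w : ι → ℝ) : |v ⬝ᵥ w| ≤ eucNorm v * eucNorm w := by
  apply abs_le_of_sq_le_sq _ (mul_nonneg (eucNorm_nonneg _) (eucNorm_nonneg _))
  rw [mul_pow, eucNorm_sq, eucNorm_sq]
  exact Finset.sum_mul_sq_le_sq_mul_sq _ _ _

theorem dotProduct_sq_le (v w : ι → ℝ) : (v ⬝ᵥ w) ^ 2 ≤ eucNorm v ^ 2 * eucNorm w ^ 2 := by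
  rw [eucNorm_sq, eucNorm_sq]
  exact Finset.sum_mul_sq_le_sq_mul_sq _ _ _

theorem abs_apply_le_eucNorm (v : ι → ℝ) (i : ι) : |v i| ≤ eucNorm v := by
  apply abs_le_of_sq_le_sq _ (eucNorm_nonneg _)
  rw [eucNorm_sq]
  exact Finset.single_le_sum (f := fun i => v i ^ 2) (fun _ _ => sq_nonneg _) (Finset.mem_univ i)

theorem eucNorm_le_of_abs_le {v : ι → ℝ} {c : ℝ} (hc : 0 ≤ c) (h : ∀ i, |v i| ≤ c) :
    eucNorm v ≤ Fintype.card ι * c := by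
  apply le_of_sq_le_sq _ (by positivity)
  rw [eucNorm_sq]
  have h1 : ∀ i ∈ Finset.univ, v i ^ 2 ≤ c ^ 2 := fun i _ =>
    sq_le_sq' (by linarith [neg_abs_le (v i), h i]) ((le_abs_self _).trans (h i))
  refine (Finset.sum_le_sum h1).trans ?_
  simp only [Finset.sum_const, Finset.card_univ, nsmul_eq_mul]
  rw [mul_pow]
  gcongr
  rcases Nat.eq_zero_or_pos (Fintype.card ι) with h0 | h0
  · simp [h0]
  · exact_mod_cast Nat.le_self_pow two_ne_zero _

theorem eucNorm_sumElim_sq (a : m → ℝ) (b : n → ℝ) :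
    eucNorm (Sum.elim a b) ^ 2 = eucNorm a ^ 2 + eucNorm b ^ 2 := by
  simp [eucNorm_sq]

theorem eucNorm_sumElim_le (a : m → ℝ) (b : n → ℝ) :
    eucNorm (Sum.elim a b) ≤ eucNorm a + eucNorm b := by
  apply le_of_sq_le_sq _ (add_nonneg (eucNorm_nonneg _) (eucNorm_nonneg _))
  rw [eucNorm_sumElim_sq]
  nlinarith [mul_nonneg (eucNorm_nonneg a) (eucNorm_nonneg b)]

theorem eucNorm_le_sumElim_left (a : m → ℝ) (b : n → ℝ) :
    eucNorm a ≤ eucNorm (Sum.elim a b) := by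
  apply le_of_sq_le_sq _ (eucNorm_nonneg _)
  rw [eucNorm_sumElim_sq]
  nlinarith [sq_nonneg (eucNorm b)]

theorem frobNorm_nonneg (M : Matrix m n ℝ) : 0 ≤ frobNorm M := Real.sqrt_nonneg _

theorem specNorm_nonneg [DecidableEq n] (M : Matrix m n ℝ) : 0 ≤ specNorm M := norm_nonneg _

theorem eucNorm_mulVec_le_specNorm [DecidableEq n] (M : Matrix m n ℝ) (v : n → ℝ) :
    eucNorm (M *ᵥ v) ≤ specNorm M * eucNorm v := by
  have := (LinearMap.toContinuousLinearMap (Matrix.toEuclideanLin M)).le_opNorm (WithLp.toLp 2 v)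
  simpa [specNorm, eucNorm, Matrix.toLpLin_toLp] using this

theorem eucNorm_mulVec_le_frobNorm (M : Matrix m n ℝ) (v : n → ℝ) :
    eucNorm (M *ᵥ v) ≤ frobNorm M * eucNorm v := by
  apply le_of_sq_le_sq _ (mul_nonneg (frobNorm_nonneg _) (eucNorm_nonneg _))
  rw [mul_pow, frobNorm_sq, eucNorm_sq, Finset.sum_mul]
  refine Finset.sum_le_sum fun i _ => ?_
  have := dotProduct_sq_le (M i) v
  rwa [eucNorm_sq (M i)] at this

theorem frobNorm_transpose (M : Matrix m n ℝ) : frobNorm Mᵀ = frobNorm M := by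
  unfold frobNorm
  rw [Finset.sum_comm]
  rfl

theorem specNorm_le_of_forall [DecidableEq n] {M : Matrix m n ℝ} {c : ℝ} (hc : 0 ≤ c)
    (h : ∀ v, eucNorm (M *ᵥ v) ≤ c * eucNorm v) : specNorm M ≤ c := by
  refine ContinuousLinearMap.opNorm_le_bound _ hc fun v => ?_
  have := h (WithLp.ofLp v)
  rw [eucNorm, eucNorm, WithLp.toLp_ofLp] at this
  exact this

theorem specNorm_le_frobNorm [DecidableEq n] (M : Matrix m n ℝ) : specNorm M ≤ frobNorm M :=
  specNorm_le_of_forall (frobNorm_nonneg _) (eucNorm_mulVec_le_frobNorm M)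

theorem frobNorm_eq_norm (M : Matrix m n ℝ) :
    frobNorm M = eucNorm (fun p : m × n => M p.1 p.2) := by
  rw [← Real.sqrt_sq (eucNorm_nonneg _), eucNorm_sq, Fintype.sum_prod_type]
  rfl

theorem frobNorm_sub_le (M N : Matrix m n ℝ) : frobNorm (M - N) ≤ frobNorm M + frobNorm N := by
  simp only [frobNorm_eq_norm]
  exact eucNorm_sub_le _ _

theorem frobNorm_smul (c : ℝ) (M : Matrix m n ℝ) : frobNorm (c • M) = |c| * frobNorm M := by
  simp only [frobNorm_eq_norm]
  exact eucNorm_smul _ _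

end EuclideanNorm

/-! ### Quadratic forms -/

section QuadraticForms

set_option linter.unusedSectionVars false

variable {m n : Type*} [Fintype m] [Fintype n] [DecidableEq m]

theorem posDef_isUnit_det {V : Matrix m m ℝ} (hV : V.PosDef) : IsUnit V.det :=
  (Matrix.isUnit_iff_isUnit_det _).1 hV.isUnit

theorem posDef_mulVec_inv_mulVec {V : Matrix m m ℝ} (hV : V.PosDef) (v : m → ℝ) :
    V *ᵥ (V⁻¹ *ᵥ v) = v := by
  rw [Matrix.mulVec_mulVec, Matrix.mul_nonsing_inv _ (posDef_isUnit_det hV), Matrix.one_mulVec]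

theorem posDef_inv_mulVec_mulVec {V : Matrix m m ℝ} (hV : V.PosDef) (v : m → ℝ) :
    V⁻¹ *ᵥ (V *ᵥ v) = v := by
  rw [Matrix.mulVec_mulVec, Matrix.nonsing_inv_mul _ (posDef_isUnit_det hV), Matrix.one_mulVec]

theorem posDef_transpose_eq {V : Matrix m m ℝ} (hV : V.PosDef) : Vᵀ = V := by
  have := hV.isHermitian.eq
  rwa [conjTranspose_eq_transpose_of_trivial] at this

theorem posDef_dotProduct_comm {V : Matrix m m ℝ} (hV : V.PosDef) (v w : m → ℝ) :
    v ⬝ᵥ V *ᵥ w = w ⬝ᵥ V *ᵥ v := by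
  rw [Matrix.dotProduct_mulVec, ← Matrix.mulVec_transpose, posDef_transpose_eq hV, dotProduct_comm]

theorem posDef_quad_nonneg {V : Matrix m m ℝ} (hV : V.PosDef) (v : m → ℝ) :
    0 ≤ v ⬝ᵥ V *ᵥ v := by
  simpa using hV.posSemidef.dotProduct_mulVec_nonneg v

/-- The form of `V` at v - tV⁻¹z is a nonnegative quadratic polynomial in t, so its discriminant is
nonpositive. This is Cauchy–Schwarz for the dual norms of V and V⁻¹. -/
theorem posDef_dotProduct_sq_le {V : Matrix m m ℝ} (hV : V.PosDef) (v z : m → ℝ) :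
    (v ⬝ᵥ z) ^ 2 ≤ (v ⬝ᵥ V *ᵥ v) * (z ⬝ᵥ V⁻¹ *ᵥ z) := by
  have key : ∀ t : ℝ, 0 ≤ (z ⬝ᵥ V⁻¹ *ᵥ z) * (t * t) + (-2 * (v ⬝ᵥ z)) * t + v ⬝ᵥ V *ᵥ v := by
    intro t
    have h := posDef_quad_nonneg hV (v - t • (V⁻¹ *ᵥ z))
    have e : V *ᵥ (v - t • (V⁻¹ *ᵥ z)) = V *ᵥ v - t • z := by
      rw [Matrix.mulVec_sub, Matrix.mulVec_smul, posDef_mulVec_inv_mulVec hV]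
    have e2 : (V⁻¹ *ᵥ z) ⬝ᵥ V *ᵥ v = v ⬝ᵥ z := by
      rw [posDef_dotProduct_comm hV, posDef_mulVec_inv_mulVec hV]
    rw [e] at h
    simp only [sub_dotProduct, dotProduct_sub, smul_dotProduct, dotProduct_smul, smul_eq_mul,
      e2] at h
    rw [dotProduct_comm (V⁻¹ *ᵥ z) z] at h
    linarith
  have := discrim_le_zero key
  rw [discrim] at this
  nlinarith

theorem trace_quad_eq_sum (V : Matrix m m ℝ) (M : Matrix m n ℝ) :
    (Mᵀ * V * M).trace = ∑ i, (fun k => M k i) ⬝ᵥ V *ᵥ (fun k => M k i) := by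
  unfold Matrix.trace
  refine Finset.sum_congr rfl fun i _ => ?_
  rw [Matrix.mul_assoc]
  rfl

theorem trace_quad_nonneg {V : Matrix m m ℝ} (hV : V.PosDef) (M : Matrix m n ℝ) :
    0 ≤ (Mᵀ * V * M).trace := by
  rw [trace_quad_eq_sum]
  exact Finset.sum_nonneg fun _ _ => posDef_quad_nonneg hV _

/-- Weighted Cauchy–Schwarz in each column. With M a difference of parameters, it turns membership
in a confidence set into a bound on the prediction error at z. -/
theorem eucNorm_transpose_mulVec_sq_le {V : Matrix m m ℝ} (hV : V.PosDef) (M : Matrix m n ℝ)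
    (z : m → ℝ) :
    eucNorm (Mᵀ *ᵥ z) ^ 2 ≤ (Mᵀ * V * M).trace * (z ⬝ᵥ V⁻¹ *ᵥ z) := by
  rw [eucNorm_sq, trace_quad_eq_sum, Finset.sum_mul]
  exact Finset.sum_le_sum fun i _ => posDef_dotProduct_sq_le hV (fun k => M k i) z

/-- Writing V = CᵀC makes each term the Frobenius norm of C times the matrix, for which the triangle
inequality is known. -/
theorem trace_quad_sub_le {V : Matrix m m ℝ} (hV : V.PosDef) (M N : Matrix m n ℝ) :
    √(((M - N)ᵀ * V * (M - N)).trace) ≤ √((Mᵀ * V * M).trace) + √((Nᵀ * V * N).trace) := by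
  obtain ⟨C, hC⟩ : ∃ C : Matrix m m ℝ, V = Cᵀ * C := by
    obtain ⟨C, hC⟩ := (CStarAlgebra.nonneg_iff_eq_star_mul_self (a := V)).1
      hV.posSemidef.nonneg
    exact ⟨C, by rw [hC, Matrix.star_eq_conjTranspose, conjTranspose_eq_transpose_of_trivial]⟩
  have key : ∀ X : Matrix m n ℝ, √((Xᵀ * V * X).trace) = frobNorm (C * X) := by
    intro X
    have : Xᵀ * V * X = (C * X)ᵀ * (C * X) := by
      rw [hC, Matrix.transpose_mul]
      simp only [Matrix.mul_assoc]
    rw [this, frobNorm, Finset.sum_comm]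
    congr 1
    refine Finset.sum_congr rfl fun i _ => Finset.sum_congr rfl fun j _ => ?_
    exact (sq ((C * X) j i)).symm
  rw [key, key, key, Matrix.mul_sub]
  exact frobNorm_sub_le _ _

theorem det_add_vecMulVec_self {V : Matrix m m ℝ} (hV : V.PosDef) (z : m → ℝ) :
    (V + vecMulVec z z).det = V.det * (1 + z ⬝ᵥ V⁻¹ *ᵥ z) := by
  have := Matrix.det_add_replicateCol_mul_replicateRow (ι := Unit) (posDef_isUnit_det hV) z z
  rw [← Matrix.vecMulVec_eq] at this
  rw [this]
  congr 1
  rw [Matrix.det_unique]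
  simp only [Matrix.add_apply, Matrix.one_apply_eq]
  congr 1
  rw [Matrix.mul_assoc]
  rfl

theorem posDef_add_vecMulVec_self {V : Matrix m m ℝ} (hV : V.PosDef) (z : m → ℝ) :
    (V + vecMulVec z z).PosDef :=
  hV.add_posSemidef (by simpa using Matrix.posSemidef_vecMulVec_self_star (R := ℝ) z)

theorem inv_quad_nonneg {V : Matrix m m ℝ} (hV : V.PosDef) (v : m → ℝ) :
    0 ≤ v ⬝ᵥ V⁻¹ *ᵥ v := posDef_quad_nonneg hV.inv v

/-- The Sherman–Morrison formula for the quadratic form of the inverse. -/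
theorem inv_quad_rank_one_update {V : Matrix m m ℝ} (hV : V.PosDef) (z S : m → ℝ) (w : ℝ) :
    (S + w • z) ⬝ᵥ (V + vecMulVec z z)⁻¹ *ᵥ (S + w • z)
      = S ⬝ᵥ V⁻¹ *ᵥ S + (-(z ⬝ᵥ V⁻¹ *ᵥ S) ^ 2 + 2 * w * (z ⬝ᵥ V⁻¹ *ᵥ S)
          + w ^ 2 * (z ⬝ᵥ V⁻¹ *ᵥ z)) / (1 + z ⬝ᵥ V⁻¹ *ᵥ z) := by
  have hr := inv_quad_nonneg hV z
  set r := z ⬝ᵥ V⁻¹ *ᵥ z with hrdef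
  set a := z ⬝ᵥ V⁻¹ *ᵥ S with ha
  have h1 : (1 + r) ≠ 0 := by positivity
  have hV' := posDef_add_vecMulVec_self hV z
  -- The right-hand side is an explicit candidate for the solution of the updated linear system; it
  -- is verified by applying V + zzᵀ.
  have e : (V + vecMulVec z z)⁻¹ *ᵥ (S + w • z)
      = V⁻¹ *ᵥ S + ((w - a) / (1 + r)) • V⁻¹ *ᵥ z := by
    rw [← posDef_inv_mulVec_mulVec hV' (V⁻¹ *ᵥ S + ((w - a) / (1 + r)) • V⁻¹ *ᵥ z)]
    congr 1
    rw [Matrix.mulVec_add, Matrix.mulVec_smul, Matrix.add_mulVec, Matrix.add_mulVec,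
      posDef_mulVec_inv_mulVec hV, posDef_mulVec_inv_mulVec hV, Matrix.vecMulVec_mulVec,
      Matrix.vecMulVec_mulVec]
    ext i
    simp only [Pi.add_apply, Pi.smul_apply, smul_eq_mul, ← ha, ← hrdef,
      MulOpposite.smul_eq_mul_unop, MulOpposite.unop_op]
    field_simp
    ring
  have hs : S ⬝ᵥ V⁻¹ *ᵥ z = a := posDef_dotProduct_comm hV.inv S z
  rw [e]
  simp only [add_dotProduct, dotProduct_add, smul_dotProduct, dotProduct_smul, smul_eq_mul, hs,
    ← ha, ← hrdef]
  field_simp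
  ring

/-- Testing the form on unit eigenvectors bounds every eigenvalue by c, and the determinant is their
product. -/
theorem det_le_of_quad_le {V : Matrix m m ℝ} (hV : V.PosDef) {c : ℝ}
    (h : ∀ v, v ⬝ᵥ V *ᵥ v ≤ c * eucNorm v ^ 2) : V.det ≤ c ^ Fintype.card m := by
  rw [hV.isHermitian.det_eq_prod_eigenvalues]
  have : ∀ i ∈ Finset.univ, hV.isHermitian.eigenvalues i ≤ c := by
    intro i _
    have h1 := h (hV.isHermitian.eigenvectorBasis i)
    rw [hV.isHermitian.mulVec_eigenvectorBasis i, dotProduct_smul, smul_eq_mul,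
      ← eucNorm_sq_eq_dotProduct] at h1
    have h2 : eucNorm (hV.isHermitian.eigenvectorBasis i : m → ℝ) = 1 :=
      hV.isHermitian.eigenvectorBasis.orthonormal.1 i
    rw [h2] at h1
    linarith
  have h3 := Finset.prod_le_prod (fun i _ => (hV.eigenvalues_pos i).le) this
  simpa using h3

end QuadraticForms

end StabL

namespace StabL

/-! ### Sub-Gaussian noise laws -/

/-- Centred laws on `ι → ℝ` with componentwise sub-Gaussian parameter `σ` and covariance `τ² I`. -/
structure IsNoiseLaw {ι : Type*} [DecidableEq ι] (μ : Measure (ι → ℝ)) (σ τ : ℝ) : Prop where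
  prob : IsProbabilityMeasure μ
  exp_le : ∀ i (s : ℝ), ∫⁻ y, ENNReal.ofReal (Real.exp (s * y i)) ∂μ
    ≤ ENNReal.ofReal (Real.exp (s ^ 2 * σ ^ 2 / 2))
  mean : ∀ i, ∫ y, y i ∂μ = 0
  cov : ∀ i j, ∫ y, y i * y j ∂μ = if i = j then τ ^ 2 else 0

/-- Completing the square in x. It is the computation behind the method of mixtures: integrating
exp(xw - x²σ²/2) against a Gaussian in x produces the self-normalized factor of one step. -/
theorem gaussianPDFReal_mul_exp {r σ : ℝ} (hr : 0 < r) (hσ : 0 < σ) (a w x : ℝ) :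
    gaussianPDFReal (a / σ ^ 2) (r / σ ^ 2).toNNReal x * Real.exp (x * w - x ^ 2 * σ ^ 2 / 2)
      = ((√(1 + r))⁻¹ * Real.exp ((-a ^ 2 + 2 * w * a + w ^ 2 * r) / (2 * σ ^ 2 * (1 + r))))
        * gaussianPDFReal ((w * r + a) / (σ ^ 2 * (1 + r)))
            (r / (σ ^ 2 * (1 + r))).toNNReal x := by
  have h1 : 0 < r / σ ^ 2 := by positivity
  have h2 : 0 < r / (σ ^ 2 * (1 + r)) := by positivity
  rw [gaussianPDFReal, gaussianPDFReal, Real.coe_toNNReal _ h1.le, Real.coe_toNNReal _ h2.le]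
  have e1 : √(2 * Real.pi * (r / σ ^ 2))
      = √(1 + r) * √(2 * Real.pi * (r / (σ ^ 2 * (1 + r)))) := by
    rw [← Real.sqrt_mul (by positivity)]
    congr 1
    field_simp
  rw [e1, mul_inv]
  have e2 : Real.exp (-(x - a / σ ^ 2) ^ 2 / (2 * (r / σ ^ 2)))
      * Real.exp (x * w - x ^ 2 * σ ^ 2 / 2)
      = Real.exp ((-a ^ 2 + 2 * w * a + w ^ 2 * r) / (2 * σ ^ 2 * (1 + r)))
        * Real.exp (-(x - (w * r + a) / (σ ^ 2 * (1 + r))) ^ 2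
            / (2 * (r / (σ ^ 2 * (1 + r))))) := by
    rw [← Real.exp_add, ← Real.exp_add]
    congr 1
    field_simp
    ring
  calc _ = (√(1 + r))⁻¹ * (√(2 * Real.pi * (r / (σ ^ 2 * (1 + r)))))⁻¹ *
        (Real.exp (-(x - a / σ ^ 2) ^ 2 / (2 * (r / σ ^ 2)))
          * Real.exp (x * w - x ^ 2 * σ ^ 2 / 2)) := by ring
    _ = _ := by rw [e2]; ring

theorem lintegral_gaussianReal_exp {r σ : ℝ} (hr : 0 < r) (hσ : 0 < σ) (a w : ℝ) :
    ∫⁻ x, ENNReal.ofReal (Real.exp (x * w - x ^ 2 * σ ^ 2 / 2))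
        ∂(gaussianReal (a / σ ^ 2) (r / σ ^ 2).toNNReal)
      = ENNReal.ofReal ((√(1 + r))⁻¹
          * Real.exp ((-a ^ 2 + 2 * w * a + w ^ 2 * r) / (2 * σ ^ 2 * (1 + r)))) := by
  have h1 : (r / σ ^ 2).toNNReal ≠ 0 := by
    have : 0 < r / σ ^ 2 := by positivity
    simpa using this
  have h2 : (r / (σ ^ 2 * (1 + r))).toNNReal ≠ 0 := by
    have : 0 < r / (σ ^ 2 * (1 + r)) := by positivity
    simpa using this
  rw [gaussianReal_of_var_ne_zero _ h1,
    lintegral_withDensity_eq_lintegral_mul _ (measurable_gaussianPDF _ _) (by fun_prop)]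
  have : ∀ x, (gaussianPDF (a / σ ^ 2) (r / σ ^ 2).toNNReal
        * fun x => ENNReal.ofReal (Real.exp (x * w - x ^ 2 * σ ^ 2 / 2))) x
      = ENNReal.ofReal ((√(1 + r))⁻¹
          * Real.exp ((-a ^ 2 + 2 * w * a + w ^ 2 * r) / (2 * σ ^ 2 * (1 + r))))
        * gaussianPDF ((w * r + a) / (σ ^ 2 * (1 + r))) (r / (σ ^ 2 * (1 + r))).toNNReal x := by
    intro x
    rw [Pi.mul_apply, gaussianPDF, gaussianPDF, ← ENNReal.ofReal_mul (gaussianPDFReal_nonneg _ _ _),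
      gaussianPDFReal_mul_exp hr hσ, ENNReal.ofReal_mul (by positivity)]
  simp_rw [this]
  rw [lintegral_const_mul _ (measurable_gaussianPDF _ _), lintegral_gaussianPDF_eq_one _ h2, mul_one]

/-! ### Exponential and polynomial moments of sub-Gaussian laws. -/

section NoiseLaw

set_option linter.unusedSectionVars false

variable {ι : Type*} [Fintype ι] [DecidableEq ι] {μ : Measure (ι → ℝ)} {σ τ : ℝ}

/-- One step of the self-normalized exponential supermartingale. -/
theorem IsNoiseLaw.lintegral_exp_quad_le (h : IsNoiseLaw μ σ τ) (hσ : 0 < σ) (i : ι) {r a : ℝ}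
    (hr : 0 ≤ r) (ha : r = 0 → a = 0) :
    ∫⁻ y, ENNReal.ofReal (Real.exp
      ((-a ^ 2 + 2 * y i * a + y i ^ 2 * r) / (2 * σ ^ 2 * (1 + r)))) ∂μ
      ≤ ENNReal.ofReal (√(1 + r)) := by
  have := h.prob
  -- For r = 0 the mixing Gaussian would be degenerate; then a = 0 and the integrand is 1.
  rcases hr.eq_or_lt with h0 | h0
  · simp [← h0, ha h0.symm]
  -- The integrand is √(1+r) times a Gaussian mixture over x of exp(x yᵢ - x²σ²/2). After Tonelli
  -- each of these has integral at most 1 by sub-Gaussianity.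
  have e : ∀ y : ι → ℝ, ENNReal.ofReal (Real.exp
      ((-a ^ 2 + 2 * y i * a + y i ^ 2 * r) / (2 * σ ^ 2 * (1 + r))))
      = ENNReal.ofReal (√(1 + r)) *
        ∫⁻ x, ENNReal.ofReal (Real.exp (x * y i - x ^ 2 * σ ^ 2 / 2))
        ∂(gaussianReal (a / σ ^ 2) (r / σ ^ 2).toNNReal) := by
    intro y
    rw [lintegral_gaussianReal_exp h0 hσ, ← ENNReal.ofReal_mul (by positivity), ← mul_assoc,
      mul_inv_cancel₀ (by positivity), one_mul]
  simp_rw [e]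
  rw [lintegral_const_mul]
  · refine mul_le_of_le_one_right zero_le ?_
    rw [lintegral_lintegral_swap]
    · calc _ ≤ ∫⁻ x : ℝ, 1 ∂(gaussianReal (a / σ ^ 2) (r / σ ^ 2).toNNReal) := by
            refine lintegral_mono fun x => ?_
            have : ∀ y : ι → ℝ, ENNReal.ofReal (Real.exp (x * y i - x ^ 2 * σ ^ 2 / 2))
                = ENNReal.ofReal (Real.exp (- (x ^ 2 * σ ^ 2 / 2)))
                  * ENNReal.ofReal (Real.exp (x * y i)) := by
              intro y
              rw [← ENNReal.ofReal_mul (by positivity), ← Real.exp_add]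
              congr 2
              ring
            simp only [this]
            rw [lintegral_const_mul _ (by fun_prop)]
            calc _ ≤ ENNReal.ofReal (Real.exp (- (x ^ 2 * σ ^ 2 / 2)))
                  * ENNReal.ofReal (Real.exp (x ^ 2 * σ ^ 2 / 2)) := by
                  gcongr
                  exact h.exp_le i x
              _ = 1 := by
                  rw [← ENNReal.ofReal_mul (by positivity), ← Real.exp_add]
                  simp
        _ = 1 := by simp
    · fun_prop
  · exact Measurable.lintegral_prod_right' (f := fun p : (ι → ℝ) × ℝ =>
      ENNReal.ofReal (Real.exp (p.2 * p.1 i - p.2 ^ 2 * σ ^ 2 / 2))) (by fun_prop)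

theorem pow_four_le_exp (y : ℝ) : y ^ 4 ≤ 24 * (Real.exp y + Real.exp (-y)) := by
  rcases le_total 0 y with h | h
  · have := Real.pow_div_factorial_le_exp y h 4
    have h2 := Real.exp_pos (-y)
    norm_num [Nat.factorial] at this
    linarith
  · have := Real.pow_div_factorial_le_exp (-y) (by linarith) 4
    have h2 := Real.exp_pos y
    norm_num [Nat.factorial] at this
    linarith

theorem IsNoiseLaw.integrable_exp (h : IsNoiseLaw μ σ τ) (i : ι) (s : ℝ) :
    Integrable (fun y => Real.exp (s * y i)) μ := by
  refine ⟨(by fun_prop : Measurable _).aestronglyMeasurable, ?_⟩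
  rw [hasFiniteIntegral_iff_ofReal (ae_of_all _ fun _ => (Real.exp_pos _).le)]
  exact (h.exp_le i s).trans_lt ENNReal.ofReal_lt_top

theorem IsNoiseLaw.integral_exp_le (h : IsNoiseLaw μ σ τ) (i : ι) (s : ℝ) :
    ∫ y, Real.exp (s * y i) ∂μ ≤ Real.exp (s ^ 2 * σ ^ 2 / 2) := by
  have := h.exp_le i s
  rw [← ofReal_integral_eq_lintegral_ofReal (h.integrable_exp i s)
    (ae_of_all _ fun _ => (Real.exp_pos _).le)] at this
  exact (ENNReal.ofReal_le_ofReal_iff (Real.exp_pos _).le).1 this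

theorem scaled_pow_four_le {σ : ℝ} (hσ : 0 < σ) (y : ℝ) :
    y ^ 4 ≤ σ ^ 4 * (24 * (Real.exp (σ⁻¹ * y) + Real.exp (-σ⁻¹ * y))) := by
  have := pow_four_le_exp (σ⁻¹ * y)
  calc y ^ 4 = σ ^ 4 * (σ⁻¹ * y) ^ 4 := by field_simp
    _ ≤ _ := by
      rw [neg_mul]
      gcongr

theorem IsNoiseLaw.integrable_pow_four (h : IsNoiseLaw μ σ τ) (hσ : 0 < σ) (i : ι) :
    Integrable (fun y => y i ^ 4) μ := by
  refine Integrable.mono' ((((h.integrable_exp i σ⁻¹).add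
    (h.integrable_exp i (-σ⁻¹))).const_mul 24).const_mul (σ ^ 4))
    (by fun_prop : Measurable _).aestronglyMeasurable ?_
  refine ae_of_all _ fun y => ?_
  rw [Real.norm_of_nonneg (by positivity)]
  exact scaled_pow_four_le hσ (y i)

theorem IsNoiseLaw.integral_pow_four_le (h : IsNoiseLaw μ σ τ) (hσ : 0 < σ) (i : ι) :
    ∫ y, y i ^ 4 ∂μ ≤ 96 * σ ^ 4 := by
  -- At scale s = ±1/σ each exponential moment is at most e^{1/2} ≤ 2, whence 96 = 24·(2+2).
  have hE : Real.exp (1 / 2) ≤ 2 := by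
    have h1 : Real.exp (1 / 2) ^ 2 = Real.exp 1 := by rw [← Real.exp_nat_mul]; norm_num
    have h2 := Real.exp_one_lt_d9
    nlinarith [Real.exp_pos (1 / 2)]
  calc ∫ y, y i ^ 4 ∂μ
      ≤ ∫ y, σ ^ 4 * (24 * (Real.exp (σ⁻¹ * y i) + Real.exp (-σ⁻¹ * y i))) ∂μ :=
        integral_mono (h.integrable_pow_four hσ i) ((((h.integrable_exp i σ⁻¹).add
          (h.integrable_exp i (-σ⁻¹))).const_mul 24).const_mul (σ ^ 4))
          fun y => scaled_pow_four_le hσ (y i)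
    _ = σ ^ 4 * (24 * (∫ y, Real.exp (σ⁻¹ * y i) ∂μ + ∫ y, Real.exp (-σ⁻¹ * y i) ∂μ)) := by
        rw [integral_const_mul, integral_const_mul,
          integral_add (h.integrable_exp i σ⁻¹) (h.integrable_exp i (-σ⁻¹))]
    _ ≤ σ ^ 4 * (24 * (2 + 2)) := by
        have e1 : σ⁻¹ ^ 2 * σ ^ 2 / 2 = 1 / 2 := by field_simp
        have e2 : (-σ⁻¹) ^ 2 * σ ^ 2 / 2 = 1 / 2 := by rw [neg_sq]; exact e1
        have h1 := h.integral_exp_le i σ⁻¹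
        have h2 := h.integral_exp_le i (-σ⁻¹)
        rw [e1] at h1
        rw [e2] at h2
        gcongr <;> linarith
    _ = 96 * σ ^ 4 := by ring

theorem IsNoiseLaw.integrable_apply (h : IsNoiseLaw μ σ τ) (hσ : 0 < σ) (i : ι) :
    Integrable (fun y => y i) μ := by
  have := h.prob
  refine Integrable.mono' ((integrable_const (1 : ℝ)).add (h.integrable_pow_four hσ i))
    (by fun_prop : Measurable _).aestronglyMeasurable (ae_of_all _ fun y => ?_)
  simp only [Pi.add_apply, Real.norm_eq_abs]
  rcases le_total |y i| 1 with h1 | h1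
  · have : 0 ≤ y i ^ 4 := by positivity
    linarith
  · have : |y i| ≤ |y i| ^ 4 := le_self_pow₀ h1 (by norm_num)
    rw [Even.pow_abs (n := 4) ⟨2, rfl⟩] at this
    linarith

theorem IsNoiseLaw.integrable_mul (h : IsNoiseLaw μ σ τ) (hσ : 0 < σ) (i j : ι) :
    Integrable (fun y => y i * y j) μ := by
  have := h.prob
  refine Integrable.mono' (((integrable_const (1 : ℝ)).add (h.integrable_pow_four hσ i)).add
    (h.integrable_pow_four hσ j)) (by fun_prop : Measurable _).aestronglyMeasurable (ae_of_all _ fun y => ?_)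
  simp only [Pi.add_apply, Real.norm_eq_abs, abs_mul]
  nlinarith [sq_nonneg (|y i| - |y j|), sq_nonneg (|y i| ^ 2 - 1), sq_nonneg (|y j| ^ 2 - 1),
    Even.pow_abs (n := 4) ⟨2, rfl⟩ (y i), Even.pow_abs (n := 4) ⟨2, rfl⟩ (y j)]

theorem IsNoiseLaw.integrable_dotProduct (h : IsNoiseLaw μ σ τ) (hσ : 0 < σ) (a : ι → ℝ) :
    Integrable (fun y => a ⬝ᵥ y) μ :=
  integrable_finsetSum _ fun i _ => (h.integrable_apply hσ i).const_mul (a i)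

theorem IsNoiseLaw.integral_dotProduct (h : IsNoiseLaw μ σ τ) (hσ : 0 < σ) (a : ι → ℝ) :
    ∫ y, a ⬝ᵥ y ∂μ = 0 := by
  simp only [dotProduct]
  rw [integral_finsetSum _ fun i _ => (h.integrable_apply hσ i).const_mul (a i)]
  simp [integral_const_mul, h.mean]

theorem dotProduct_sq_eq_sum (a y : ι → ℝ) :
    (a ⬝ᵥ y) ^ 2 = ∑ i, ∑ j, a i * a j * (y i * y j) := by
  rw [sq, dotProduct, Finset.sum_mul_sum]
  exact Finset.sum_congr rfl fun i _ => Finset.sum_congr rfl fun j _ => by ring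

theorem IsNoiseLaw.integrable_dotProduct_sq (h : IsNoiseLaw μ σ τ) (hσ : 0 < σ) (a : ι → ℝ) :
    Integrable (fun y => (a ⬝ᵥ y) ^ 2) μ := by
  simp only [dotProduct_sq_eq_sum]
  exact integrable_finsetSum _ fun i _ => integrable_finsetSum _ fun j _ =>
    (h.integrable_mul hσ i j).const_mul _

theorem IsNoiseLaw.integral_dotProduct_sq (h : IsNoiseLaw μ σ τ) (hσ : 0 < σ) (a : ι → ℝ) :
    ∫ y, (a ⬝ᵥ y) ^ 2 ∂μ = τ ^ 2 * eucNorm a ^ 2 := by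
  simp only [dotProduct_sq_eq_sum]
  rw [integral_finsetSum _ fun i _ => integrable_finsetSum _ fun j _ =>
    (h.integrable_mul hσ i j).const_mul _]
  have : ∀ i, ∫ y, ∑ j, a i * a j * (y i * y j) ∂μ = τ ^ 2 * a i ^ 2 := by
    intro i
    rw [integral_finsetSum _ fun j _ => (h.integrable_mul hσ i j).const_mul _]
    simp only [integral_const_mul, h.cov, mul_ite, mul_zero, Finset.sum_ite_eq, Finset.mem_univ,
      if_true]
    ring
  simp only [this]
  rw [eucNorm_sq, Finset.mul_sum]

theorem dotProduct_pow_four_le (a y : ι → ℝ) :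
    (a ⬝ᵥ y) ^ 4 ≤ eucNorm a ^ 4 * (Fintype.card ι * ∑ i, y i ^ 4) := by
  have h1 := dotProduct_sq_le a y
  have h2 : (eucNorm y ^ 2) ^ 2 ≤ Fintype.card ι * ∑ i, y i ^ 4 := by
    rw [eucNorm_sq]
    have := sq_sum_le_card_mul_sum_sq (s := (Finset.univ : Finset ι)) (f := fun i => y i ^ 2)
    simp only [Finset.card_univ, ← pow_mul] at this
    exact this
  calc (a ⬝ᵥ y) ^ 4 = ((a ⬝ᵥ y) ^ 2) ^ 2 := by ring
    _ ≤ (eucNorm a ^ 2 * eucNorm y ^ 2) ^ 2 := by gcongr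
    _ = eucNorm a ^ 4 * (eucNorm y ^ 2) ^ 2 := by ring
    _ ≤ _ := by gcongr

theorem IsNoiseLaw.integrable_dotProduct_pow_four (h : IsNoiseLaw μ σ τ) (hσ : 0 < σ)
    (a : ι → ℝ) : Integrable (fun y => (a ⬝ᵥ y) ^ 4) μ := by
  refine Integrable.mono' (((integrable_finsetSum Finset.univ fun i _ =>
    h.integrable_pow_four hσ i).const_mul (Fintype.card ι : ℝ)).const_mul (eucNorm a ^ 4))
    (by fun_prop : Measurable _).aestronglyMeasurable (ae_of_all _ fun y => ?_)
  rw [Real.norm_of_nonneg (by positivity)]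
  exact dotProduct_pow_four_le a y

theorem IsNoiseLaw.integral_dotProduct_pow_four_le (h : IsNoiseLaw μ σ τ) (hσ : 0 < σ)
    (a : ι → ℝ) :
    ∫ y, (a ⬝ᵥ y) ^ 4 ∂μ ≤ eucNorm a ^ 4 * (Fintype.card ι ^ 2 * (96 * σ ^ 4)) := by
  calc _ ≤ ∫ y, eucNorm a ^ 4 * (Fintype.card ι * ∑ i, y i ^ 4) ∂μ :=
        integral_mono (h.integrable_dotProduct_pow_four hσ a)
          (((integrable_finsetSum Finset.univ fun i _ =>
            h.integrable_pow_four hσ i).const_mul (Fintype.card ι : ℝ)).const_mul _)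
          fun y => dotProduct_pow_four_le a y
    _ = eucNorm a ^ 4 * (Fintype.card ι * ∑ i, ∫ y, y i ^ 4 ∂μ) := by
        rw [integral_const_mul, integral_const_mul,
          integral_finsetSum _ fun i _ => h.integrable_pow_four hσ i]
    _ ≤ eucNorm a ^ 4 * (Fintype.card ι * ∑ _i : ι, 96 * σ ^ 4) := by
        gcongr with i
        exact h.integral_pow_four_le hσ i
    _ = _ := by
        simp only [Finset.sum_const, Finset.card_univ, nsmul_eq_mul]
        ring

end NoiseLaw

/-! ### Small-ball estimate -/

/-- A polynomial minorant of the truncated square, so that second and fourth moments control it; the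
bound by 1 is (θy²/2 - 1)² ≥ 0. -/
theorem min_sq_one_ge {θ : ℝ} (h1 : θ ≤ 1) (y : ℝ) :
    θ * y ^ 2 - θ ^ 2 / 4 * y ^ 4 ≤ min (y ^ 2) 1 := by
  have hy := sq_nonneg y
  refine le_min ?_ ?_
  · have : 0 ≤ θ ^ 2 / 4 * y ^ 4 := by positivity
    nlinarith
  · nlinarith [sq_nonneg (θ * y ^ 2 / 2 - 1)]

theorem add_pow_four_le (g x : ℝ) : (g + x) ^ 4 ≤ 8 * (g ^ 4 + x ^ 4) := by
  nlinarith [sq_nonneg (g - x), sq_nonneg (g + x), sq_nonneg (g ^ 2 - x ^ 2),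
    mul_nonneg (sq_nonneg (g - x)) (sq_nonneg (g + x)), sq_nonneg ((g - x) ^ 2)]

/-- A Paley–Zygmund type bound that is uniform in the shift g. This uniformity allows everything
already known about the trajectory to be put into g. -/
theorem integral_min_sq_one_ge {α : Type*} [MeasurableSpace α] {μ : Measure α}
    [IsProbabilityMeasure μ] {X : α → ℝ} (hm : Measurable X) (h1 : Integrable X μ)
    (h2 : Integrable (fun a => X a ^ 2) μ) (h4 : Integrable (fun a => X a ^ 4) μ)
    (hX1 : ∫ a, X a ∂μ = 0) {s C : ℝ} (hs : 0 < s) (hs1 : s ≤ 1) (hC : 1 ≤ C)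
    (hX2 : s ≤ ∫ a, X a ^ 2 ∂μ) (hX4 : ∫ a, X a ^ 4 ∂μ ≤ C) (g : ℝ) :
    s ^ 2 / (8 * C) ≤ ∫ a, min ((g + X a) ^ 2) 1 ∂μ := by
  -- The second moment of g + X is at least s(1+g²), and its fourth is at most 8C(1+g²)². Taking θ
  -- inversely proportional to 1+g² removes g and leaves s²/(4C) - s²/(8C).
  set θ := s / (4 * C) / (1 + g ^ 2) with hθ
  have hC0 : 0 < C := by linarith
  have hg : 1 ≤ 1 + g ^ 2 := by nlinarith [sq_nonneg g]
  have hg0 : 0 < 1 + g ^ 2 := by linarith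
  have hθ0 : 0 ≤ θ := by positivity
  have hθ1 : θ ≤ 1 := by
    rw [hθ, div_div, div_le_one (by positivity)]
    nlinarith
  have e2 : ∀ a, (g + X a) ^ 2 = (g ^ 2 + 2 * g * X a) + X a ^ 2 := fun a => by ring
  have i2 : Integrable (fun a => (g + X a) ^ 2) μ := by
    simp only [e2]
    exact ((integrable_const _).add (h1.const_mul _)).add h2
  have i4' : Integrable (fun a => 8 * (g ^ 4 + X a ^ 4)) μ :=
    ((integrable_const _).add h4).const_mul _
  have i1 : Integrable (fun a => g ^ 2 + 2 * g * X a) μ :=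
    (integrable_const _).add (h1.const_mul _)
  have m2 : g ^ 2 + s ≤ ∫ a, (g + X a) ^ 2 ∂μ := by
    simp only [e2]
    rw [integral_add i1 h2, integral_add (integrable_const _) (h1.const_mul _), integral_const_mul, hX1]
    simpa using hX2
  calc s ^ 2 / (8 * C) ≤ θ * (g ^ 2 + s) - θ ^ 2 / 4 * (8 * (g ^ 4 + C)) := by
        have k1 : s * (1 + g ^ 2) ≤ g ^ 2 + s := by nlinarith [sq_nonneg g]
        have k2 : g ^ 4 + C ≤ C * (1 + g ^ 2) ^ 2 := by
          nlinarith [sq_nonneg g, mul_nonneg hC0.le (sq_nonneg g), sq_nonneg (g ^ 2)]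
        have k3 : θ * (1 + g ^ 2) = s / (4 * C) := by
          rw [hθ]; field_simp
        calc s ^ 2 / (8 * C) = s * (s / (4 * C)) - (s / (4 * C)) ^ 2 / 4 * (8 * C) := by
              field_simp; ring
          _ = θ * (s * (1 + g ^ 2)) - θ ^ 2 / 4 * (8 * (C * (1 + g ^ 2) ^ 2)) := by
              rw [← k3]; ring
          _ ≤ _ := by gcongr
    _ ≤ θ * ∫ a, (g + X a) ^ 2 ∂μ - θ ^ 2 / 4 * ∫ a, 8 * (g ^ 4 + X a ^ 4) ∂μ := by
        have : ∫ a, 8 * (g ^ 4 + X a ^ 4) ∂μ ≤ 8 * (g ^ 4 + C) := by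
          rw [integral_const_mul, integral_add (integrable_const _) h4]
          simp only [integral_const, probReal_univ, one_smul]
          linarith
        gcongr
    _ = ∫ a, (θ * (g + X a) ^ 2 - θ ^ 2 / 4 * (8 * (g ^ 4 + X a ^ 4))) ∂μ := by
        rw [integral_sub (i2.const_mul _) (i4'.const_mul _), integral_const_mul θ,
          integral_const_mul (θ ^ 2 / 4)]
    _ ≤ _ := by
        refine integral_mono ((i2.const_mul _).sub (i4'.const_mul _)) ?_ fun a => ?_
        · refine Integrable.mono' (integrable_const (1 : ℝ)) (by fun_prop) (ae_of_all _ fun a => ?_)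
          rw [Real.norm_of_nonneg (by positivity)]
          exact min_le_right _ _
        · have := min_sq_one_ge hθ1 (g + X a)
          have h8 := add_pow_four_le g (X a)
          have : θ ^ 2 / 4 * (g + X a) ^ 4 ≤ θ ^ 2 / 4 * (8 * (g ^ 4 + X a ^ 4)) := by gcongr
          simp only
          linarith

/-- Uses exp(-x) ≤ 1 - x/2 on [0,1]. The exponential form is the one that multiplies along the
trajectory in the Chernoff argument. -/
theorem lintegral_exp_neg_min_le {α : Type*} [MeasurableSpace α] {μ : Measure α}
    [IsProbabilityMeasure μ] {Y : α → ℝ} (hm : Measurable Y) {q : ℝ}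
    (hq : q ≤ ∫ a, min (Y a ^ 2) 1 ∂μ) :
    ∫⁻ a, ENNReal.ofReal (Real.exp (-min (Y a ^ 2) 1)) ∂μ ≤ ENNReal.ofReal (1 - q / 2) := by
  have im : Integrable (fun a => min (Y a ^ 2) 1) μ := by
    refine Integrable.mono' (integrable_const (1 : ℝ)) (by fun_prop) (ae_of_all _ fun a => ?_)
    rw [Real.norm_of_nonneg (by positivity)]
    exact min_le_right _ _
  have key : ∀ x : ℝ, 0 ≤ x → x ≤ 1 → Real.exp (-x) ≤ 1 - x / 2 := by
    intro x h0 h1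
    have h2 := Real.quadratic_le_exp_of_nonneg h0
    rw [Real.exp_neg, inv_le_iff_one_le_mul₀ (Real.exp_pos x)]
    nlinarith [mul_nonneg h0 h0, mul_nonneg h0 (sub_nonneg.2 h1),
      mul_nonneg (mul_nonneg h0 h0) (sub_nonneg.2 h1)]
  have ih : Integrable (fun a => 1 - min (Y a ^ 2) 1 / 2) μ :=
    (integrable_const _).sub (im.div_const 2)
  calc _ ≤ ∫⁻ a, ENNReal.ofReal (1 - min (Y a ^ 2) 1 / 2) ∂μ := by
        refine lintegral_mono fun a => ENNReal.ofReal_le_ofReal ?_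
        exact key _ (by positivity) (min_le_right _ _)
    _ = ENNReal.ofReal (∫ a, (1 - min (Y a ^ 2) 1 / 2) ∂μ) := by
        rw [ofReal_integral_eq_lintegral_ofReal ih]
        refine ae_of_all _ fun a => ?_
        have : min (Y a ^ 2) 1 ≤ 1 := min_le_right _ _
        simp only [Pi.zero_apply]
        linarith
    _ ≤ _ := by
        apply ENNReal.ofReal_le_ofReal
        rw [integral_sub (integrable_const _) (im.div_const 2), integral_div]
        simp only [integral_const, probReal_univ, one_smul]
        linarith

end StabL

namespace StabL

theorem isNoiseLaw_pi_gaussianReal {ι : Type*} [Fintype ι] [DecidableEq ι] (v : NNReal) :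
    IsNoiseLaw (Measure.pi fun _ : ι => gaussianReal 0 v) (√v) (√v) where
  prob := inferInstance
  exp_le i s := by
    have h := (measurePreserving_eval (fun _ : ι => gaussianReal 0 v) i).lintegral_comp
      (f := fun x => ENNReal.ofReal (Real.exp (s * x))) (by fun_prop)
    simp only [Function.eval] at h
    rw [h, ← ofReal_integral_eq_lintegral_ofReal (integrable_exp_mul_gaussianReal s)
      (ae_of_all _ fun _ => (Real.exp_pos _).le)]
    have h2 := mgf_gaussianReal (p := gaussianReal 0 v) (X := id) (μ := 0) (v := v) (by simp) s
    simp only [mgf, id, zero_mul, zero_add] at h2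
    rw [h2, Real.sq_sqrt v.coe_nonneg, mul_comm]
  mean i := by
    have h := integral_map (μ := Measure.pi fun _ : ι => gaussianReal 0 v)
      (measurable_pi_apply i).aemeasurable (f := fun x : ℝ => x) (by fun_prop)
    rw [← h, (measurePreserving_eval (fun _ : ι => gaussianReal 0 v) i).map_eq]
    exact integral_id_gaussianReal
  cov i j := by
    have hid : ∀ k, ∫ y, y k ∂(Measure.pi fun _ : ι => gaussianReal 0 v) = 0 := by
      intro k
      have h := integral_map (μ := Measure.pi fun _ : ι => gaussianReal 0 v)
        (measurable_pi_apply k).aemeasurable (f := fun x : ℝ => x) (by fun_prop)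
      rw [← h, (measurePreserving_eval (fun _ : ι => gaussianReal 0 v) k).map_eq]
      exact integral_id_gaussianReal
    split_ifs with hij
    · subst hij
      have h := integral_map (μ := Measure.pi fun _ : ι => gaussianReal 0 v)
        (measurable_pi_apply i).aemeasurable (f := fun x : ℝ => x * x) (by fun_prop)
      rw [← h, (measurePreserving_eval (fun _ : ι => gaussianReal 0 v) i).map_eq,
        Real.sq_sqrt v.coe_nonneg]
      have h2 := variance_id_gaussianReal (μ := 0) (v := v)
      rw [variance_of_integral_eq_zero (by fun_prop) (by simp)] at h2
      simpa [sq] using h2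
    · have hind := (iIndepFun_pi (μ := fun _ : ι => gaussianReal 0 v)
        (X := fun _ x => x) (fun i => aemeasurable_id)).indepFun hij
      have := hind.integral_fun_mul_eq_mul_integral
        (measurable_pi_apply i).aestronglyMeasurable (measurable_pi_apply j).aestronglyMeasurable
      rw [this, hid, zero_mul]

section SmallBall

variable {ι κ : Type*} [Fintype ι] [DecidableEq ι] [Fintype κ] [DecidableEq κ]
  {μ : Measure (ι → ℝ)} {γ : Measure (κ → ℝ)} {σ τ σ' τ' : ℝ}

/-- Under the product law the sum a·y + b·q is centred, its cross term vanishes, and both moments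
are explicit, so the shifted small-ball bound applies. -/
theorem lintegral_exp_neg_min_dotProduct_le (hμ : IsNoiseLaw μ σ τ) (hγ : IsNoiseLaw γ σ' τ')
    (hσ : 0 < σ) (hσ' : 0 < σ') {a : ι → ℝ} {b : κ → ℝ} {s C : ℝ} (hs : 0 < s) (hs1 : s ≤ 1)
    (hC : 1 ≤ C) (h2 : s ≤ τ ^ 2 * eucNorm a ^ 2 + τ' ^ 2 * eucNorm b ^ 2)
    (h4 : 8 * (eucNorm a ^ 4 * (Fintype.card ι ^ 2 * (96 * σ ^ 4))
      + eucNorm b ^ 4 * (Fintype.card κ ^ 2 * (96 * σ' ^ 4))) ≤ C) (g : ℝ) :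
    ∫⁻ y, ∫⁻ q, ENNReal.ofReal (Real.exp (-min ((g + (a ⬝ᵥ y + b ⬝ᵥ q)) ^ 2) 1)) ∂γ ∂μ
      ≤ ENNReal.ofReal (1 - s ^ 2 / (8 * C) / 2) := by
  have := hμ.prob
  have := hγ.prob
  have ha1 := (hμ.integrable_dotProduct hσ a).comp_fst γ
  have hb1 := (hγ.integrable_dotProduct hσ' b).comp_snd μ
  have ha2 := (hμ.integrable_dotProduct_sq hσ a).comp_fst γ
  have hb2 := (hγ.integrable_dotProduct_sq hσ' b).comp_snd μ
  have hab := ((hμ.integrable_dotProduct hσ a).mul_prod (hγ.integrable_dotProduct hσ' b)).const_mul 2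
  have ha4 := (hμ.integrable_dotProduct_pow_four hσ a).comp_fst γ
  have hb4 := (hγ.integrable_dotProduct_pow_four hσ' b).comp_snd μ
  have esq : ∀ z : (ι → ℝ) × (κ → ℝ), (a ⬝ᵥ z.1 + b ⬝ᵥ z.2) ^ 2
      = ((a ⬝ᵥ z.1) ^ 2 + 2 * ((a ⬝ᵥ z.1) * (b ⬝ᵥ z.2))) + (b ⬝ᵥ z.2) ^ 2 := fun z => by ring
  have hab2 : Integrable (fun z : (ι → ℝ) × (κ → ℝ) =>
      (a ⬝ᵥ z.1) ^ 2 + 2 * ((a ⬝ᵥ z.1) * (b ⬝ᵥ z.2))) (μ.prod γ) := ha2.add hab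
  have i2 : Integrable (fun z : (ι → ℝ) × (κ → ℝ) => (a ⬝ᵥ z.1 + b ⬝ᵥ z.2) ^ 2) (μ.prod γ) := by
    simp only [esq]
    exact hab2.add hb2
  have i8 : Integrable (fun z : (ι → ℝ) × (κ → ℝ) =>
      8 * ((a ⬝ᵥ z.1) ^ 4 + (b ⬝ᵥ z.2) ^ 4)) (μ.prod γ) := (ha4.add hb4).const_mul 8
  have i4 : Integrable (fun z : (ι → ℝ) × (κ → ℝ) => (a ⬝ᵥ z.1 + b ⬝ᵥ z.2) ^ 4) (μ.prod γ) := by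
    refine i8.mono' (by fun_prop : Measurable _).aestronglyMeasurable (ae_of_all _ fun z => ?_)
    rw [Real.norm_of_nonneg (by positivity)]
    exact add_pow_four_le _ _
  have m1 : ∫ z, (a ⬝ᵥ z.1 + b ⬝ᵥ z.2) ∂(μ.prod γ) = 0 := by
    rw [integral_add ha1 hb1, integral_fun_fst (fun y => a ⬝ᵥ y),
      integral_fun_snd (fun y => b ⬝ᵥ y), hμ.integral_dotProduct hσ, hγ.integral_dotProduct hσ']
    simp
  have m2 : ∫ z, (a ⬝ᵥ z.1 + b ⬝ᵥ z.2) ^ 2 ∂(μ.prod γ)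
      = τ ^ 2 * eucNorm a ^ 2 + τ' ^ 2 * eucNorm b ^ 2 := by
    simp only [esq]
    rw [integral_add hab2 hb2, integral_add ha2 hab, integral_const_mul,
      integral_prod_mul (fun y => a ⬝ᵥ y) (fun y => b ⬝ᵥ y),
      integral_fun_fst (fun y => (a ⬝ᵥ y) ^ 2),
      integral_fun_snd (fun y => (b ⬝ᵥ y) ^ 2), hμ.integral_dotProduct hσ,
      hμ.integral_dotProduct_sq hσ, hγ.integral_dotProduct_sq hσ']
    simp
  have m4 : ∫ z, (a ⬝ᵥ z.1 + b ⬝ᵥ z.2) ^ 4 ∂(μ.prod γ) ≤ C := by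
    calc _ ≤ ∫ z : (ι → ℝ) × (κ → ℝ), 8 * ((a ⬝ᵥ z.1) ^ 4 + (b ⬝ᵥ z.2) ^ 4) ∂(μ.prod γ) :=
          integral_mono i4 i8 fun z => add_pow_four_le _ _
      _ = 8 * (∫ y, (a ⬝ᵥ y) ^ 4 ∂μ + ∫ y, (b ⬝ᵥ y) ^ 4 ∂γ) := by
          rw [integral_const_mul, integral_add ha4 hb4, integral_fun_fst (fun y => (a ⬝ᵥ y) ^ 4),
            integral_fun_snd (fun y => (b ⬝ᵥ y) ^ 4)]
          simp
      _ ≤ _ := by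
          refine le_trans ?_ h4
          gcongr
          · exact hμ.integral_dotProduct_pow_four_le hσ a
          · exact hγ.integral_dotProduct_pow_four_le hσ' b
  have key := integral_min_sq_one_ge (μ := μ.prod γ) (X := fun z => a ⬝ᵥ z.1 + b ⬝ᵥ z.2)
    (by fun_prop) (ha1.add hb1) i2 i4 m1 hs hs1 hC (by rw [m2]; exact h2) m4 g
  have := lintegral_exp_neg_min_le (μ := μ.prod γ) (by fun_prop) key
  rwa [lintegral_prod _ (by fun_prop : Measurable _).aemeasurable] at this

end SmallBall

/-! ### Conditional integration of the noise -/

section Conditional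

set_option linter.unusedSectionVars false

variable {Ω : Type*} {mΩ : MeasurableSpace Ω} {P : Measure Ω} [IsProbabilityMeasure P]
  {ℱ : Filtration ℕ mΩ} {n d : ℕ} {σw σbar σνsq : ℝ} {w : ℕ → Ω → Fin n → ℝ}
  {ν : ℕ → Ω → Fin d → ℝ} {𝒳 : Type*} [m𝒳 : MeasurableSpace 𝒳]

/-- The tower property descends from ℱ t to the σ-algebra of X, and conditional expectation given X
is integration against a regular conditional law. Conditional hypotheses thus become properties of
honest measures. -/
theorem ae_integral_condDistrib_le {Y : Ω → Fin n → ℝ} (hY : Measurable Y) {t : ℕ} {X : Ω → 𝒳}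
    (hX : Measurable[ℱ t] X) {f : (Fin n → ℝ) → ℝ} (hf : Measurable f)
    (hint : Integrable (fun ω => f (Y ω)) P) {c : ℝ}
    (hc : P[fun ω => f (Y ω) | ℱ t] ≤ᵐ[P] fun _ => c) :
    ∀ᵐ x ∂(P.map X), ∫ y, f y ∂(condDistrib Y X P x) ≤ c := by
  have hX' : Measurable X := hX.mono (ℱ.le t) le_rfl
  have hle : m𝒳.comap X ≤ ℱ t := hX.comap_le
  have h1 := condExp_ae_eq_integral_condDistrib hX' hY.aemeasurable hf.stronglyMeasurable hint
  have h2 : P[P[fun ω => f (Y ω) | ℱ t] | m𝒳.comap X] =ᵐ[P] P[fun ω => f (Y ω) | m𝒳.comap X] :=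
    condExp_condExp_of_le hle (ℱ.le t)
  have h3 : P[P[fun ω => f (Y ω) | ℱ t] | m𝒳.comap X] ≤ᵐ[P] P[fun _ => c | m𝒳.comap X] :=
    condExp_mono integrable_condExp (integrable_const c) hc
  rw [condExp_const (hle.trans (ℱ.le t))] at h3
  rw [ae_map_iff hX'.aemeasurable]
  · filter_upwards [h1, h2, h3] with ω e1 e2 e3
    rw [← e1, ← e2]
    exact e3
  · exact (StronglyMeasurable.integral_condDistrib (X := X) (Y := Y) (μ := P)
      (hf.comp measurable_snd).stronglyMeasurable).measurable measurableSet_Iic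

theorem ae_integral_condDistrib_eq {Y : Ω → Fin n → ℝ} (hY : Measurable Y) {t : ℕ} {X : Ω → 𝒳}
    (hX : Measurable[ℱ t] X) {f : (Fin n → ℝ) → ℝ} (hf : Measurable f)
    (hint : Integrable (fun ω => f (Y ω)) P) {c : ℝ}
    (hc : P[fun ω => f (Y ω) | ℱ t] =ᵐ[P] fun _ => c) :
    ∀ᵐ x ∂(P.map X), ∫ y, f y ∂(condDistrib Y X P x) = c := by
  have h1 := ae_integral_condDistrib_le hY hX hf hint hc.le
  have hn : P[fun ω => -f (Y ω) | ℱ t] ≤ᵐ[P] fun _ => -c := by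
    have := condExp_neg (μ := P) (fun ω => f (Y ω)) (ℱ t)
    filter_upwards [this, hc] with ω e1 e2
    have e3 : (P[fun ω => -f (Y ω) | ℱ t]) ω = _ := e1
    rw [e3, Pi.neg_apply, e2]
  have h2 := ae_integral_condDistrib_le hY hX hf.neg hint.neg hn
  filter_upwards [h1, h2] with x e1 e2
  simp only [Pi.neg_apply, integral_neg] at e2
  linarith

theorem IsNoise.measurable' (hw : IsNoise P ℱ σw σbar w) (t : ℕ) : Measurable (w t) :=
  (hw.measurable t).mono (ℱ.le _) le_rfl

/-- Countably many exponents keep the exceptional set null in the conditional statement; Fatou along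
rationals converging to s recovers every real exponent. -/
theorem lintegral_exp_le_of_rat {μ : Measure (Fin n → ℝ)} {i : Fin n} {σ : ℝ}
    (h : ∀ q : ℚ, ∫⁻ y, ENNReal.ofReal (Real.exp (q * y i)) ∂μ
      ≤ ENNReal.ofReal (Real.exp ((q : ℝ) ^ 2 * σ ^ 2 / 2))) (s : ℝ) :
    ∫⁻ y, ENNReal.ofReal (Real.exp (s * y i)) ∂μ
      ≤ ENNReal.ofReal (Real.exp (s ^ 2 * σ ^ 2 / 2)) := by
  obtain ⟨u, -, -, hu⟩ := Real.exists_seq_rat_strictMono_tendsto s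
  have h1 : ∀ y : Fin n → ℝ, Filter.Tendsto
      (fun k => ENNReal.ofReal (Real.exp (u k * y i))) Filter.atTop
      (nhds (ENNReal.ofReal (Real.exp (s * y i)))) := fun y =>
    ENNReal.tendsto_ofReal ((Real.continuous_exp.tendsto _).comp (hu.mul_const _))
  have h2 : Filter.Tendsto
      (fun k => ENNReal.ofReal (Real.exp ((u k : ℝ) ^ 2 * σ ^ 2 / 2))) Filter.atTop
      (nhds (ENNReal.ofReal (Real.exp (s ^ 2 * σ ^ 2 / 2)))) :=
    ENNReal.tendsto_ofReal ((Real.continuous_exp.tendsto _).comp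
      (((hu.pow 2).mul_const _).div_const _))
  calc ∫⁻ y, ENNReal.ofReal (Real.exp (s * y i)) ∂μ
      = ∫⁻ y, Filter.liminf (fun k => ENNReal.ofReal (Real.exp (u k * y i))) Filter.atTop ∂μ :=
        lintegral_congr fun y => (h1 y).liminf_eq.symm
    _ ≤ Filter.liminf (fun k => ∫⁻ y, ENNReal.ofReal (Real.exp (u k * y i)) ∂μ) Filter.atTop :=
        lintegral_liminf_le fun k => by fun_prop
    _ ≤ Filter.liminf (fun k => ENNReal.ofReal (Real.exp ((u k : ℝ) ^ 2 * σ ^ 2 / 2)))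
          Filter.atTop := Filter.liminf_le_liminf (Filter.Eventually.of_forall fun k => h (u k))
    _ = _ := h2.liminf_eq

/-- Conditionally on any statistic of the past, the process noise has a sub-Gaussian law. -/
theorem IsNoise.ae_isNoiseLaw_condDistrib (hw : IsNoise P ℱ σw σbar w) (t : ℕ) {X : Ω → 𝒳}
    (hX : Measurable[ℱ t] X) :
    ∀ᵐ x ∂(P.map X), IsNoiseLaw (condDistrib (w t) X P x) σw σbar := by
  have hY := hw.measurable' t
  have hX' : Measurable X := hX.mono (ℱ.le t) le_rfl
  have hexp : ∀ i, ∀ q : ℚ, ∀ᵐ x ∂(P.map X),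
      ∫⁻ y, ENNReal.ofReal (Real.exp (q * y i)) ∂(condDistrib (w t) X P x)
        ≤ ENNReal.ofReal (Real.exp ((q : ℝ) ^ 2 * σw ^ 2 / 2)) := by
    intro i q
    have h1 := ae_integral_condDistrib_le hY hX (f := fun y => Real.exp (q * y i)) (by fun_prop)
      (hw.integrable_exp t i q) (hw.subGaussian t i q)
    have h2 : ∀ᵐ x ∂(P.map X), Integrable (fun y : Fin n → ℝ => Real.exp (q * y i))
        (condDistrib (w t) X P x) := by
      refine Integrable.condDistrib_ae_map (f := fun p : 𝒳 × (Fin n → ℝ) => Real.exp (q * p.2 i))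
        hY.aemeasurable ?_
      rw [integrable_map_measure (by fun_prop : Measurable _).aestronglyMeasurable
        (hX'.prodMk hY).aemeasurable]
      exact hw.integrable_exp t i q
    filter_upwards [h1, h2] with x e1 e2
    rw [← ofReal_integral_eq_lintegral_ofReal e2 (ae_of_all _ fun _ => (Real.exp_pos _).le)]
    exact ENNReal.ofReal_le_ofReal e1
  have hmean : ∀ i, ∀ᵐ x ∂(P.map X), ∫ y, y i ∂(condDistrib (w t) X P x) = 0 := fun i =>
    ae_integral_condDistrib_eq hY hX (measurable_pi_apply i) (hw.integrable t i) (hw.condMean t i)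
  have hcov : ∀ i j, ∀ᵐ x ∂(P.map X), ∫ y, y i * y j ∂(condDistrib (w t) X P x)
      = if i = j then σbar ^ 2 else 0 := fun i j =>
    ae_integral_condDistrib_eq hY hX (f := fun y => y i * y j) (by fun_prop)
      (hw.integrable_mul t i j) (hw.condCov t i j)
  have hexp' := ae_all_iff.2 fun i => ae_all_iff.2 (hexp i)
  have hcov' := ae_all_iff.2 fun i => ae_all_iff.2 (hcov i)
  filter_upwards [hexp', ae_all_iff.2 hmean, hcov'] with x e1 e2 e3
  exact ⟨inferInstance, fun i s => lintegral_exp_le_of_rat (e1 i) s, e2, e3⟩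

/-- Freezing the past: after disintegrating the joint law of (X, w t), it is enough to integrate
over any admissible noise law with the statistic held fixed. -/
theorem IsNoise.lintegral_le (hw : IsNoise P ℱ σw σbar w) (t : ℕ) {X : Ω → 𝒳}
    (hX : Measurable[ℱ t] X) {G : 𝒳 → (Fin n → ℝ) → ENNReal}
    (hG : Measurable (Function.uncurry G)) {b : 𝒳 → ENNReal} (hb : Measurable b)
    (h : ∀ μ, IsNoiseLaw μ σw σbar → ∀ x, ∫⁻ y, G x y ∂μ ≤ b x) :
    ∫⁻ ω, G (X ω) (w t ω) ∂P ≤ ∫⁻ ω, b (X ω) ∂P := by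
  have hY := hw.measurable' t
  have hX' : Measurable X := hX.mono (ℱ.le t) le_rfl
  have e1 : ∫⁻ ω, G (X ω) (w t ω) ∂P
      = ∫⁻ p, Function.uncurry G p ∂(P.map fun ω => (X ω, w t ω)) := by
    rw [lintegral_map hG (hX'.prodMk hY)]
    rfl
  rw [e1, ← compProd_map_condDistrib hY.aemeasurable, Measure.lintegral_compProd hG,
    ← lintegral_map hb hX']
  refine lintegral_mono_ae ?_
  filter_upwards [hw.ae_isNoiseLaw_condDistrib t hX] with x hx
  exact h _ hx x

theorem IsPerturbation.measurable' (hν : IsPerturbation P ℱ σνsq w ν) (t : ℕ) :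
    Measurable (ν t) := (hν.measurable t).mono (ℱ.le _) le_rfl

theorem IsPerturbation.lintegral_eq (hν : IsPerturbation P ℱ σνsq w ν) (t : ℕ) {X : Ω → 𝒳}
    (hX : Measurable[ℱ t ⊔ MeasurableSpace.comap (w t) MeasurableSpace.pi] X) (hX' : Measurable X)
    {G : 𝒳 → (Fin d → ℝ) → ENNReal} (hG : Measurable (Function.uncurry G)) :
    ∫⁻ ω, G (X ω) (ν t ω) ∂P
      = ∫⁻ p, ∫⁻ ω, G (X ω) p ∂P ∂(Measure.pi fun _ : Fin d => gaussianReal 0 σνsq.toNNReal) := by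
  have hind : IndepFun X (ν t) P := by
    rw [IndepFun_iff_Indep]
    exact (indep_of_indep_of_le_right (hν.indep t) hX.comap_le).symm
  have hm := (indepFun_iff_map_prod_eq_prod_map_map hX'.aemeasurable
    (hν.measurable' t).aemeasurable).1 hind
  have e1 : ∫⁻ ω, G (X ω) (ν t ω) ∂P
      = ∫⁻ p, Function.uncurry G p ∂(P.map fun ω => (X ω, ν t ω)) := by
    rw [lintegral_map hG (hX'.prodMk (hν.measurable' t))]
    rfl
  have : IsProbabilityMeasure (P.map X) := Measure.isProbabilityMeasure_map hX'.aemeasurable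
  rw [e1, hm, hν.law t, lintegral_prod_symm' _ hG]
  refine lintegral_congr fun p => ?_
  rw [lintegral_map (f := fun x => Function.uncurry G (x, p)) (hG.comp (by fun_prop)) hX']
  rfl

/-- The covariate at time t contains ν t, which is not in ℱ t. Since ν t is independent of the past
and w t jointly, it can be integrated last; for each fixed value p the noise w t still has its
conditional law given the past. -/
theorem lintegral_perturbed_noise_le (hw : IsNoise P ℱ σw σbar w)
    (hν : IsPerturbation P ℱ σνsq w ν) (t : ℕ) {X : Ω → 𝒳}
    (hX : Measurable[ℱ t] X) {G : 𝒳 → (Fin d → ℝ) → (Fin n → ℝ) → ENNReal}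
    (hG : Measurable fun z : 𝒳 × (Fin d → ℝ) × (Fin n → ℝ) => G z.1 z.2.1 z.2.2)
    {b : 𝒳 → (Fin d → ℝ) → ENNReal} (hb : Measurable (Function.uncurry b))
    (h : ∀ μ, IsNoiseLaw μ σw σbar → ∀ x p, ∫⁻ y, G x p y ∂μ ≤ b x p) :
    ∫⁻ ω, G (X ω) (ν t ω) (w t ω) ∂P ≤ ∫⁻ ω, b (X ω) (ν t ω) ∂P := by
  have hX' : Measurable X := hX.mono (ℱ.le t) le_rfl
  have hXs : Measurable[ℱ t ⊔ MeasurableSpace.comap (w t) MeasurableSpace.pi] X :=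
    hX.mono le_sup_left le_rfl
  have hws : Measurable[ℱ t ⊔ MeasurableSpace.comap (w t) MeasurableSpace.pi] (w t) :=
    (comap_measurable (w t)).mono le_sup_right le_rfl
  have e1 := hν.lintegral_eq t (X := fun ω => (X ω, w t ω)) (hXs.prodMk hws)
    (hX'.prodMk (hw.measurable' t)) (G := fun z p => G z.1 p z.2)
    (hG.comp (f := fun z : (𝒳 × (Fin n → ℝ)) × (Fin d → ℝ) => (z.1.1, z.2, z.1.2)) (by fun_prop))
  have e2 := hν.lintegral_eq t hXs hX' hb
  rw [e1, e2]
  refine lintegral_mono fun p => ?_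
  exact hw.lintegral_le t hX (G := fun x y => G x p y)
    (hG.comp (f := fun z : 𝒳 × (Fin n → ℝ) => (z.1, p, z.2)) (by fun_prop))
    (hb.comp (f := fun z : 𝒳 => (z, p)) (by fun_prop)) fun μ hμ x => h μ hμ x p

end Conditional

end StabL

namespace StabL

/-! ### Deterministic analysis of the least-squares estimate -/

section LeastSquares

variable {n d : ℕ}

theorem stateMat_mulVec_add_inputMat_mulVec (Θ : Param n d) (a : Fin n → ℝ) (b : Fin d → ℝ) :
    stateMat Θ *ᵥ a + inputMat Θ *ᵥ b = Θᵀ *ᵥ Sum.elim a b := by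
  ext i
  simp [stateMat, inputMat, Matrix.mulVec, dotProduct, Matrix.toRows₁, Matrix.toRows₂]

theorem designMat_zero (lam : ℝ) (x : ℕ → Fin n → ℝ) (u : ℕ → Fin d → ℝ) :
    designMat lam x u 0 = lam • (1 : Matrix (Fin n ⊕ Fin d) (Fin n ⊕ Fin d) ℝ) := by
  simp [designMat]

theorem designMat_succ (lam : ℝ) (x : ℕ → Fin n → ℝ) (u : ℕ → Fin d → ℝ) (t : ℕ) :
    designMat lam x u (t + 1)
      = designMat lam x u t + vecMulVec (covariate x u t) (covariate x u t) := by
  rw [designMat, designMat, Finset.sum_range_succ, add_assoc]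

theorem dotProduct_designMat_mulVec (lam : ℝ) (x : ℕ → Fin n → ℝ) (u : ℕ → Fin d → ℝ) (t : ℕ)
    (v : Fin n ⊕ Fin d → ℝ) :
    v ⬝ᵥ designMat lam x u t *ᵥ v
      = lam * eucNorm v ^ 2 + ∑ s ∈ Finset.range t, (v ⬝ᵥ covariate x u s) ^ 2 := by
  induction t with
  | zero =>
    rw [designMat_zero, Matrix.smul_mulVec, Matrix.one_mulVec, dotProduct_smul, smul_eq_mul,
      eucNorm_sq_eq_dotProduct]
    simp
  | succ t ih =>
    rw [designMat_succ, Matrix.add_mulVec, dotProduct_add, ih, Finset.sum_range_succ,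
      Matrix.vecMulVec_mulVec, add_assoc]
    congr 2
    rw [op_smul_eq_smul, dotProduct_smul, smul_eq_mul, dotProduct_comm v, sq]

/-- This is V ≥ λI inverted. With p = V⁻¹v, λ|p|² ≤ p·v ≤ |p||v|. -/
theorem designMat_inv_quad_le {lam : ℝ} (hl : 0 < lam) (x : ℕ → Fin n → ℝ)
    (u : ℕ → Fin d → ℝ) (t : ℕ) (v : Fin n ⊕ Fin d → ℝ) :
    lam * (v ⬝ᵥ (designMat lam x u t)⁻¹ *ᵥ v) ≤ eucNorm v ^ 2 := by
  have hV := designMat_posDef hl x u t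
  set p := (designMat lam x u t)⁻¹ *ᵥ v with hp
  have h1 := dotProduct_designMat_mulVec lam x u t p
  rw [hp, posDef_mulVec_inv_mulVec hV, ← hp, dotProduct_comm] at h1
  have h2 : 0 ≤ ∑ s ∈ Finset.range t, (p ⬝ᵥ covariate x u s) ^ 2 :=
    Finset.sum_nonneg fun _ _ => sq_nonneg _
  have h3 := (le_abs_self _).trans (abs_dotProduct_le v p)
  have h4 : lam * eucNorm p ≤ eucNorm v := by
    rcases (eucNorm_nonneg p).eq_or_lt with h0 | h0
    · rw [← h0, mul_zero]; exact eucNorm_nonneg v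
    · nlinarith
  nlinarith [eucNorm_nonneg v, eucNorm_nonneg p]

/-- The accumulated noise `∑_{s < t} z_s w_sᵀ`. -/
noncomputable def noiseSum (x : ℕ → Fin n → ℝ) (u : ℕ → Fin d → ℝ) (w : ℕ → Fin n → ℝ) (t : ℕ) :
    Param n d :=
  ∑ s ∈ Finset.range t, vecMulVec (covariate x u s) (w s)

variable {lam σw S δ : ℝ} {x w : ℕ → Fin n → ℝ} {u : ℕ → Fin d → ℝ} {Θ : Param n d}

/-- The normal equations split the error into the regularization bias and the accumulated noise. -/
theorem sub_rlsEstimate (hl : 0 < lam)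
    (hdyn : ∀ t, x (t + 1) = stateMat Θ *ᵥ x t + inputMat Θ *ᵥ u t + w t) (t : ℕ) :
    Θ - rlsEstimate lam x u t
      = lam • ((designMat lam x u t)⁻¹ * Θ) - (designMat lam x u t)⁻¹ * noiseSum x u w t := by
  have hV := posDef_isUnit_det (designMat_posDef hl x u t)
  have h1 : ∑ s ∈ Finset.range t, vecMulVec (covariate x u s) (x (s + 1))
      = designMat lam x u t * Θ - lam • Θ + noiseSum x u w t := by
    rw [designMat, noiseSum, Matrix.add_mul, Matrix.smul_mul, Matrix.one_mul, add_sub_cancel_left,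
      Matrix.sum_mul, ← Finset.sum_add_distrib]
    refine Finset.sum_congr rfl fun s _ => ?_
    rw [hdyn, stateMat_mulVec_add_inputMat_mulVec, Matrix.vecMulVec_add, Matrix.vecMulVec_mul,
      Matrix.mulVec_transpose]
    rfl
  rw [rlsEstimate, h1, Matrix.mul_add, Matrix.mul_sub, ← Matrix.mul_assoc,
    Matrix.nonsing_inv_mul _ hV, Matrix.one_mul, Matrix.mul_smul]
  abel

/-- Triangle inequality in the V-norm; the bias costs √λ‖Θ‖ because V⁻¹ ≤ λ⁻¹I. -/
theorem sqrt_trace_sub_rlsEstimate_le (hl : 0 < lam)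
    (hdyn : ∀ t, x (t + 1) = stateMat Θ *ᵥ x t + inputMat Θ *ᵥ u t + w t) (t : ℕ) :
    √(((Θ - rlsEstimate lam x u t)ᵀ * designMat lam x u t * (Θ - rlsEstimate lam x u t)).trace)
      ≤ √(∑ i, (fun k => noiseSum x u w t k i) ⬝ᵥ (designMat lam x u t)⁻¹ *ᵥ
          (fun k => noiseSum x u w t k i)) + √lam * frobNorm Θ := by
  have hV := designMat_posDef hl x u t
  set V := designMat lam x u t with hVdef
  have hid : ∀ N : Param n d, ((V⁻¹ * N)ᵀ * V * (V⁻¹ * N)).trace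
      = ∑ i, (fun k => N k i) ⬝ᵥ V⁻¹ *ᵥ (fun k => N k i) := by
    intro N
    have : (V⁻¹ * N)ᵀ * V * (V⁻¹ * N) = Nᵀ * V⁻¹ * N := by
      rw [Matrix.transpose_mul, posDef_transpose_eq hV.inv, Matrix.mul_assoc,
        Matrix.mul_nonsing_inv_cancel_left _ _ (posDef_isUnit_det hV)]
    rw [this, trace_quad_eq_sum]
  rw [sub_rlsEstimate hl hdyn, ← Matrix.mul_smul]
  refine (trace_quad_sub_le hV _ _).trans ?_
  rw [hid, hid, add_comm]
  gcongr
  rw [frobNorm, ← Real.sqrt_mul hl.le]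
  apply Real.sqrt_le_sqrt
  rw [Finset.sum_comm, Finset.mul_sum]
  refine Finset.sum_le_sum fun i _ => ?_
  have h1 := designMat_inv_quad_le hl x u t (fun k => Θ k i)
  rw [eucNorm_sq] at h1
  have h2 : (fun k => (lam • Θ) k i) = lam • fun k => Θ k i := rfl
  rw [h2, Matrix.mulVec_smul, smul_dotProduct, dotProduct_smul, smul_eq_mul, smul_eq_mul]
  gcongr

/-- The self-normalized exponential of the `i`-th component of the noise. -/
noncomputable def expProcess (σw lam : ℝ) (x : ℕ → Fin n → ℝ) (u : ℕ → Fin d → ℝ)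
    (w : ℕ → Fin n → ℝ) (i : Fin n) (t : ℕ) : ℝ :=
  √((lam • (1 : Matrix (Fin n ⊕ Fin d) (Fin n ⊕ Fin d) ℝ)).det / (designMat lam x u t).det)
    * Real.exp (((fun k => noiseSum x u w t k i) ⬝ᵥ (designMat lam x u t)⁻¹ *ᵥ
        (fun k => noiseSum x u w t k i)) / (2 * σw ^ 2))

theorem det_smul_one_pos (hl : 0 < lam) :
    0 < (lam • (1 : Matrix (Fin n ⊕ Fin d) (Fin n ⊕ Fin d) ℝ)).det := by
  simp only [det_smul, det_one, mul_one]
  positivity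

theorem expProcess_zero (hl : 0 < lam) (i : Fin n) : expProcess σw lam x u w i 0 = 1 := by
  rw [expProcess, designMat_zero, div_self (det_smul_one_pos hl).ne']
  have : (fun k => noiseSum x u w 0 k i) = 0 := by
    ext k
    simp [noiseSum]
  rw [this]
  simp

/-- Sherman–Morrison for the exponent and the matrix determinant lemma for the prefactor yield
precisely the factor handled by `IsNoiseLaw.lintegral_exp_quad_le`. -/
theorem expProcess_succ (hl : 0 < lam) (i : Fin n) (t : ℕ) :
    expProcess σw lam x u w i (t + 1) = expProcess σw lam x u w i t *
      ((√(1 + covariate x u t ⬝ᵥ (designMat lam x u t)⁻¹ *ᵥ covariate x u t))⁻¹ * Real.exp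
        ((-(covariate x u t ⬝ᵥ (designMat lam x u t)⁻¹ *ᵥ (fun k => noiseSum x u w t k i)) ^ 2
          + 2 * w t i *
            (covariate x u t ⬝ᵥ (designMat lam x u t)⁻¹ *ᵥ (fun k => noiseSum x u w t k i))
          + w t i ^ 2 * (covariate x u t ⬝ᵥ (designMat lam x u t)⁻¹ *ᵥ covariate x u t))
        / (2 * σw ^ 2 *
          (1 + covariate x u t ⬝ᵥ (designMat lam x u t)⁻¹ *ᵥ covariate x u t)))) := by
  have hV := designMat_posDef hl x u t
  have hr := inv_quad_nonneg hV (covariate x u t)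
  have hS : (fun k => noiseSum x u w (t + 1) k i)
      = (fun k => noiseSum x u w t k i) + w t i • covariate x u t := by
    ext k
    simp [noiseSum, Finset.sum_range_succ, Matrix.vecMulVec_apply, mul_comm]
  rw [expProcess, expProcess, designMat_succ, hS, inv_quad_rank_one_update hV,
    det_add_vecMulVec_self hV]
  set r := covariate x u t ⬝ᵥ (designMat lam x u t)⁻¹ *ᵥ covariate x u t
  set a := covariate x u t ⬝ᵥ (designMat lam x u t)⁻¹ *ᵥ (fun k => noiseSum x u w t k i)
  rw [← div_div, div_eq_mul_inv _ (1 + r), Real.sqrt_mul (div_pos (det_smul_one_pos hl) hV.det_pos).le,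
    Real.sqrt_inv, add_div, Real.exp_add, div_div, mul_comm (1 + r)]
  ring

/-- Convexity of exp turns a bound on the average of the n exponentials into one on the average
exponent. A union bound over coordinates would put log(n/δ) in place of log(1/δ). -/
theorem mem_confSet_of_expProcess_lt (hn : 0 < n) (hl : 0 < lam) (hσ : 0 < σw) (hδ : 0 < δ)
    (hΘ : frobNorm Θ ≤ S)
    (hdyn : ∀ t, x (t + 1) = stateMat Θ *ᵥ x t + inputMat Θ *ᵥ u t + w t) (t : ℕ)
    (hlt : (∑ i, expProcess σw lam x u w i t) < n * δ⁻¹) :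
    Θ ∈ confSet σw lam S δ x u t := by
  have hV := designMat_posDef hl x u t
  have hn' : (0 : ℝ) < n := by exact_mod_cast hn
  set Y : Fin n → ℝ := fun i => (fun k => noiseSum x u w t k i) ⬝ᵥ (designMat lam x u t)⁻¹ *ᵥ
        (fun k => noiseSum x u w t k i) with hY
  set D := (designMat lam x u t).det with hD
  set D0 := (lam • (1 : Matrix (Fin n ⊕ Fin d) (Fin n ⊕ Fin d) ℝ)).det with hD0
  have hDpos : 0 < D := hV.det_pos
  have hD0pos : 0 < D0 := det_smul_one_pos hl
  rw [confSet, Set.mem_ofPred_eq]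
  refine (sqrt_trace_sub_rlsEstimate_le hl hdyn t).trans ?_
  rw [confRadius]
  have key : ∑ i, Y i ≤ σw ^ 2 * (2 * n * Real.log (δ⁻¹ * √(D / D0))) := by
    have hj := convexOn_exp.map_sum_le (t := Finset.univ) (w := fun _ : Fin n => (n : ℝ)⁻¹)
      (p := fun i => Y i / (2 * σw ^ 2)) (fun _ _ => by positivity)
      (by simp [hn'.ne']) (fun _ _ => Set.mem_univ _)
    simp only [smul_eq_mul, ← Finset.mul_sum] at hj
    have h1 : √(D0 / D) * ∑ i, Real.exp (Y i / (2 * σw ^ 2)) < n * δ⁻¹ := by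
      rw [Finset.mul_sum]
      exact hlt
    have h2 : √(D0 / D) = (√(D / D0))⁻¹ := by rw [← Real.sqrt_inv, inv_div]
    have h3 : 0 < √(D / D0) := Real.sqrt_pos.2 (by positivity)
    rw [h2, inv_mul_lt_iff₀ h3] at h1
    have h4 : Real.exp ((n : ℝ)⁻¹ * ∑ i, Y i / (2 * σw ^ 2)) ≤ δ⁻¹ * √(D / D0) := by
      refine hj.trans ?_
      rw [inv_mul_le_iff₀ hn']
      linarith
    rw [← Real.le_log_iff_exp_le (by positivity), ← Finset.sum_div] at h4
    have h5 : (n : ℝ)⁻¹ * ((∑ i, Y i) / (2 * σw ^ 2)) = (∑ i, Y i) / (σw ^ 2 * (2 * n)) := by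
      field_simp
    rw [h5, div_le_iff₀ (by positivity)] at h4
    linarith
  have h6 : √(∑ i, Y i) ≤ σw * √(2 * n * Real.log (δ⁻¹ * √(D / D0))) := by
    calc √(∑ i, Y i) ≤ √(σw ^ 2 * (2 * n * Real.log (δ⁻¹ * √(D / D0)))) := Real.sqrt_le_sqrt key
      _ = _ := by rw [Real.sqrt_mul (by positivity), Real.sqrt_sq hσ.le]
  gcongr

end LeastSquares

/-! ### A maximal inequality -/

/-- Ville's inequality. The mass of L t on the paths that have not yet reached c, plus c times the
probability of having reached it, does not increase with t. The supermartingale step is needed only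
on the surviving paths. -/
theorem maximal_ineq_of_lintegral_le {Ω : Type*} [MeasurableSpace Ω] {P : Measure Ω}
    [IsProbabilityMeasure P] {L : ℕ → Ω → ENNReal} (hL : ∀ t, Measurable (L t)) {c : ENNReal}
    (h0 : ∫⁻ ω, L 0 ω ∂P ≤ 1)
    (hstep : ∀ t, ∫⁻ ω in {ω | ∀ s < t + 1, L s ω < c}, L (t + 1) ω ∂P
      ≤ ∫⁻ ω in {ω | ∀ s < t + 1, L s ω < c}, L t ω ∂P) (T : ℕ) :
    c * P {ω | ∃ s < T, c ≤ L s ω} ≤ 1 := by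
  have hA : ∀ t, MeasurableSet {ω | ∀ s < t, L s ω < c} := fun t => by
    simp only [Set.ofPred_forall]
    exact MeasurableSet.iInter fun s => MeasurableSet.iInter fun _ =>
      measurableSet_lt (hL s) measurable_const
  have hcompl : ∀ t, {ω | ∃ s < t, c ≤ L s ω} = {ω | ∀ s < t, L s ω < c}ᶜ := by
    intro t; ext ω; simp
  have key : ∀ t, ∫⁻ ω in {ω | ∀ s < t, L s ω < c}, L t ω ∂P
      + c * P {ω | ∃ s < t, c ≤ L s ω} ≤ 1 := by
    intro t
    induction t with
    | zero => simpa using h0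
    | succ t ih =>
      set A := {ω | ∀ s < t, L s ω < c}
      set B := {ω | L t ω < c}
      have hB : MeasurableSet B := measurableSet_lt (hL t) measurable_const
      have hAB : {ω | ∀ s < t + 1, L s ω < c} = A ∩ B := by
        ext ω
        simp only [A, B, Set.mem_ofPred_eq, Set.mem_inter_iff, Nat.lt_succ_iff_lt_or_eq]
        constructor
        · exact fun h => ⟨fun s hs => h s (Or.inl hs), h t (Or.inr rfl)⟩
        · rintro ⟨h1, h2⟩ s (hs | rfl)
          · exact h1 s hs
          · exact h2
      have e1 : {ω | ∃ s < t + 1, c ≤ L s ω} ⊆ {ω | ∃ s < t, c ≤ L s ω} ∪ (A \ B) := by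
        rw [hcompl, hcompl, hAB]
        intro ω hω
        by_cases h : ω ∈ A
        · exact Or.inr ⟨h, fun hb => hω ⟨h, hb⟩⟩
        · exact Or.inl h
      have h2 : c * P (A \ B) ≤ ∫⁻ ω in A \ B, L t ω ∂P := by
        rw [← setLIntegral_const]
        refine setLIntegral_mono (hL t) fun ω hω => ?_
        exact not_lt.1 hω.2
      calc ∫⁻ ω in {ω | ∀ s < t + 1, L s ω < c}, L (t + 1) ω ∂P
            + c * P {ω | ∃ s < t + 1, c ≤ L s ω}
          ≤ ∫⁻ ω in {ω | ∀ s < t + 1, L s ω < c}, L t ω ∂P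
            + c * (P {ω | ∃ s < t, c ≤ L s ω} + P (A \ B)) := by
            refine add_le_add (hstep t) ?_
            gcongr
            exact (measure_mono e1).trans (measure_union_le _ _)
        _ ≤ ∫⁻ ω in A ∩ B, L t ω ∂P + ∫⁻ ω in A \ B, L t ω ∂P
            + c * P {ω | ∃ s < t, c ≤ L s ω} := by
            rw [hAB, mul_add, add_comm (c * P {ω | ∃ s < t, c ≤ L s ω}), ← add_assoc]
            gcongr
        _ = ∫⁻ ω in A, L t ω ∂P + c * P {ω | ∃ s < t, c ≤ L s ω} := by
            rw [lintegral_inter_add_sdiff _ _ hB]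
        _ ≤ 1 := ih
  exact le_add_self.trans (key T)

end StabL

namespace StabL

/-! ### Measurability along a run -/

section Measurability

theorem measurable_mulVec_apply {Ω ι κ : Type*} [MeasurableSpace Ω] [Fintype κ]
    {M : Ω → Matrix ι κ ℝ} {v : Ω → κ → ℝ} (hM : ∀ i j, Measurable fun ω => M ω i j)
    (hv : ∀ j, Measurable fun ω => v ω j) (i : ι) : Measurable fun ω => (M ω *ᵥ v ω) i := by
  simp only [Matrix.mulVec, dotProduct]
  exact Finset.measurable_sum _ fun j _ => (hM i j).mul (hv j)

theorem measurable_dotProduct {Ω κ : Type*} [MeasurableSpace Ω] [Fintype κ]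
    {v w : Ω → κ → ℝ} (hv : ∀ j, Measurable fun ω => v ω j)
    (hw : ∀ j, Measurable fun ω => w ω j) : Measurable fun ω => v ω ⬝ᵥ w ω := by
  simp only [dotProduct]
  exact Finset.measurable_sum _ fun j _ => (hv j).mul (hw j)

theorem measurable_det {Ω ι : Type*} [MeasurableSpace Ω] [Fintype ι] [DecidableEq ι]
    {M : Ω → Matrix ι ι ℝ} (hM : ∀ i j, Measurable fun ω => M ω i j) :
    Measurable fun ω => (M ω).det := by
  simp only [Matrix.det_apply]
  exact Finset.measurable_sum _ fun σ _ =>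
    (Finset.measurable_prod _ fun i _ => hM _ _).const_smul _

theorem measurable_inv_apply {Ω ι : Type*} [MeasurableSpace Ω] [Fintype ι] [DecidableEq ι]
    {M : Ω → Matrix ι ι ℝ} (hM : ∀ i j, Measurable fun ω => M ω i j) (i j : ι) :
    Measurable fun ω => (M ω)⁻¹ i j := by
  simp only [Matrix.inv_def, Ring.inverse_eq_inv, Matrix.smul_apply, smul_eq_mul,
    Matrix.adjugate_apply]
  refine (measurable_det hM).inv.mul (measurable_det fun k l => ?_)
  simp only [Matrix.updateRow_apply]
  split_ifs
  · exact measurable_const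
  · exact hM k l

end Measurability

section Run

variable {Ω : Type*} {mΩ : MeasurableSpace Ω} {P : Measure Ω} [IsProbabilityMeasure P]
  {ℱ : Filtration ℕ mΩ} {n d : ℕ} {σw σbar κ γ S lam δ σνsq : ℝ} {Tw : ℕ}
  {Q : Matrix (Fin n) (Fin n) ℝ} {R : Matrix (Fin d) (Fin d) ℝ} {Θstar : Param n d}
  {w : ℕ → Ω → Fin n → ℝ} {ν : ℕ → Ω → Fin d → ℝ} {x : ℕ → Ω → Fin n → ℝ}
  {u : ℕ → Ω → Fin d → ℝ} {Θt : ℕ → Ω → Param n d}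

set_option linter.unusedSectionVars false

theorem IsRun.measurable_gain_prev
    (hr : IsRun ℱ Q R σw σbar κ γ S lam δ Tw Θstar w ν x u Θt) (t : ℕ) (i : Fin d) (j : Fin n) :
    Measurable[ℱ t] fun ω => gain Q R (Θt (t - 1) ω) i j :=
  (hr.measurable_gain (t - 1) i j).mono (ℱ.mono (Nat.sub_le t 1)) le_rfl

theorem IsRun.measurable_input_of_state (hν : IsPerturbation P ℱ σνsq w ν)
    (hr : IsRun ℱ Q R σw σbar κ γ S lam δ Tw Θstar w ν x u Θt) {t : ℕ}
    (hx : Measurable[ℱ t] (x t)) : Measurable[ℱ (t + 1)] (u t) := by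
  let _ : MeasurableSpace Ω := ℱ (t + 1)
  have hx' : ∀ i, Measurable fun ω => x t ω i := fun i =>
    (measurable_pi_apply i).comp (hx.mono (ℱ.mono t.le_succ) le_rfl)
  have hK : ∀ i j, Measurable fun ω => gain Q R (Θt (t - 1) ω) i j := fun i j =>
    (hr.measurable_gain_prev t i j).mono (ℱ.mono t.le_succ) le_rfl
  have hν' : Measurable (ν t) := hν.measurable t
  refine measurable_pi_lambda _ fun i => ?_
  simp only [hr.input, Pi.add_apply]
  refine (measurable_mulVec_apply hK hx' i).add ?_
  split_ifs
  · exact (measurable_pi_apply i).comp hν'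
  · exact measurable_const

theorem IsRun.measurable_state (hw : IsNoise P ℱ σw σbar w) (hν : IsPerturbation P ℱ σνsq w ν)
    (hr : IsRun ℱ Q R σw σbar κ γ S lam δ Tw Θstar w ν x u Θt) (t : ℕ) :
    Measurable[ℱ t] (x t) := by
  induction t with
  | zero =>
    have : x 0 = fun _ => 0 := funext hr.init_state
    rw [this]
    exact measurable_const
  | succ t ih =>
    have hu := hr.measurable_input_of_state hν ih
    let _ : MeasurableSpace Ω := ℱ (t + 1)
    have hx' : Measurable (x t) := ih.mono (ℱ.mono t.le_succ) le_rfl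
    have hw' : Measurable (w t) := hw.measurable t
    refine measurable_pi_lambda _ fun i => ?_
    simp only [hr.dynamics, Pi.add_apply]
    exact ((measurable_mulVec_apply (M := fun _ => stateMat Θstar) (fun _ _ => measurable_const)
      (fun j => (measurable_pi_apply j).comp hx') i).add
      (measurable_mulVec_apply (M := fun _ => inputMat Θstar) (fun _ _ => measurable_const)
      (fun j => (measurable_pi_apply j).comp hu) i)).add ((measurable_pi_apply i).comp hw')

theorem IsRun.measurable_input (hw : IsNoise P ℱ σw σbar w) (hν : IsPerturbation P ℱ σνsq w ν)
    (hr : IsRun ℱ Q R σw σbar κ γ S lam δ Tw Θstar w ν x u Θt) (t : ℕ) :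
    Measurable[ℱ (t + 1)] (u t) :=
  hr.measurable_input_of_state hν (hr.measurable_state hw hν t)

theorem IsRun.measurable_covariate (hw : IsNoise P ℱ σw σbar w)
    (hν : IsPerturbation P ℱ σνsq w ν)
    (hr : IsRun ℱ Q R σw σbar κ γ S lam δ Tw Θstar w ν x u Θt) (t : ℕ) (k : Fin n ⊕ Fin d) :
    Measurable[ℱ (t + 1)] fun ω => covariate (fun s => x s ω) (fun s => u s ω) t k := by
  have hx := hr.measurable_state hw hν t
  have hu := hr.measurable_input hw hν t
  let _ : MeasurableSpace Ω := ℱ (t + 1)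
  have hx' : Measurable (x t) := hx.mono (ℱ.mono t.le_succ) le_rfl
  cases k with
  | inl i => exact (measurable_pi_apply i).comp hx'
  | inr i => exact (measurable_pi_apply i).comp hu

theorem IsRun.measurable_designMat (hw : IsNoise P ℱ σw σbar w)
    (hν : IsPerturbation P ℱ σνsq w ν)
    (hr : IsRun ℱ Q R σw σbar κ γ S lam δ Tw Θstar w ν x u Θt) (t : ℕ) (k l : Fin n ⊕ Fin d) :
    Measurable[ℱ t] fun ω => designMat lam (fun s => x s ω) (fun s => u s ω) t k l := by
  simp only [designMat, Matrix.add_apply, Matrix.sum_apply, Matrix.vecMulVec_apply]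
  refine Measurable.add (by exact measurable_const) ?_
  refine Finset.measurable_sum _ fun s hs => ?_
  have hle : ℱ (s + 1) ≤ ℱ t := ℱ.mono (Finset.mem_range.1 hs)
  exact ((hr.measurable_covariate hw hν s k).mono hle le_rfl).mul
    ((hr.measurable_covariate hw hν s l).mono hle le_rfl)

theorem IsRun.measurable_noiseSum (hw : IsNoise P ℱ σw σbar w)
    (hν : IsPerturbation P ℱ σνsq w ν)
    (hr : IsRun ℱ Q R σw σbar κ γ S lam δ Tw Θstar w ν x u Θt) (t : ℕ) (k : Fin n ⊕ Fin d)
    (i : Fin n) :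
    Measurable[ℱ t] fun ω => noiseSum (fun s => x s ω) (fun s => u s ω) (fun s => w s ω) t k i := by
  simp only [noiseSum, Matrix.sum_apply, Matrix.vecMulVec_apply]
  refine Finset.measurable_sum _ fun s hs => ?_
  have hle : ℱ (s + 1) ≤ ℱ t := ℱ.mono (Finset.mem_range.1 hs)
  exact ((hr.measurable_covariate hw hν s k).mono hle le_rfl).mul
    (((measurable_pi_apply i).comp (hw.measurable s)).mono hle le_rfl)

theorem IsRun.measurable_expProcess (hw : IsNoise P ℱ σw σbar w)
    (hν : IsPerturbation P ℱ σνsq w ν)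
    (hr : IsRun ℱ Q R σw σbar κ γ S lam δ Tw Θstar w ν x u Θt) (t : ℕ) (i : Fin n) :
    Measurable[ℱ t] fun ω =>
      expProcess σw lam (fun s => x s ω) (fun s => u s ω) (fun s => w s ω) i t := by
  have hV := hr.measurable_designMat hw hν t
  have hS := fun k => hr.measurable_noiseSum hw hν t k i
  let _ : MeasurableSpace Ω := ℱ t
  unfold expProcess
  refine Measurable.mul ?_ ?_
  · exact (measurable_const.div (measurable_det hV)).sqrt
  · refine ((measurable_dotProduct hS fun k => ?_).div_const _).exp
    exact measurable_mulVec_apply (measurable_inv_apply hV) hS k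

/-! ### The confidence event -/

/-- The quantities r and a depend on the past and on ν t but not on w t, so the step inequality
holds with both frozen and the expected factor is at most 1. -/
theorem lintegral_selfNormalized_step_le {𝒳 : Type*} [MeasurableSpace 𝒳] (hσ : 0 < σw)
    (hw : IsNoise P ℱ σw σbar w) (hν : IsPerturbation P ℱ σνsq w ν) (t : ℕ) (i : Fin n)
    {X : Ω → 𝒳} (hX : Measurable[ℱ t] X) {r a : 𝒳 × (Fin d → ℝ) → ℝ} (hr : Measurable r)
    (ha : Measurable a) {c : 𝒳 → ENNReal} (hc : Measurable c)
    (hok : ∀ ω, 0 ≤ r (X ω, ν t ω) ∧ (r (X ω, ν t ω) = 0 → a (X ω, ν t ω) = 0)) :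
    ∫⁻ ω, c (X ω) * ENNReal.ofReal ((√(1 + r (X ω, ν t ω)))⁻¹ * Real.exp
        ((-a (X ω, ν t ω) ^ 2 + 2 * w t ω i * a (X ω, ν t ω) + w t ω i ^ 2 * r (X ω, ν t ω))
          / (2 * σw ^ 2 * (1 + r (X ω, ν t ω))))) ∂P
      ≤ ∫⁻ ω, c (X ω) ∂P := by
  classical
  have hokm : MeasurableSet {q | 0 ≤ r q ∧ (r q = 0 → a q = 0)} := by
    refine (measurableSet_le measurable_const hr).inter ?_
    have : {q | r q = 0 → a q = 0} = {q | r q = 0}ᶜ ∪ {q | a q = 0} := by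
      ext q; simp [imp_iff_not_or]
    refine MeasurableSet.congr ?_ this.symm
    exact (measurableSet_eq_fun hr measurable_const).compl.union
      (measurableSet_eq_fun ha measurable_const)
  let E : 𝒳 → (Fin d → ℝ) → (Fin n → ℝ) → ENNReal := fun X p y =>
    ENNReal.ofReal (Real.exp ((-a (X, p) ^ 2 + 2 * y i * a (X, p) + y i ^ 2 * r (X, p))
      / (2 * σw ^ 2 * (1 + r (X, p)))))
  have hE : Measurable fun q : 𝒳 × (Fin d → ℝ) × (Fin n → ℝ) => E q.1 q.2.1 q.2.2 := by
    simp only [E]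
    fun_prop
  -- The frozen inequality must hold for all arguments, whereas `hok` concerns only attained values;
  -- hence the value 0 off the admissible set.
  let G : 𝒳 → (Fin d → ℝ) → (Fin n → ℝ) → ENNReal := fun X p y =>
    if (X, p) ∈ {q | 0 ≤ r q ∧ (r q = 0 → a q = 0)} then
      c X * (ENNReal.ofReal (√(1 + r (X, p)))⁻¹ * E X p y) else 0
  have hG : Measurable fun q : 𝒳 × (Fin d → ℝ) × (Fin n → ℝ) => G q.1 q.2.1 q.2.2 := by
    refine Measurable.ite ?_ ?_ measurable_const
    · exact (by fun_prop : Measurable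
        fun q : 𝒳 × (Fin d → ℝ) × (Fin n → ℝ) => (q.1, q.2.1)) hokm
    · exact Measurable.mul (by fun_prop) (Measurable.mul (by fun_prop) hE)
  have hmain := lintegral_perturbed_noise_le hw hν t hX hG (b := fun X _ => c X)
    (by unfold Function.uncurry; fun_prop) (by
      intro μ hμ X p
      simp only [G]
      split_ifs with h
      · have hEm : Measurable fun y => E X p y :=
          hE.comp (f := fun y => (X, p, y)) (by fun_prop)
        rw [lintegral_const_mul _ (hEm.const_mul _), lintegral_const_mul _ hEm]
        refine mul_le_of_le_one_right zero_le ?_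
        calc _ ≤ ENNReal.ofReal (√(1 + r (X, p)))⁻¹ * ENNReal.ofReal (√(1 + r (X, p))) := by
              gcongr
              exact hμ.lintegral_exp_quad_le hσ i h.1 h.2
          _ = 1 := by
              have : 0 < √(1 + r (X, p)) := Real.sqrt_pos.2 (by linarith [h.1])
              rw [← ENNReal.ofReal_mul (by positivity), inv_mul_cancel₀ this.ne',
                ENNReal.ofReal_one]
      · simp)
  refine le_trans (le_of_eq (lintegral_congr fun ω => ?_)) hmain
  have hmem : (X ω, ν t ω) ∈ {q | 0 ≤ r q ∧ (r q = 0 → a q = 0)} := hok ω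
  simp only [G, if_pos hmem, E]
  rw [ENNReal.ofReal_mul (by positivity)]

/-- Space of the statistics of the past that determine one step of the confidence analysis:
state, gain, inverse design matrix, accumulated noise of one component, and a weight. -/
abbrev PastStat (n d : ℕ) : Type :=
  (Fin n → ℝ) × (Fin d → Fin n → ℝ) × (Fin n ⊕ Fin d → Fin n ⊕ Fin d → ℝ)
    × (Fin n ⊕ Fin d → ℝ) × ENNReal

/-- The covariate determined by the past and the perturbation. -/
def PastStat.covariate (q : PastStat n d × (Fin d → ℝ)) (b : Prop) [Decidable b] :
    Fin n ⊕ Fin d → ℝ :=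
  Sum.elim q.1.1 (Matrix.of q.1.2.1 *ᵥ q.1.1 + if b then q.2 else 0)

theorem PastStat.measurable_covariate (b : Prop) [Decidable b] (k : Fin n ⊕ Fin d) :
    Measurable fun q : PastStat n d × (Fin d → ℝ) => PastStat.covariate q b k := by
  cases k with
  | inl j =>
    simp only [PastStat.covariate, Sum.elim_inl]
    fun_prop
  | inr j =>
    simp only [PastStat.covariate, Sum.elim_inr, Pi.add_apply]
    refine Measurable.add ?_ ?_
    · exact measurable_mulVec_apply (fun j l => by simp only [Matrix.of_apply]; fun_prop)
        (fun l => by fun_prop) j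
    · split_ifs
      · fun_prop
      · exact measurable_const

/-- One step of the self-normalized exponential supermartingale along a run. -/
theorem IsRun.lintegral_expProcess_succ_le (hl : 0 < lam) (hσ : 0 < σw)
    (hw : IsNoise P ℱ σw σbar w) (hν : IsPerturbation P ℱ σνsq w ν)
    (hr : IsRun ℱ Q R σw σbar κ γ S lam δ Tw Θstar w ν x u Θt) (t : ℕ) (i : Fin n)
    {A : Set Ω} (hA : MeasurableSet[ℱ t] A) :
    ∫⁻ ω in A, ENNReal.ofReal
        (expProcess σw lam (fun s => x s ω) (fun s => u s ω) (fun s => w s ω) i (t + 1)) ∂P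
      ≤ ∫⁻ ω in A, ENNReal.ofReal
        (expProcess σw lam (fun s => x s ω) (fun s => u s ω) (fun s => w s ω) i t) ∂P := by
  have hAm : MeasurableSet A := ℱ.le t _ hA
  let X : Ω → PastStat n d := fun ω => (x t ω, fun j l => gain Q R (Θt (t - 1) ω) j l,
    fun k l => (designMat lam (fun s => x s ω) (fun s => u s ω) t)⁻¹ k l,
    fun k => noiseSum (fun s => x s ω) (fun s => u s ω) (fun s => w s ω) t k i,
    A.indicator (fun ω => ENNReal.ofReal
      (expProcess σw lam (fun s => x s ω) (fun s => u s ω) (fun s => w s ω) i t)) ω)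
  have hX : Measurable[ℱ t] X := by
    have hV := hr.measurable_designMat hw hν t
    have hN := fun k => hr.measurable_noiseSum hw hν t k i
    have hE := hr.measurable_expProcess hw hν t i
    have hK := hr.measurable_gain_prev t
    have hx := hr.measurable_state hw hν t
    let _ : MeasurableSpace Ω := ℱ t
    refine hx.prodMk (Measurable.prodMk ?_ (Measurable.prodMk ?_ (Measurable.prodMk ?_ ?_)))
    · exact measurable_pi_lambda _ fun j => measurable_pi_lambda _ fun l => hK j l
    · exact measurable_pi_lambda _ fun k => measurable_pi_lambda _ fun l =>
        measurable_inv_apply hV k l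
    · exact measurable_pi_lambda _ fun k => hN k
    · exact (ENNReal.measurable_ofReal.comp hE).indicator hA
  have hz : ∀ ω, PastStat.covariate (X ω, ν t ω) (t ≤ Tw)
      = covariate (fun s => x s ω) (fun s => u s ω) t := by
    intro ω
    simp only [PastStat.covariate, covariate, hr.input t ω]
    rfl
  have hzm := PastStat.measurable_covariate (n := n) (d := d) (t ≤ Tw)
  have hmain := lintegral_selfNormalized_step_le hσ hw hν t i hX
    (r := fun q => PastStat.covariate q (t ≤ Tw) ⬝ᵥ
      (Matrix.of q.1.2.2.1) *ᵥ PastStat.covariate q (t ≤ Tw))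
    (a := fun q => PastStat.covariate q (t ≤ Tw) ⬝ᵥ (Matrix.of q.1.2.2.1) *ᵥ q.1.2.2.2.1)
    (measurable_dotProduct hzm fun k => measurable_mulVec_apply
      (fun j l => by simp only [Matrix.of_apply]; fun_prop) hzm k)
    (measurable_dotProduct hzm fun k => measurable_mulVec_apply
      (fun j l => by simp only [Matrix.of_apply]; fun_prop) (fun j => by fun_prop) k)
    (c := fun q => q.2.2.2.2) (by fun_prop) (by
      intro ω
      have hV := designMat_posDef hl (fun s => x s ω) (fun s => u s ω) t
      simp only [hz]
      refine ⟨inv_quad_nonneg hV _, fun h0 => ?_⟩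
      -- If zᵀV⁻¹z = 0, Cauchy–Schwarz for V⁻¹ forces the cross term with the accumulated noise to
      -- vanish.
      have h1 := posDef_dotProduct_sq_le hV.inv (covariate (fun s => x s ω) (fun s => u s ω) t)
        ((designMat lam (fun s => x s ω) (fun s => u s ω) t)⁻¹ *ᵥ (X ω).2.2.2.1)
      have h2 : covariate (fun s => x s ω) (fun s => u s ω) t ⬝ᵥ
        (designMat lam (fun s => x s ω) (fun s => u s ω) t)⁻¹ *ᵥ
          covariate (fun s => x s ω) (fun s => u s ω) t = 0 := h0
      rw [h2, zero_mul] at h1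
      exact pow_eq_zero_iff two_ne_zero |>.1 (le_antisymm h1 (sq_nonneg _)))
  rw [← lintegral_indicator hAm, ← lintegral_indicator hAm]
  refine le_trans (le_of_eq (lintegral_congr fun ω => ?_)) hmain
  simp only [hz]
  by_cases hω : ω ∈ A
  · have hC : (X ω).2.2.2.2 = ENNReal.ofReal
      (expProcess σw lam (fun s => x s ω) (fun s => u s ω) (fun s => w s ω) i t) := by
      simp only [X, Set.indicator_of_mem hω]
    rw [Set.indicator_of_mem hω, hC, expProcess_succ hl, ENNReal.ofReal_mul (by
      unfold expProcess; positivity)]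
    rfl
  · have hC : (X ω).2.2.2.2 = 0 := by simp only [X, Set.indicator_of_notMem hω]
    rw [Set.indicator_of_notMem hω, hC, zero_mul]

/-- With probability at least `1 - δ`, the true parameter belongs to all confidence sets. -/
theorem IsRun.measure_notMem_confSet_le (hn : 0 < n) (hl : 0 < lam) (hσ : 0 < σw) (hδ : 0 < δ)
    (hΘ : frobNorm Θstar ≤ S)
    (hw : IsNoise P ℱ σw σbar w) (hν : IsPerturbation P ℱ σνsq w ν)
    (hr : IsRun ℱ Q R σw σbar κ γ S lam δ Tw Θstar w ν x u Θt) (T : ℕ) :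
    P {ω | ∃ t < T, Θstar ∉ confSet σw lam S δ (fun s => x s ω) (fun s => u s ω) t}
      ≤ ENNReal.ofReal δ := by
  let L : ℕ → Ω → ENNReal := fun t ω => ∑ i, ENNReal.ofReal
    (expProcess σw lam (fun s => x s ω) (fun s => u s ω) (fun s => w s ω) i t)
  have hLF : ∀ t, Measurable[ℱ t] (L t) := fun t => by
    have hE := hr.measurable_expProcess hw hν t
    let _ : MeasurableSpace Ω := ℱ t
    exact Finset.measurable_sum _ fun i _ => ENNReal.measurable_ofReal.comp (hE i)
  have hn' : (0 : ℝ) < n := by exact_mod_cast hn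
  let c : ENNReal := ENNReal.ofReal (n * δ⁻¹)
  have hmeas : ∀ t i, Measurable fun ω => ENNReal.ofReal
      (expProcess σw lam (fun s => x s ω) (fun s => u s ω) (fun s => w s ω) i t) := fun t i =>
    ENNReal.measurable_ofReal.comp ((hr.measurable_expProcess hw hν t i).mono (ℱ.le t) le_rfl)
  -- Division by n makes the initial value of the summed process equal to 1.
  have key := maximal_ineq_of_lintegral_le (P := P) (L := fun t ω => (n : ENNReal)⁻¹ * L t ω)
    (fun t => ((hLF t).mono (ℱ.le t) le_rfl).const_mul _) (c := (n : ENNReal)⁻¹ * c) (by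
      simp only [L, expProcess_zero hl]
      simp [ENNReal.inv_mul_cancel (a := (n : ENNReal)) (by simpa using hn.ne') (by simp)])
    (by
      intro t
      have hA : MeasurableSet[ℱ t] {ω | ∀ s < t + 1, (n : ENNReal)⁻¹ * L s ω < (n : ENNReal)⁻¹ * c} := by
        simp only [Set.ofPred_forall]
        refine MeasurableSet.iInter fun s => MeasurableSet.iInter fun hs => ?_
        have hLs := (hLF s).mono (ℱ.mono (Nat.lt_succ_iff.1 hs)) le_rfl
        let _ : MeasurableSpace Ω := ℱ t
        exact measurableSet_lt (hLs.const_mul _) measurable_const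
      have hLm : ∀ t, Measurable (L t) := fun t => (hLF t).mono (ℱ.le t) le_rfl
      rw [lintegral_const_mul _ (hLm _), lintegral_const_mul _ (hLm _)]
      refine mul_le_mul_right ?_ _
      simp only [L]
      rw [lintegral_finsetSum _ fun i _ => hmeas _ i, lintegral_finsetSum _ fun i _ => hmeas _ i]
      exact Finset.sum_le_sum fun i _ => hr.lintegral_expProcess_succ_le hl hσ hw hν t i hA) T
  have hsub : {ω | ∃ t < T, Θstar ∉ confSet σw lam S δ (fun s => x s ω) (fun s => u s ω) t}
      ⊆ {ω | ∃ s < T, (n : ENNReal)⁻¹ * c ≤ (n : ENNReal)⁻¹ * L s ω} := by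
    rintro ω ⟨t, ht, hnot⟩
    refine ⟨t, ht, ?_⟩
    gcongr
    by_contra hlt
    refine hnot (mem_confSet_of_expProcess_lt hn hl hσ hδ hΘ (w := fun s => w s ω)
      (fun s => hr.dynamics s ω) t ?_)
    rw [not_le] at hlt
    simp only [L, c] at hlt
    rw [← ENNReal.ofReal_sum_of_nonneg (fun i _ => by unfold expProcess; positivity)] at hlt
    exact (ENNReal.ofReal_lt_ofReal_iff (by positivity)).1 hlt
  have hc : (n : ENNReal)⁻¹ * c = ENNReal.ofReal δ⁻¹ := by
    simp only [c]
    rw [ENNReal.ofReal_mul hn'.le, ENNReal.ofReal_natCast, ← mul_assoc,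
      ENNReal.inv_mul_cancel (by simpa using hn.ne') (by simp), one_mul]
  refine (measure_mono hsub).trans ?_
  rw [hc] at key
  rw [hc]
  rw [ENNReal.ofReal_inv_of_pos hδ, mul_comm, ← div_eq_mul_inv,
    ENNReal.div_le_iff (by simpa using hδ) (by simp), one_mul] at key
  rw [ENNReal.ofReal_inv_of_pos hδ]
  exact key

end Run

end StabL

namespace StabL

/-! ### Eliminating the state of a frozen closed loop -/

section Elimination

variable {n d : ℕ}

/-- The coefficients are polynomials in the entries, as the universal characteristic polynomial
shows. Continuity serves both the compactness bound and measurability in a random gain. -/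
theorem continuous_charpoly_coeff (j : ℕ) :
    Continuous fun M : Fin n → Fin n → ℝ => (Matrix.of M).charpoly.coeff j := by
  have : (fun M : Fin n → Fin n → ℝ => (Matrix.of M).charpoly.coeff j)
      = fun M => MvPolynomial.eval (fun p : Fin n × Fin n => M p.1 p.2)
          ((Matrix.charpoly.univ ℝ (Fin n)).coeff j) := by
    ext M
    have := Matrix.charpoly.univ_coeff_eval₂Hom (n := Fin n) (RingHom.id ℝ)
      (fun p : Fin n × Fin n => M p.1 p.2) j
    rw [MvPolynomial.coe_eval₂Hom] at this
    rw [← MvPolynomial.eval₂_id, this]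
    rfl
  rw [this]
  exact (MvPolynomial.continuous_eval _).comp (by fun_prop)

theorem exists_charpoly_coeff_bound (n : ℕ) (ρ : ℝ) :
    ∃ C : ℝ, 1 ≤ C ∧ ∀ M : Matrix (Fin n) (Fin n) ℝ,
      (∀ v, eucNorm (M *ᵥ v) ≤ ρ * eucNorm v) →
      ∀ j ∈ Finset.range (n + 1), |M.charpoly.coeff j| ≤ C := by
  have hcomp : IsCompact (Set.Icc (fun _ _ => -ρ : Fin n → Fin n → ℝ) (fun _ _ => ρ)) :=
    isCompact_Icc
  have hb : ∀ j, ∃ C : ℝ, ∀ M ∈ Set.Icc (fun _ _ => -ρ : Fin n → Fin n → ℝ) (fun _ _ => ρ),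
      |(Matrix.of M).charpoly.coeff j| ≤ C := fun j => by
    obtain ⟨C, hC⟩ := hcomp.exists_bound_of_continuousOn (continuous_charpoly_coeff j).continuousOn
    exact ⟨C, hC⟩
  choose C hC using hb
  have hC0 : ∀ j ∈ Finset.range (n + 1), |C j| ≤ 1 + ∑ j ∈ Finset.range (n + 1), |C j| := by
    intro j hj
    have := Finset.single_le_sum (f := fun j => |C j|) (fun _ _ => abs_nonneg _) hj
    linarith
  refine ⟨1 + ∑ j ∈ Finset.range (n + 1), |C j|, ?_, fun M hM j hj => ?_⟩
  · have : 0 ≤ ∑ j ∈ Finset.range (n + 1), |C j| := Finset.sum_nonneg fun _ _ => abs_nonneg _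
    linarith
  · refine le_trans (hC j M ?_) ((le_abs_self _).trans (hC0 j hj))
    have hent : ∀ i k, |M i k| ≤ ρ := by
      intro i k
      have h1 := hM (Pi.single k 1)
      have h2 := abs_apply_le_eucNorm (M *ᵥ Pi.single k 1) i
      have h3 : eucNorm (Pi.single k (1 : ℝ) : Fin n → ℝ) = 1 := by
        rw [← Real.sqrt_sq (eucNorm_nonneg _), eucNorm_sq_eq_dotProduct]
        simp
      rw [h3, mul_one] at h1
      rw [Matrix.mulVec_single_one] at h1 h2
      exact h2.trans h1
    exact ⟨fun i k => (abs_le.1 (hent i k)).1, fun i k => (abs_le.1 (hent i k)).2⟩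

/-- The state driven from the origin by `ξ` under the fixed closed loop `M`. -/
def frozenState (M : Matrix (Fin n) (Fin n) ℝ) (ξ : ℕ → Fin n → ℝ) : ℕ → Fin n → ℝ
  | 0 => 0
  | j + 1 => M *ᵥ frozenState M ξ j + ξ j

/-- The closed loop `A + B K`. -/
def closedLoop (Θ : Param n d) (K : Matrix (Fin d) (Fin n) ℝ) : Matrix (Fin n) (Fin n) ℝ :=
  stateMat Θ + inputMat Θ * K

/-- The combination `∑_j c_j X_j` of the states driven from the origin, with `c_j` the
coefficients of the characteristic polynomial of the closed loop. -/
noncomputable def filteredState (Θ : Param n d) (K : Matrix (Fin d) (Fin n) ℝ)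
    (w : ℕ → Fin n → ℝ) (ν : ℕ → Fin d → ℝ) : Fin n → ℝ :=
  ∑ j ∈ Finset.range (n + 1), (closedLoop Θ K).charpoly.coeff j •
    frozenState (closedLoop Θ K) (fun j => inputMat Θ *ᵥ ν j + w j) j

/-- The combination of the covariates of a frozen closed loop that does not depend on its
initial state. -/
noncomputable def excitation (Θ : Param n d) (K : Matrix (Fin d) (Fin n) ℝ)
    (w : ℕ → Fin n → ℝ) (ν : ℕ → Fin d → ℝ) : Fin n ⊕ Fin d → ℝ :=
  Sum.elim (filteredState Θ K w ν)
    (K *ᵥ filteredState Θ K w ν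
      + ∑ j ∈ Finset.range (n + 1), (closedLoop Θ K).charpoly.coeff j • ν j)

theorem sum_charpoly_coeff_mulVec (M : Matrix (Fin n) (Fin n) ℝ) (v : Fin n → ℝ) :
    ∑ j ∈ Finset.range (n + 1), M.charpoly.coeff j • (M ^ j *ᵥ v) = 0 := by
  have h := M.aeval_self_charpoly
  rw [Polynomial.aeval_eq_sum_range, Matrix.charpoly_natDegree_eq_dim, Fintype.card_fin] at h
  simp only [← Matrix.smul_mulVec]
  rw [← Matrix.sum_mulVec, h, Matrix.zero_mulVec]

variable {Θ : Param n d} {K : Matrix (Fin d) (Fin n) ℝ} {w : ℕ → Fin n → ℝ} {ν : ℕ → Fin d → ℝ}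
  {x : ℕ → Fin n → ℝ} {u : ℕ → Fin d → ℝ}

/-- The state is M^j x₀ plus a part driven from the origin by the noise. Cayley–Hamilton removes the
first part, and the input inherits this through u = Kx + ν. -/
theorem sum_charpoly_coeff_covariate
    (hx : ∀ j < n, x (j + 1) = stateMat Θ *ᵥ x j + inputMat Θ *ᵥ u j + w j)
    (hu : ∀ j ≤ n, u j = K *ᵥ x j + ν j) :
    ∑ j ∈ Finset.range (n + 1), (closedLoop Θ K).charpoly.coeff j • covariate x u j
      = excitation Θ K w ν := by
  have h1 : ∀ j ≤ n, x j = closedLoop Θ K ^ j *ᵥ x 0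
      + frozenState (closedLoop Θ K) (fun j => inputMat Θ *ᵥ ν j + w j) j := by
    intro j
    induction j with
    | zero => intro _; simp [frozenState]
    | succ j ih =>
      intro hj
      have hj' : x (j + 1) = closedLoop Θ K *ᵥ x j + (inputMat Θ *ᵥ ν j + w j) := by
        rw [hx j hj, hu j (by omega), closedLoop, Matrix.add_mulVec, Matrix.mulVec_add,
          Matrix.mulVec_mulVec]
        abel
      rw [hj', ih (by omega), Matrix.mulVec_add, Matrix.mulVec_mulVec, ← pow_succ', frozenState,
        add_assoc]
  have h2 : ∑ j ∈ Finset.range (n + 1), (closedLoop Θ K).charpoly.coeff j • x j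
      = filteredState Θ K w ν := by
    have : ∀ j ∈ Finset.range (n + 1), (closedLoop Θ K).charpoly.coeff j • x j
        = (closedLoop Θ K).charpoly.coeff j • (closedLoop Θ K ^ j *ᵥ x 0)
          + (closedLoop Θ K).charpoly.coeff j •
            frozenState (closedLoop Θ K) (fun j => inputMat Θ *ᵥ ν j + w j) j := by
      intro j hj
      rw [← smul_add, ← h1 j (Nat.lt_succ_iff.1 (Finset.mem_range.1 hj))]
    rw [Finset.sum_congr rfl this, Finset.sum_add_distrib, sum_charpoly_coeff_mulVec, zero_add]
    rfl
  ext k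
  rw [Finset.sum_apply]
  cases k with
  | inl i =>
    have := congrFun h2 i
    rw [Finset.sum_apply] at this
    exact this
  | inr i =>
    simp only [excitation, Sum.elim_inr, ← h2, Matrix.mulVec_sum, Matrix.mulVec_smul]
    rw [← Finset.sum_add_distrib, Finset.sum_apply]
    refine Finset.sum_congr rfl fun j hj => ?_
    rw [← smul_add, ← hu j (Nat.lt_succ_iff.1 (Finset.mem_range.1 hj))]
    rfl

/-- Cauchy–Schwarz over the n+1 terms of the block: an excited combination forces excited
covariates. -/
theorem dotProduct_excitation_sq_le {C : ℝ}
    (hC : ∀ j ∈ Finset.range (n + 1), |(closedLoop Θ K).charpoly.coeff j| ≤ C)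
    (hx : ∀ j < n, x (j + 1) = stateMat Θ *ᵥ x j + inputMat Θ *ᵥ u j + w j)
    (hu : ∀ j ≤ n, u j = K *ᵥ x j + ν j) (v : Fin n ⊕ Fin d → ℝ) :
    (v ⬝ᵥ excitation Θ K w ν) ^ 2
      ≤ (n + 1) * C ^ 2 * ∑ j ∈ Finset.range (n + 1), (v ⬝ᵥ covariate x u j) ^ 2 := by
  rw [← sum_charpoly_coeff_covariate hx hu, dotProduct_sum]
  simp only [dotProduct_smul, smul_eq_mul]
  refine (Finset.sum_mul_sq_le_sq_mul_sq _ _ _).trans ?_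
  gcongr
  calc _ ≤ ∑ j ∈ Finset.range (n + 1), C ^ 2 := by
        refine Finset.sum_le_sum fun j hj => ?_
        rw [← sq_abs]
        have := hC j hj
        gcongr
    _ = _ := by simp

theorem frozenState_congr {M : Matrix (Fin n) (Fin n) ℝ} {ξ ξ' : ℕ → Fin n → ℝ} {j : ℕ}
    (h : ∀ i < j, ξ i = ξ' i) : frozenState M ξ j = frozenState M ξ' j := by
  induction j with
  | zero => rfl
  | succ j ih =>
    rw [frozenState, frozenState, ih fun i hi => h i (by omega), h j (by omega)]

theorem eucNorm_closedLoop_mulVec_le {S κ : ℝ} (hΘ : frobNorm Θ ≤ S) (hK : specNorm K ≤ κ)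
    (v : Fin n → ℝ) : eucNorm (closedLoop Θ K *ᵥ v) ≤ S * (1 + κ) * eucNorm v := by
  have h1 : closedLoop Θ K *ᵥ v = Θᵀ *ᵥ Sum.elim v (K *ᵥ v) := by
    rw [← stateMat_mulVec_add_inputMat_mulVec, closedLoop, Matrix.add_mulVec, Matrix.mulVec_mulVec]
  have h2 := eucNorm_mulVec_le_frobNorm Θᵀ (Sum.elim v (K *ᵥ v))
  have h3 := eucNorm_sumElim_le v (K *ᵥ v)
  have h4 : eucNorm (K *ᵥ v) ≤ κ * eucNorm v :=
    (eucNorm_mulVec_le_specNorm K v).trans (mul_le_mul_of_nonneg_right hK (eucNorm_nonneg _))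
  have hS : 0 ≤ S := (frobNorm_nonneg Θ).trans hΘ
  rw [frobNorm_transpose] at h2
  rw [h1]
  calc _ ≤ frobNorm Θ * eucNorm (Sum.elim v (K *ᵥ v)) := h2
    _ ≤ S * (eucNorm v + κ * eucNorm v) := by
        gcongr
        · exact eucNorm_nonneg _
        · linarith
    _ = _ := by ring

theorem eucNorm_inputMat_mulVec_le {S : ℝ} (hΘ : frobNorm Θ ≤ S) (p : Fin d → ℝ) :
    eucNorm (inputMat Θ *ᵥ p) ≤ S * eucNorm p := by
  have h1 : inputMat Θ *ᵥ p = Θᵀ *ᵥ Sum.elim 0 p := by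
    rw [← stateMat_mulVec_add_inputMat_mulVec, Matrix.mulVec_zero, zero_add]
  rw [h1]
  refine (eucNorm_mulVec_le_frobNorm _ _).trans ?_
  rw [frobNorm_transpose]
  have := eucNorm_sumElim_le (0 : Fin n → ℝ) p
  rw [eucNorm_zero, zero_add] at this
  exact mul_le_mul hΘ this (eucNorm_nonneg _) ((frobNorm_nonneg Θ).trans hΘ)

/-- The constant is uniform over all admissible systems and gains. It bounds the cost of the
elimination and the error made when a direction is replaced by a nearby grid point. -/
theorem exists_excitation_bound (n d : ℕ) (S κ : ℝ) (hκ : 0 ≤ κ) :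
    ∃ C : ℝ, 1 ≤ C ∧ ∀ (Θ : Param n d) (K : Matrix (Fin d) (Fin n) ℝ),
      frobNorm Θ ≤ S → specNorm K ≤ κ →
      (∀ j ∈ Finset.range (n + 1), |(closedLoop Θ K).charpoly.coeff j| ≤ C) ∧
      ∀ (w : ℕ → Fin n → ℝ) (ν : ℕ → Fin d → ℝ) (W : ℝ),
        (∀ j ≤ n, eucNorm (w j) ≤ W) → (∀ j ≤ n, eucNorm (ν j) ≤ W) →
        eucNorm (excitation Θ K w ν) ≤ C * W := by
  obtain ⟨C, hC1, hC⟩ := exists_charpoly_coeff_bound n (S * (1 + κ))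
  set G := |S| * (1 + κ) + |S| + 1 with hG
  have hG1 : 1 ≤ G := by
    have : 0 ≤ |S| * (1 + κ) := by positivity
    have := abs_nonneg S
    linarith
  refine ⟨C + (1 + κ) * ((n + 1) * (C * G ^ n)) + (n + 1) * C, ?_, fun Θ K hΘ hK => ?_⟩
  · have : 0 ≤ (1 + κ) * ((n + 1) * (C * G ^ n)) := by positivity
    have : 0 ≤ (n + 1) * C := by positivity
    linarith
  have hM := eucNorm_closedLoop_mulVec_le hΘ hK
  have hS : 0 ≤ S := (frobNorm_nonneg Θ).trans hΘ
  rw [abs_of_nonneg hS] at hG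
  have hcoef := hC _ hM
  refine ⟨fun j hj => (hcoef j hj).trans ?_, fun w ν W hw hν => ?_⟩
  · have : 0 ≤ (1 + κ) * ((n + 1) * (C * G ^ n)) := by positivity
    have : 0 ≤ (n + 1) * C := by positivity
    linarith
  have hW : 0 ≤ W := (eucNorm_nonneg _).trans (hw 0 (Nat.zero_le _))
  have hfs : ∀ j ≤ n, eucNorm (frozenState (closedLoop Θ K)
      (fun j => inputMat Θ *ᵥ ν j + w j) j) ≤ G ^ j * W := by
    intro j
    induction j with
    | zero => intro _; simp [frozenState, hW]
    | succ j ih =>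
      intro hj
      rw [frozenState]
      have h1 := (hM (frozenState (closedLoop Θ K) (fun j => inputMat Θ *ᵥ ν j + w j) j)).trans
        (mul_le_mul_of_nonneg_left (ih (by omega)) (by positivity))
      have h2 := (eucNorm_inputMat_mulVec_le hΘ (ν j)).trans
        (mul_le_mul_of_nonneg_left (hν j (by omega)) hS)
      have h3 := hw j (by omega)
      have h4 : 1 ≤ G ^ j := one_le_pow₀ hG1
      have h5 : (S + 1) * W ≤ (S + 1) * (G ^ j * W) := by
        gcongr
        nlinarith
      calc _ ≤ S * (1 + κ) * (G ^ j * W) + (S * W + W) :=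
            (eucNorm_add_le _ _).trans (add_le_add h1 ((eucNorm_add_le _ _).trans
              (add_le_add h2 h3)))
        _ ≤ S * (1 + κ) * (G ^ j * W) + (S + 1) * (G ^ j * W) := by linarith
        _ = G ^ (j + 1) * W := by rw [pow_succ, hG]; ring
  have hfilt : eucNorm (filteredState Θ K w ν) ≤ (n + 1) * (C * G ^ n) * W := by
    rw [filteredState]
    refine (eucNorm_sum_le _ _).trans ?_
    calc _ ≤ ∑ j ∈ Finset.range (n + 1), C * (G ^ n * W) := by
          refine Finset.sum_le_sum fun j hj => ?_
          have hj' := Nat.lt_succ_iff.1 (Finset.mem_range.1 hj)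
          rw [eucNorm_smul]
          have h1 := hcoef j hj
          have h2 := hfs j hj'
          have h3 : G ^ j ≤ G ^ n := pow_le_pow_right₀ hG1 hj'
          have h4 : G ^ j * W ≤ G ^ n * W := by gcongr
          exact mul_le_mul h1 (h2.trans h4) (eucNorm_nonneg _) (by linarith)
      _ = _ := by simp; ring
  have hsumν : eucNorm (∑ j ∈ Finset.range (n + 1), (closedLoop Θ K).charpoly.coeff j • ν j)
      ≤ (n + 1) * C * W := by
    refine (eucNorm_sum_le _ _).trans ?_
    calc _ ≤ ∑ j ∈ Finset.range (n + 1), C * W := by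
          refine Finset.sum_le_sum fun j hj => ?_
          rw [eucNorm_smul]
          exact mul_le_mul (hcoef j hj) (hν j (Nat.lt_succ_iff.1 (Finset.mem_range.1 hj)))
            (eucNorm_nonneg _) (by linarith)
      _ = _ := by simp; ring
  have hKf : eucNorm (K *ᵥ filteredState Θ K w ν) ≤ κ * ((n + 1) * (C * G ^ n) * W) :=
    (eucNorm_mulVec_le_specNorm K _).trans (mul_le_mul hK hfilt (eucNorm_nonneg _) hκ)
  calc eucNorm (excitation Θ K w ν)
      ≤ (n + 1) * (C * G ^ n) * W + (κ * ((n + 1) * (C * G ^ n) * W) + (n + 1) * C * W) :=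
        (eucNorm_sumElim_le _ _).trans (add_le_add hfilt ((eucNorm_add_le _ _).trans
          (add_le_add hKf hsumν)))
    _ ≤ _ := by
        have : 0 ≤ C * W := by positivity
        nlinarith

end Elimination

end StabL

namespace StabL

/-! ### The leading noise of the excitation -/

section LeadingNoise

variable {N d : ℕ}

/-- The sequence with all terms from index `N` on replaced by zero. -/
def truncSeq {E : Type*} [Zero E] (N : ℕ) (f : ℕ → E) (j : ℕ) : E := if j < N then f j else 0

theorem filteredState_eq (Θ : Param (N + 1) d) (K : Matrix (Fin d) (Fin (N + 1)) ℝ)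
    (w : ℕ → Fin (N + 1) → ℝ) (ν : ℕ → Fin d → ℝ) :
    filteredState Θ K w ν = filteredState Θ K (truncSeq N w) (truncSeq N ν)
      + (inputMat Θ *ᵥ ν N + w N) := by
  have hcoef : (closedLoop Θ K).charpoly.coeff (N + 1) = 1 := by
    have h := (closedLoop Θ K).charpoly_monic
    rw [Polynomial.Monic, Polynomial.leadingCoeff, Matrix.charpoly_natDegree_eq_dim,
      Fintype.card_fin] at h
    exact h
  have hcongr : ∀ j ≤ N, frozenState (closedLoop Θ K) (fun j => inputMat Θ *ᵥ ν j + w j) j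
      = frozenState (closedLoop Θ K)
          (fun j => inputMat Θ *ᵥ truncSeq N ν j + truncSeq N w j) j := by
    intro j hj
    refine frozenState_congr fun i hi => ?_
    have : i < N := by omega
    simp [truncSeq, this]
  rw [filteredState, filteredState, Finset.sum_range_succ _ (N + 1),
    Finset.sum_range_succ _ (N + 1), hcoef, one_smul, one_smul, frozenState, frozenState,
    hcongr N le_rfl, Finset.sum_congr rfl fun j hj => by
      rw [hcongr j (Nat.lt_succ_iff.1 (Finset.mem_range.1 hj))]]
  simp [truncSeq, add_assoc]

/-- Isolates the noises not yet known after the first N steps of the block. Monicity gives w N and ν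
(N+1) the weights a + Kᵀb and b; everything else is known at that time, except the ν N term, which
can only shift the sum. -/
theorem dotProduct_excitation_eq (Θ : Param (N + 1) d) (K : Matrix (Fin d) (Fin (N + 1)) ℝ)
    (w : ℕ → Fin (N + 1) → ℝ) (ν : ℕ → Fin d → ℝ) (a : Fin (N + 1) → ℝ) (b : Fin d → ℝ) :
    Sum.elim a b ⬝ᵥ excitation Θ K w ν
      = Sum.elim a b ⬝ᵥ excitation Θ K (truncSeq N w) (truncSeq N ν)
        + ((inputMat Θ)ᵀ *ᵥ (a + Kᵀ *ᵥ b) + (closedLoop Θ K).charpoly.coeff N • b) ⬝ᵥ ν N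
        + (a + Kᵀ *ᵥ b) ⬝ᵥ w N + b ⬝ᵥ ν (N + 1) := by
  have hcoef : (closedLoop Θ K).charpoly.coeff (N + 1) = 1 := by
    have h := (closedLoop Θ K).charpoly_monic
    rw [Polynomial.Monic, Polynomial.leadingCoeff, Matrix.charpoly_natDegree_eq_dim,
      Fintype.card_fin] at h
    exact h
  have hsum : ∑ j ∈ Finset.range (N + 1 + 1), (closedLoop Θ K).charpoly.coeff j • ν j
      = ∑ j ∈ Finset.range (N + 1 + 1), (closedLoop Θ K).charpoly.coeff j • truncSeq N ν j
        + ((closedLoop Θ K).charpoly.coeff N • ν N + ν (N + 1)) := by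
    rw [Finset.sum_range_succ, Finset.sum_range_succ, Finset.sum_range_succ _ (N + 1),
      Finset.sum_range_succ _ N, hcoef, one_smul]
    have : ∀ j ∈ Finset.range N, (closedLoop Θ K).charpoly.coeff j • truncSeq N ν j
        = (closedLoop Θ K).charpoly.coeff j • ν j := fun j hj => by
      simp [truncSeq, Finset.mem_range.1 hj]
    rw [Finset.sum_congr rfl this]
    simp [truncSeq, add_assoc]
  simp only [excitation, sumElim_dotProduct_sumElim, hsum, filteredState_eq Θ K w ν]
  have e1 : ∀ y, b ⬝ᵥ K *ᵥ y = (Kᵀ *ᵥ b) ⬝ᵥ y := fun y => by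
    rw [Matrix.dotProduct_mulVec, Matrix.mulVec_transpose]
  have e2 : ((inputMat Θ)ᵀ *ᵥ (a + Kᵀ *ᵥ b)) ⬝ᵥ ν N = (a + Kᵀ *ᵥ b) ⬝ᵥ inputMat Θ *ᵥ ν N := by
    rw [Matrix.dotProduct_mulVec, Matrix.mulVec_transpose]
  simp only [dotProduct_add, add_dotProduct, smul_dotProduct, dotProduct_smul, e1, e2]
  ring

theorem eucNorm_transpose_mulVec_le {κ : ℝ} {n d : ℕ} {K : Matrix (Fin d) (Fin n) ℝ}
    (hK : specNorm K ≤ κ) (b : Fin d → ℝ) : eucNorm (Kᵀ *ᵥ b) ≤ κ * eucNorm b := by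
  have h1 : eucNorm (Kᵀ *ᵥ b) ^ 2 = b ⬝ᵥ K *ᵥ (Kᵀ *ᵥ b) := by
    rw [eucNorm_sq_eq_dotProduct, Matrix.dotProduct_mulVec b K, ← Matrix.mulVec_transpose K b]
  have h2 := (le_abs_self _).trans (abs_dotProduct_le b (K *ᵥ (Kᵀ *ᵥ b)))
  have h3 := (eucNorm_mulVec_le_specNorm K (Kᵀ *ᵥ b)).trans
    (mul_le_mul_of_nonneg_right hK (eucNorm_nonneg _))
  have h4 := mul_le_mul_of_nonneg_left h3 (eucNorm_nonneg b)
  rcases (eucNorm_nonneg (Kᵀ *ᵥ b)).eq_or_lt with h0 | h0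
  · rw [← h0]
    exact mul_nonneg ((specNorm_nonneg K).trans hK) (eucNorm_nonneg b)
  · nlinarith

end LeadingNoise

/-! ### Conditional small-ball estimate -/

section ConditionalSmallBall

variable {Ω : Type*} {mΩ : MeasurableSpace Ω} {P : Measure Ω} [IsProbabilityMeasure P]
  {ℱ : Filtration ℕ mΩ} {n d : ℕ} {σw σbar σνsq : ℝ} {w : ℕ → Ω → Fin n → ℝ}
  {ν : ℕ → Ω → Fin d → ℝ}

theorem measurable_eucNorm {ι : Type*} [Fintype ι] : Measurable (eucNorm : (ι → ℝ) → ℝ) := by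
  have : (eucNorm : (ι → ℝ) → ℝ) = fun v => √(∑ i, v i ^ 2) := by
    ext v
    rw [← eucNorm_sq, Real.sqrt_sq (eucNorm_nonneg v)]
  rw [this]
  fun_prop

/-- The perturbation ν (s+1) is independent of ℱ (s+1) and becomes the inner integral; then w s is
integrated with ν s frozen. The term in ν s joins the shift, which is why no bound on `e` is
required. -/
theorem lintegral_smallBall_step_le (hσ : 0 < σw) (hσν : 0 < σνsq) (hw : IsNoise P ℱ σw σbar w)
    (hν : IsPerturbation P ℱ σνsq w ν) (s : ℕ) {Y : Ω → ENNReal} {g : Ω → ℝ}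
    {e : Ω → Fin d → ℝ} {a : Ω → Fin n → ℝ} (b : Fin d → ℝ) (hY : Measurable[ℱ s] Y)
    (hg : Measurable[ℱ s] g) (he : Measurable[ℱ s] e) (ha : Measurable[ℱ s] a) {r C : ℝ}
    (hr : 0 < r) (hr1 : r ≤ 1) (hC : 1 ≤ C)
    (h2 : ∀ ω, r ≤ σbar ^ 2 * eucNorm (a ω) ^ 2 + σνsq * eucNorm b ^ 2)
    (h4 : ∀ ω, 8 * (eucNorm (a ω) ^ 4 * (n ^ 2 * (96 * σw ^ 4))
      + eucNorm b ^ 4 * (d ^ 2 * (96 * σνsq ^ 2))) ≤ C) :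
    ∫⁻ ω, Y ω * ENNReal.ofReal (Real.exp (-min
        ((g ω + e ω ⬝ᵥ ν s ω + a ω ⬝ᵥ w s ω + b ⬝ᵥ ν (s + 1) ω) ^ 2) 1)) ∂P
      ≤ ENNReal.ofReal (1 - r ^ 2 / (8 * C) / 2) * ∫⁻ ω, Y ω ∂P := by
  set γ : Measure (Fin d → ℝ) := Measure.pi fun _ : Fin d => gaussianReal 0 σνsq.toNNReal with hγdef
  have hγ : IsNoiseLaw γ (√σνsq) (√σνsq) := by
    have := isNoiseLaw_pi_gaussianReal (ι := Fin d) σνsq.toNNReal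
    rwa [Real.coe_toNNReal _ hσν.le] at this
  have hνm : Measurable[ℱ (s + 1)] (ν s) := hν.measurable s
  have hwm : Measurable[ℱ (s + 1)] (w s) := hw.measurable s
  have hYm : Measurable Y := hY.mono (ℱ.le s) le_rfl
  have hle : ℱ s ≤ ℱ (s + 1) := ℱ.mono s.le_succ
  have hX1 : Measurable[ℱ (s + 1)]
      fun ω => (Y ω, g ω + e ω ⬝ᵥ ν s ω + a ω ⬝ᵥ w s ω) := by
    have hY1 := hY.mono hle le_rfl
    have hg1 := hg.mono hle le_rfl
    have he1 := he.mono hle le_rfl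
    have ha1 := ha.mono hle le_rfl
    let _ : MeasurableSpace Ω := ℱ (s + 1)
    exact hY1.prodMk ((hg1.add (measurable_dotProduct
      (fun j => (measurable_pi_apply j).comp he1) (fun j => (measurable_pi_apply j).comp hνm))).add
      (measurable_dotProduct (fun j => (measurable_pi_apply j).comp ha1)
        (fun j => (measurable_pi_apply j).comp hwm)))
  have hX1' : Measurable fun ω => (Y ω, g ω + e ω ⬝ᵥ ν s ω + a ω ⬝ᵥ w s ω) :=
    hX1.mono (ℱ.le _) le_rfl
  have step1 := hν.lintegral_eq (s + 1) (hX1.mono le_sup_left le_rfl) hX1'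
    (G := fun (x : ENNReal × ℝ) q =>
      x.1 * ENNReal.ofReal (Real.exp (-min ((x.2 + b ⬝ᵥ q) ^ 2) 1)))
    (by unfold Function.uncurry; fun_prop)
  simp only at step1
  rw [step1, lintegral_lintegral_swap]
  swap
  · refine Measurable.aemeasurable ?_
    have hg' := hX1'.snd
    simp only at hg'
    exact (by fun_prop : Measurable fun x : (Fin d → ℝ) × ENNReal × ℝ =>
      x.2.1 * ENNReal.ofReal (Real.exp (-min ((x.2.2 + b ⬝ᵥ x.1) ^ 2) 1))).comp
      (measurable_fst.prodMk (hX1'.comp measurable_snd))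
  classical
  have hX : Measurable[ℱ s] fun ω => (Y ω, g ω, e ω, a ω) := hY.prodMk (hg.prodMk (he.prodMk ha))
  let ok : Set (Fin n → ℝ) := {a | r ≤ σbar ^ 2 * eucNorm a ^ 2 + σνsq * eucNorm b ^ 2 ∧
    8 * (eucNorm a ^ 4 * (n ^ 2 * (96 * σw ^ 4))
      + eucNorm b ^ 4 * (d ^ 2 * (96 * σνsq ^ 2))) ≤ C}
  have hok : MeasurableSet ok := by
    have := measurable_eucNorm (ι := Fin n)
    exact (measurableSet_le measurable_const (by fun_prop : Measurable fun a : Fin n → ℝ =>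
      σbar ^ 2 * eucNorm a ^ 2 + σνsq * eucNorm b ^ 2)).inter
      (measurableSet_le (by fun_prop : Measurable fun a : Fin n → ℝ =>
        8 * (eucNorm a ^ 4 * (n ^ 2 * (96 * σw ^ 4))
          + eucNorm b ^ 4 * (d ^ 2 * (96 * σνsq ^ 2)))) measurable_const)
  have hγp := hγ.prob
  let F : ENNReal × ℝ × (Fin d → ℝ) × (Fin n → ℝ) → (Fin d → ℝ) → (Fin n → ℝ) → ENNReal :=
    fun X p y => if X.2.2.2 ∈ ok then X.1 * ∫⁻ q, ENNReal.ofReal (Real.exp (-min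
      ((X.2.1 + X.2.2.1 ⬝ᵥ p + (X.2.2.2 ⬝ᵥ y + b ⬝ᵥ q)) ^ 2) 1)) ∂γ else 0
  have hinner : Measurable fun z : (ENNReal × ℝ × (Fin d → ℝ) × (Fin n → ℝ)) × (Fin d → ℝ)
      × (Fin n → ℝ) => ∫⁻ q, ENNReal.ofReal (Real.exp (-min
      ((z.1.2.1 + z.1.2.2.1 ⬝ᵥ z.2.1 + (z.1.2.2.2 ⬝ᵥ z.2.2 + b ⬝ᵥ q)) ^ 2) 1)) ∂γ := by
    refine Measurable.lintegral_prod_right' (f := fun zq : ((ENNReal × ℝ × (Fin d → ℝ) ×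
      (Fin n → ℝ)) × (Fin d → ℝ) × (Fin n → ℝ)) × (Fin d → ℝ) => ENNReal.ofReal (Real.exp (-min
      ((zq.1.1.2.1 + zq.1.1.2.2.1 ⬝ᵥ zq.1.2.1 + (zq.1.1.2.2.2 ⬝ᵥ zq.1.2.2 + b ⬝ᵥ zq.2)) ^ 2) 1))) ?_
    simp only [dotProduct]
    fun_prop
  have hF : Measurable fun z : (ENNReal × ℝ × (Fin d → ℝ) × (Fin n → ℝ)) × (Fin d → ℝ)
      × (Fin n → ℝ) => F z.1 z.2.1 z.2.2 := by
    refine Measurable.ite ?_ (Measurable.mul (by fun_prop) hinner) measurable_const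
    exact (by fun_prop : Measurable fun z : (ENNReal × ℝ × (Fin d → ℝ) × (Fin n → ℝ))
      × (Fin d → ℝ) × (Fin n → ℝ) => z.1.2.2.2) hok
  have step2 := lintegral_perturbed_noise_le hw hν s hX hF
    (b := fun X _ => ENNReal.ofReal (1 - r ^ 2 / (8 * C) / 2) * X.1)
    (by unfold Function.uncurry; fun_prop) (by
      intro μ hμ X p
      simp only [F]
      split_ifs with h
      · have hm : Measurable fun y : Fin n → ℝ => ∫⁻ q, ENNReal.ofReal (Real.exp (-min
            ((X.2.1 + X.2.2.1 ⬝ᵥ p + (X.2.2.2 ⬝ᵥ y + b ⬝ᵥ q)) ^ 2) 1)) ∂γ :=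
          hinner.comp (f := fun y => (X, p, y)) (by fun_prop)
        rw [lintegral_const_mul _ hm, mul_comm]
        gcongr
        refine lintegral_exp_neg_min_dotProduct_le hμ hγ hσ (Real.sqrt_pos.2 hσν) hr hr1 hC ?_ ?_ _
        · rw [Real.sq_sqrt hσν.le]
          exact h.1
        · have : √σνsq ^ 4 = σνsq ^ 2 := by
            rw [show (4 : ℕ) = 2 * 2 by norm_num, pow_mul, Real.sq_sqrt hσν.le]
          rw [this, Fintype.card_fin, Fintype.card_fin]
          exact h.2
      · simp)
  rw [lintegral_const_mul _ hYm] at step2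
  refine le_trans (le_of_eq (lintegral_congr fun ω => ?_)) step2
  have hmem : a ω ∈ ok := ⟨h2 ω, h4 ω⟩
  simp only [F, if_pos hmem]
  rw [lintegral_const_mul _ (by fun_prop)]
  simp only [add_assoc]
  rfl

end ConditionalSmallBall

end StabL

namespace StabL

/-! ### A finite net of directions -/

section Net

variable {ι : Type*} [Fintype ι] [DecidableEq ι]

/-- The points of the cube `[-1, 1]^ι` with coordinates in `k⁻¹ ℤ`. -/
noncomputable def cubeGrid (ι : Type*) [Fintype ι] [DecidableEq ι] (k : ℕ) : Finset (ι → ℝ) :=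
  (Fintype.piFinset fun _ : ι => Finset.Icc (-(k : ℤ)) k).image fun z i => (z i : ℝ) / k

theorem card_cubeGrid_le (k : ℕ) : (cubeGrid ι k).card ≤ (2 * k + 1) ^ Fintype.card ι := by
  refine Finset.card_image_le.trans ?_
  rw [Fintype.card_piFinset]
  simp only [Int.card_Icc, Finset.prod_const, Finset.card_univ]
  gcongr
  omega

theorem exists_mem_cubeGrid {k : ℕ} (hk : 0 < k) {v : ι → ℝ} (hv : ∀ i, |v i| ≤ 1) :
    ∃ v' ∈ cubeGrid ι k, ∀ i, |v i - v' i| ≤ 1 / k := by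
  have hk' : (0 : ℝ) < k := by exact_mod_cast hk
  refine ⟨fun i => (⌊k * v i⌋ : ℝ) / k, ?_, fun i => ?_⟩
  · refine Finset.mem_image.2 ⟨fun i => ⌊k * v i⌋, ?_, rfl⟩
    rw [Fintype.mem_piFinset]
    intro i
    have h := abs_le.1 (hv i)
    rw [Finset.mem_Icc]
    constructor
    · apply Int.le_floor.2
      push_cast
      nlinarith [h.1]
    · have h1 : (⌊k * v i⌋ : ℝ) ≤ k := (Int.floor_le _).trans (by nlinarith [h.2])
      exact_mod_cast h1
  · have h1 := Int.floor_le (k * v i)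
    have h2 := Int.lt_floor_add_one (k * v i)
    have e : v i - (⌊k * v i⌋ : ℝ) / k = (k * v i - ⌊k * v i⌋) / k := by
      field_simp
    rw [e, abs_of_nonneg (div_nonneg (by linarith) hk'.le)]
    gcongr
    linarith

theorem min_sq_one_le_add (y y' : ℝ) : min (y ^ 2) 1 ≤ min (y' ^ 2) 1 + 2 * |y - y'| := by
  have h0 : |y| ≤ |y'| + |y - y'| := by
    have := abs_add_le y' (y - y')
    rwa [add_sub_cancel] at this
  rcases le_total 1 |y'| with h | h
  · have h1 : 1 ≤ y' ^ 2 := by rw [← sq_abs]; nlinarith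
    rw [min_eq_right h1]
    have := min_le_right (y ^ 2) 1
    linarith [abs_nonneg (y - y')]
  · have h1 : y' ^ 2 ≤ 1 := by rw [← sq_abs]; nlinarith [abs_nonneg y']
    rw [min_eq_left h1]
    rcases le_total |y| 1 with h2 | h2
    · refine (min_le_left _ _).trans ?_
      rw [← sq_abs y, ← sq_abs y']
      nlinarith [abs_nonneg y, abs_nonneg y', abs_nonneg (y - y')]
    · refine (min_le_right _ _).trans ?_
      rw [← sq_abs y']
      nlinarith [abs_nonneg y']

/-- The truncated square is 2-Lipschitz, and a grid point is within card/k of the unit vector v. The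
mesh makes the loss at most q/4 per term, half of what the grid provides. -/
theorem sum_min_sq_one_ge_of_grid {k J : ℕ} (hk : 0 < k) {Z : ℕ → ι → ℝ} {q B : ℝ}
    (hZ : ∀ j < J, eucNorm (Z j) ≤ B) (hk2 : 2 * (Fintype.card ι : ℝ) ≤ k)
    (hkB : 8 * Fintype.card ι * B ≤ q * k)
    (hgrid : ∀ v ∈ cubeGrid ι k, 1 / 2 ≤ eucNorm v → eucNorm v ≤ 2 →
      q / 2 * J ≤ ∑ j ∈ Finset.range J, min ((v ⬝ᵥ Z j) ^ 2) 1)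
    {v : ι → ℝ} (hv : eucNorm v = 1) :
    q / 4 * J ≤ ∑ j ∈ Finset.range J, min ((v ⬝ᵥ Z j) ^ 2) 1 := by
  have hk' : (0 : ℝ) < k := by exact_mod_cast hk
  obtain ⟨v', hv', hclose⟩ := exists_mem_cubeGrid hk (v := v)
    fun i => (abs_apply_le_eucNorm v i).trans hv.le
  have hdist : eucNorm (v - v') ≤ Fintype.card ι * (1 / k) :=
    eucNorm_le_of_abs_le (by positivity) hclose
  have hhalf : (Fintype.card ι : ℝ) * (1 / k) ≤ 1 / 2 := by
    rw [mul_one_div, div_le_iff₀ hk']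
    linarith
  have h1 : eucNorm v ≤ eucNorm (v - v') + eucNorm v' := by
    have := eucNorm_add_le (v - v') v'
    rwa [sub_add_cancel] at this
  have h2 : eucNorm v' ≤ eucNorm v + eucNorm (v - v') := by
    have := eucNorm_sub_le v (v - v')
    rwa [sub_sub_cancel] at this
  have h3 := hgrid v' hv' (by linarith) (by linarith)
  have h4 : ∀ j ∈ Finset.range J, min ((v' ⬝ᵥ Z j) ^ 2) 1 ≤ min ((v ⬝ᵥ Z j) ^ 2) 1 + q / 4 := by
    intro j hj
    refine (min_sq_one_le_add (v' ⬝ᵥ Z j) (v ⬝ᵥ Z j)).trans ?_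
    gcongr
    have h5 : |v' ⬝ᵥ Z j - v ⬝ᵥ Z j| ≤ Fintype.card ι * (1 / k) * B := by
      rw [abs_sub_comm, ← sub_dotProduct]
      refine (abs_dotProduct_le _ _).trans ?_
      exact mul_le_mul hdist (hZ j (Finset.mem_range.1 hj)) (eucNorm_nonneg _) (by positivity)
    have h6 : (Fintype.card ι : ℝ) * (1 / k) * B = Fintype.card ι * B / k := by ring
    rw [h6, le_div_iff₀ hk'] at h5
    nlinarith
  have h5 := Finset.sum_le_sum h4
  rw [Finset.sum_add_distrib] at h5
  simp only [Finset.sum_const, Finset.card_range, nsmul_eq_mul] at h5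
  linarith

end Net

/-! ### Persistent excitation along a run -/

section Excitation

theorem measurable_dotProduct_excitation {Ω : Type*} [MeasurableSpace Ω] {n d : ℕ}
    (Θ : Param n d) {K : Ω → Matrix (Fin d) (Fin n) ℝ} {w : ℕ → Ω → Fin n → ℝ}
    {ν : ℕ → Ω → Fin d → ℝ} (hK : ∀ i j, Measurable fun ω => K ω i j)
    (hw : ∀ j, Measurable (w j)) (hν : ∀ j, Measurable (ν j)) (v : Fin n ⊕ Fin d → ℝ) :
    Measurable fun ω => v ⬝ᵥ excitation Θ (K ω) (fun j => w j ω) (fun j => ν j ω) := by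
  have hM : ∀ i j, Measurable fun ω => closedLoop Θ (K ω) i j := by
    intro i j
    simp only [closedLoop, Matrix.add_apply, Matrix.mul_apply]
    exact measurable_const.add (Finset.measurable_sum _ fun l _ => (hK l j).const_mul _)
  have hc : ∀ j, Measurable fun ω => (closedLoop Θ (K ω)).charpoly.coeff j := fun j =>
    (continuous_charpoly_coeff j).measurable.comp
      (measurable_pi_lambda _ fun i => measurable_pi_lambda _ fun k => hM i k)
  have hξ : ∀ j i, Measurable fun ω => (inputMat Θ *ᵥ ν j ω + w j ω) i := fun j i => by
    simp only [Pi.add_apply]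
    exact (measurable_mulVec_apply (M := fun _ => inputMat Θ) (fun _ _ => measurable_const)
      (fun l => (measurable_pi_apply l).comp (hν j)) i).add ((measurable_pi_apply i).comp (hw j))
  have hX : ∀ j i, Measurable fun ω => frozenState (closedLoop Θ (K ω))
      (fun j => inputMat Θ *ᵥ ν j ω + w j ω) j i := by
    intro j
    induction j with
    | zero => intro i; exact measurable_const
    | succ j ih =>
      intro i
      simp only [frozenState, Pi.add_apply]
      exact (measurable_mulVec_apply hM ih i).add (hξ j i)
  have hf : ∀ i, Measurable fun ω =>
      filteredState Θ (K ω) (fun j => w j ω) (fun j => ν j ω) i := by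
    intro i
    simp only [filteredState, Finset.sum_apply, Pi.smul_apply, smul_eq_mul]
    exact Finset.measurable_sum _ fun j _ => (hc j).mul (hX j i)
  refine measurable_dotProduct (fun _ => measurable_const) fun k => ?_
  cases k with
  | inl i => exact hf i
  | inr i =>
    simp only [excitation, Sum.elim_inr, Pi.add_apply, Finset.sum_apply, Pi.smul_apply, smul_eq_mul]
    exact (measurable_mulVec_apply hK hf i).add (Finset.measurable_sum _ fun j _ =>
      (hc j).mul ((measurable_pi_apply i).comp (hν j)))

variable {Ω : Type*} {mΩ : MeasurableSpace Ω} {P : Measure Ω} [IsProbabilityMeasure P]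
  {ℱ : Filtration ℕ mΩ} {N n d : ℕ} {σw σbar κ γ S lam δ : ℝ} {Tw : ℕ}

set_option linter.unusedSectionVars false

theorem IsRun.mem_stabSet {Q : Matrix (Fin n) (Fin n) ℝ} {R : Matrix (Fin d) (Fin d) ℝ}
    {Θstar : Param n d} {w : ℕ → Ω → Fin n → ℝ} {ν : ℕ → Ω → Fin d → ℝ}
    {x : ℕ → Ω → Fin n → ℝ} {u : ℕ → Ω → Fin d → ℝ} {Θt : ℕ → Ω → Param n d}
    (hr : IsRun ℱ Q R σw σbar κ γ S lam δ Tw Θstar w ν x u Θt) (t : ℕ) (ω : Ω) :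
    Θt t ω ∈ stabSet Q R κ γ S := by
  induction t with
  | zero => exact hr.init_param ω
  | succ t ih =>
    by_cases h : UpdatesAt κ γ lam (fun s => x s ω) (fun s => u s ω) (t + 1) ∧
      (confSet σw lam S δ (fun s => x s ω) (fun s => u s ω) (t + 1) ∩ stabSet Q R κ γ S).Nonempty
    · exact (hr.optimistic (t + 1) ω h.1 h.2).1.2
    · rw [hr.keep (t + 1) ω h]
      exact ih

variable {Q : Matrix (Fin (N + 1)) (Fin (N + 1)) ℝ} {R : Matrix (Fin d) (Fin d) ℝ}
  {Θstar : Param (N + 1) d} {w : ℕ → Ω → Fin (N + 1) → ℝ} {ν : ℕ → Ω → Fin d → ℝ}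
  {x : ℕ → Ω → Fin (N + 1) → ℝ} {u : ℕ → Ω → Fin d → ℝ} {Θt : ℕ → Ω → Param (N + 1) d}

/-- The excitation of the closed loop frozen at time `t`. -/
noncomputable def runExcitation {n : ℕ} (Q : Matrix (Fin n) (Fin n) ℝ)
    (R : Matrix (Fin d) (Fin d) ℝ) (Θstar : Param n d) (w : ℕ → Ω → Fin n → ℝ)
    (ν : ℕ → Ω → Fin d → ℝ) (Θt : ℕ → Ω → Param n d) (t : ℕ) (ω : Ω) : Fin n ⊕ Fin d → ℝ :=
  excitation Θstar (gain Q R (Θt (t - 1) ω)) (fun j => w (t + j) ω) (fun j => ν (t + j) ω)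

theorem measurable_truncSeq {E : Type*} [MeasurableSpace E] [Zero E] {f : ℕ → Ω → E}
    (hf : ∀ t, Measurable[ℱ (t + 1)] (f t)) (t j : ℕ) :
    Measurable[ℱ (t + N)] fun ω => truncSeq N (fun j => f (t + j) ω) j := by
  by_cases h : j < N
  · simp only [truncSeq, h, if_true]
    exact (hf (t + j)).mono (ℱ.mono (by omega)) le_rfl
  · simp only [truncSeq, h, if_false]
    exact measurable_const

/-- The lower bound on the conditional variance of the excitation. -/
noncomputable def excitationVar (σbar : ℝ) : ℝ := min 1 (σbar ^ 2 / 8)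

/-- An upper bound for the conditional fourth moment of the excitation. -/
noncomputable def excitationFourth (n d : ℕ) (σw σbar κ : ℝ) : ℝ :=
  1 + 8 * ((2 * (1 + κ)) ^ 4 * (n ^ 2 * (96 * σw ^ 4))
    + 2 ^ 4 * (d ^ 2 * (96 * (2 * κ ^ 2 * σbar ^ 2) ^ 2)))

/-- The small-ball rate of the excitation. -/
noncomputable def excitationRate (n d : ℕ) (σw σbar κ : ℝ) : ℝ :=
  excitationVar σbar ^ 2 / (8 * excitationFourth n d σw σbar κ) / 2

theorem one_le_excitationFourth (n d : ℕ) (σw σbar κ : ℝ) :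
    1 ≤ excitationFourth n d σw σbar κ := by
  unfold excitationFourth
  have : 0 ≤ 8 * ((2 * (1 + κ)) ^ 4 * (n ^ 2 * (96 * σw ^ 4))
    + 2 ^ 4 * (d ^ 2 * (96 * (2 * κ ^ 2 * σbar ^ 2) ^ 2))) := by positivity
  linarith

theorem excitationVar_pos (hσ : 0 < σbar) : 0 < excitationVar σbar :=
  lt_min one_pos (by positivity)

theorem excitationRate_pos (n d : ℕ) (σw κ : ℝ) (hσ : 0 < σbar) :
    0 < excitationRate n d σw σbar κ := by
  have h1 := excitationVar_pos hσ
  have h2 := one_le_excitationFourth n d σw σbar κ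
  unfold excitationRate
  positivity

theorem IsRun.measurable_dotProduct_runExcitation (hw : IsNoise P ℱ σw σbar w)
    (hν : IsPerturbation P ℱ (2 * κ ^ 2 * σbar ^ 2) w ν)
    (hr : IsRun ℱ Q R σw σbar κ γ S lam δ Tw Θstar w ν x u Θt) (t : ℕ)
    (v : Fin (N + 1) ⊕ Fin d → ℝ) :
    Measurable[ℱ (t + N + 2)] fun ω => v ⬝ᵥ runExcitation Q R Θstar w ν Θt t ω := by
  have hK := fun i j => (hr.measurable_gain_prev t i j).mono
    (ℱ.mono (show t ≤ t + N + 2 by omega)) le_rfl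
  -- Only the N+2 noises at times t to t+N+1 enter, so truncation changes nothing and shows that the
  -- vector is known at time t+N+2.
  have e : ∀ ω, runExcitation Q R Θstar w ν Θt t ω
      = excitation Θstar (gain Q R (Θt (t - 1) ω))
          (fun j => truncSeq (N + 2) (fun j => w (t + j) ω) j)
          (fun j => truncSeq (N + 2) (fun j => ν (t + j) ω) j) := by
    intro ω
    have hfs : ∀ M : Matrix (Fin (N + 1)) (Fin (N + 1)) ℝ, ∀ j ∈ Finset.range (N + 1 + 1),
        frozenState M (fun j => inputMat Θstar *ᵥ ν (t + j) ω + w (t + j) ω) j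
        = frozenState M (fun j => inputMat Θstar *ᵥ truncSeq (N + 2) (fun j => ν (t + j) ω) j
            + truncSeq (N + 2) (fun j => w (t + j) ω) j) j := by
      intro M j hj
      refine frozenState_congr fun i hi => ?_
      have : i < N + 2 := by have := Finset.mem_range.1 hj; omega
      simp [truncSeq, this]
    have hf : filteredState Θstar (gain Q R (Θt (t - 1) ω)) (fun j => w (t + j) ω)
        (fun j => ν (t + j) ω)
        = filteredState Θstar (gain Q R (Θt (t - 1) ω))
          (fun j => truncSeq (N + 2) (fun j => w (t + j) ω) j)
          (fun j => truncSeq (N + 2) (fun j => ν (t + j) ω) j) := by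
      unfold filteredState
      exact Finset.sum_congr rfl fun j hj => by rw [hfs _ j hj]
    have hs : ∀ c : ℕ → ℝ, ∑ j ∈ Finset.range (N + 1 + 1), c j • ν (t + j) ω
        = ∑ j ∈ Finset.range (N + 1 + 1), c j • truncSeq (N + 2) (fun j => ν (t + j) ω) j := by
      intro c
      refine Finset.sum_congr rfl fun j hj => ?_
      have : j < N + 2 := Finset.mem_range.1 hj
      simp [truncSeq, this]
    rw [runExcitation, excitation, excitation, ← hf, hs]
  simp only [e]
  have h1 := fun j => measurable_truncSeq (N := N + 2) hw.measurable t j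
  have h2 := fun j => measurable_truncSeq (N := N + 2) hν.measurable t j
  let _ : MeasurableSpace Ω := ℱ (t + N + 2)
  exact measurable_dotProduct_excitation Θstar (K := fun ω => gain Q R (Θt (t - 1) ω))
    (w := fun j ω => truncSeq (N + 2) (fun j => w (t + j) ω) j)
    (ν := fun j ω => truncSeq (N + 2) (fun j => ν (t + j) ω) j) hK h1 h2 v

/-- The excitation satisfies a conditional small-ball estimate in every direction. -/
theorem IsRun.lintegral_runExcitation_step_le (hσ : 0 < σw) (hσbar : 0 < σbar) (hκ : 1 ≤ κ)
    (hw : IsNoise P ℱ σw σbar w) (hν : IsPerturbation P ℱ (2 * κ ^ 2 * σbar ^ 2) w ν)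
    (hr : IsRun ℱ Q R σw σbar κ γ S lam δ Tw Θstar w ν x u Θt) (t : ℕ)
    {v : Fin (N + 1) ⊕ Fin d → ℝ} (hv1 : 1 / 2 ≤ eucNorm v) (hv2 : eucNorm v ≤ 2)
    {Y : Ω → ENNReal} (hY : Measurable[ℱ (t + N)] Y) :
    ∫⁻ ω, Y ω * ENNReal.ofReal (Real.exp (-min
        ((v ⬝ᵥ runExcitation Q R Θstar w ν Θt t ω) ^ 2) 1)) ∂P
      ≤ ENNReal.ofReal (1 - excitationRate (N + 1) d σw σbar κ) * ∫⁻ ω, Y ω ∂P := by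
  obtain ⟨a, b, rfl⟩ : ∃ a b, v = Sum.elim a b := ⟨_, _, (Sum.elim_comp_inl_inr v).symm⟩
  have hKm := fun i j => (hr.measurable_gain_prev t i j).mono
    (ℱ.mono (show t ≤ t + N by omega)) le_rfl
  have hwm := fun j => measurable_truncSeq (N := N) hw.measurable t j
  have hνm := fun j => measurable_truncSeq (N := N) hν.measurable t j
  set K : Ω → Matrix (Fin d) (Fin (N + 1)) ℝ := fun ω => gain Q R (Θt (t - 1) ω) with hKdef
  have hKb : ∀ ω, specNorm (K ω) ≤ κ := fun ω => (hr.mem_stabSet (t - 1) ω).1.2.1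
  have ha : Measurable[ℱ (t + N)] fun ω => a + (K ω)ᵀ *ᵥ b := by
    let _ : MeasurableSpace Ω := ℱ (t + N)
    refine measurable_pi_lambda _ fun i => ?_
    simp only [Pi.add_apply]
    exact measurable_const.add (measurable_mulVec_apply (M := fun ω => (K ω)ᵀ)
      (fun i j => hKm j i) (v := fun _ => b) (fun _ => measurable_const) i)
  have he : Measurable[ℱ (t + N)] fun ω => (inputMat Θstar)ᵀ *ᵥ (a + (K ω)ᵀ *ᵥ b)
      + (closedLoop Θstar (K ω)).charpoly.coeff N • b := by
    let _ : MeasurableSpace Ω := ℱ (t + N)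
    have hM : ∀ i j, Measurable fun ω => closedLoop Θstar (K ω) i j := by
      intro i j
      simp only [closedLoop, Matrix.add_apply, Matrix.mul_apply]
      exact measurable_const.add (Finset.measurable_sum _ fun l _ => (hKm l j).const_mul _)
    have hc : Measurable fun ω => (closedLoop Θstar (K ω)).charpoly.coeff N :=
      (continuous_charpoly_coeff N).measurable.comp
        (measurable_pi_lambda _ fun i => measurable_pi_lambda _ fun k => hM i k)
    refine measurable_pi_lambda _ fun i => ?_
    simp only [Pi.add_apply, Pi.smul_apply, smul_eq_mul]
    exact (measurable_mulVec_apply (M := fun _ => (inputMat Θstar)ᵀ) (fun _ _ => measurable_const)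
      (fun j => (measurable_pi_apply j).comp ha) i).add (hc.mul_const _)
  have hg : Measurable[ℱ (t + N)] fun ω => Sum.elim a b ⬝ᵥ excitation Θstar (K ω)
      (truncSeq N fun j => w (t + j) ω) (truncSeq N fun j => ν (t + j) ω) := by
    let _ : MeasurableSpace Ω := ℱ (t + N)
    exact measurable_dotProduct_excitation Θstar (K := K)
      (w := fun j ω => truncSeq N (fun j => w (t + j) ω) j)
      (ν := fun j ω => truncSeq N (fun j => ν (t + j) ω) j) hKm hwm hνm _
  have hσν : 0 < 2 * κ ^ 2 * σbar ^ 2 := by positivity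
  have hvsq := eucNorm_sumElim_sq a b
  have hva := eucNorm_le_sumElim_left a b
  have hvb : eucNorm b ≤ eucNorm (Sum.elim a b) := by
    apply le_of_sq_le_sq _ (eucNorm_nonneg _)
    rw [hvsq]
    nlinarith [sq_nonneg (eucNorm a)]
  have hKT : ∀ ω, eucNorm ((K ω)ᵀ *ᵥ b) ≤ κ * eucNorm b := fun ω =>
    eucNorm_transpose_mulVec_le (hKb ω) b
  have hup : ∀ ω, eucNorm (a + (K ω)ᵀ *ᵥ b) ≤ 2 * (1 + κ) := fun ω => by
    have h1 := eucNorm_add_le a ((K ω)ᵀ *ᵥ b)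
    have h2 := hKT ω
    have h3 : κ * eucNorm b ≤ κ * 2 := by gcongr; linarith
    linarith
  have hlow : ∀ ω, eucNorm a ≤ eucNorm (a + (K ω)ᵀ *ᵥ b) + κ * eucNorm b := fun ω => by
    have h1 := eucNorm_sub_le (a + (K ω)ᵀ *ᵥ b) ((K ω)ᵀ *ᵥ b)
    rw [add_sub_cancel_right] at h1
    linarith [hKT ω]
  have key := lintegral_smallBall_step_le hσ hσν hw hν (t + N) b hY hg he ha
    (r := excitationVar σbar) (C := excitationFourth (N + 1) d σw σbar κ)
    (excitationVar_pos hσbar) (min_le_left _ _) (one_le_excitationFourth _ _ _ _ _)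
    (by
      intro ω
      refine (min_le_right _ _).trans ?_
      -- From |a| ≤ |a+Kᵀb| + κ|b| and κ ≥ 1: 1/4 ≤ |a|²+|b|² ≤ 2|a+Kᵀb|² + 3κ²|b|² ≤ 2(|a+Kᵀb|² +
      -- 2κ²|b|²). The factor 2κ² in the variance of ν is matched to this.
      have h1 := hlow ω
      have h2 : 1 / 4 ≤ eucNorm a ^ 2 + eucNorm b ^ 2 := by rw [← hvsq]; nlinarith
      have h3 : eucNorm a ^ 2 ≤ 2 * eucNorm (a + (K ω)ᵀ *ᵥ b) ^ 2
          + 2 * κ ^ 2 * eucNorm b ^ 2 := by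
        have h4 := pow_le_pow_left₀ (eucNorm_nonneg a) h1 2
        nlinarith [sq_nonneg (eucNorm (a + (K ω)ᵀ *ᵥ b) - κ * eucNorm b)]
      have h5 : eucNorm b ^ 2 ≤ κ ^ 2 * eucNorm b ^ 2 := by
        have : 1 ≤ κ ^ 2 := by nlinarith
        nlinarith [sq_nonneg (eucNorm b)]
      have h7 : 0 ≤ κ ^ 2 * eucNorm b ^ 2 := by positivity
      have h6 : 1 / 8 ≤ eucNorm (a + (K ω)ᵀ *ᵥ b) ^ 2 + 2 * κ ^ 2 * eucNorm b ^ 2 := by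
        linarith
      calc σbar ^ 2 / 8 = σbar ^ 2 * (1 / 8) := by ring
        _ ≤ σbar ^ 2 * (eucNorm (a + (K ω)ᵀ *ᵥ b) ^ 2 + 2 * κ ^ 2 * eucNorm b ^ 2) := by gcongr
        _ = _ := by ring)
    (by
      intro ω
      unfold excitationFourth
      have h1 := pow_le_pow_left₀ (eucNorm_nonneg _) (hup ω) 4
      have h2 := pow_le_pow_left₀ (eucNorm_nonneg b) (hvb.trans hv2) 4
      have h3 : eucNorm (a + (K ω)ᵀ *ᵥ b) ^ 4 * (((N + 1 : ℕ) : ℝ) ^ 2 * (96 * σw ^ 4))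
          ≤ (2 * (1 + κ)) ^ 4 * (((N + 1 : ℕ) : ℝ) ^ 2 * (96 * σw ^ 4)) := by gcongr
      have h4 : eucNorm b ^ 4 * ((d : ℝ) ^ 2 * (96 * (2 * κ ^ 2 * σbar ^ 2) ^ 2))
          ≤ 2 ^ 4 * ((d : ℝ) ^ 2 * (96 * (2 * κ ^ 2 * σbar ^ 2) ^ 2)) := by gcongr
      linarith)
  refine le_trans (le_of_eq (lintegral_congr fun ω => ?_)) key
  rw [runExcitation, dotProduct_excitation_eq]
  rfl

/-- Blocks overlap but start two steps apart. The excitation of block J-1 is known at 2(J-1)+N+2 =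
2J+N, exactly when the estimate for block J starts to condition, so the factors chain. -/
theorem IsRun.lintegral_prod_runExcitation_le (hσ : 0 < σw) (hσbar : 0 < σbar) (hκ : 1 ≤ κ)
    (hw : IsNoise P ℱ σw σbar w) (hν : IsPerturbation P ℱ (2 * κ ^ 2 * σbar ^ 2) w ν)
    (hr : IsRun ℱ Q R σw σbar κ γ S lam δ Tw Θstar w ν x u Θt)
    {v : Fin (N + 1) ⊕ Fin d → ℝ} (hv1 : 1 / 2 ≤ eucNorm v) (hv2 : eucNorm v ≤ 2) (J : ℕ) :
    ∫⁻ ω, ∏ j ∈ Finset.range J, ENNReal.ofReal (Real.exp (-min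
        ((v ⬝ᵥ runExcitation Q R Θstar w ν Θt (2 * j) ω) ^ 2) 1)) ∂P
      ≤ ENNReal.ofReal (1 - excitationRate (N + 1) d σw σbar κ) ^ J := by
  induction J with
  | zero => simp
  | succ J ih =>
    simp only [Finset.prod_range_succ]
    refine (hr.lintegral_runExcitation_step_le hσ hσbar hκ hw hν (2 * J) hv1 hv2 ?_).trans ?_
    · have hm : ∀ j ∈ Finset.range J, Measurable[ℱ (2 * J + N)] fun ω =>
          v ⬝ᵥ runExcitation Q R Θstar w ν Θt (2 * j) ω := fun j hj =>
        (hr.measurable_dotProduct_runExcitation hw hν (2 * j) v).mono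
          (ℱ.mono (by have := Finset.mem_range.1 hj; omega)) le_rfl
      let _ : MeasurableSpace Ω := ℱ (2 * J + N)
      refine Finset.measurable_prod _ fun j hj => ?_
      exact ENNReal.measurable_ofReal.comp ((((hm j hj).pow_const 2).min measurable_const).neg.exp)
    · rw [pow_succ, mul_comm]
      gcongr

/-- Chernoff: the product of exponentials has mean at most exp(-qJ), and Markov at level exp(-qJ/2)
leaves exp(-qJ/2). -/
theorem IsRun.measure_sum_runExcitation_le (hσ : 0 < σw) (hσbar : 0 < σbar) (hκ : 1 ≤ κ)
    (hw : IsNoise P ℱ σw σbar w) (hν : IsPerturbation P ℱ (2 * κ ^ 2 * σbar ^ 2) w ν)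
    (hr : IsRun ℱ Q R σw σbar κ γ S lam δ Tw Θstar w ν x u Θt)
    {v : Fin (N + 1) ⊕ Fin d → ℝ} (hv1 : 1 / 2 ≤ eucNorm v) (hv2 : eucNorm v ≤ 2) (J : ℕ) :
    P {ω | ∑ j ∈ Finset.range J, min ((v ⬝ᵥ runExcitation Q R Θstar w ν Θt (2 * j) ω) ^ 2) 1
        ≤ excitationRate (N + 1) d σw σbar κ / 2 * J}
      ≤ ENNReal.ofReal (Real.exp (-(excitationRate (N + 1) d σw σbar κ / 2 * J))) := by
  set q := excitationRate (N + 1) d σw σbar κ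
  have h1 := hr.lintegral_prod_runExcitation_le hσ hσbar hκ hw hν hv1 hv2 J
  have hm : Measurable fun ω => ∏ j ∈ Finset.range J, ENNReal.ofReal (Real.exp (-min
        ((v ⬝ᵥ runExcitation Q R Θstar w ν Θt (2 * j) ω) ^ 2) 1)) := by
    refine Finset.measurable_prod _ fun j _ => ?_
    have := (hr.measurable_dotProduct_runExcitation hw hν (2 * j) v).mono (ℱ.le _) le_rfl
    fun_prop
  have h2 := mul_meas_ge_le_lintegral (μ := P) hm (ENNReal.ofReal (Real.exp (-(q / 2 * J))))
  have h3 : {ω | ∑ j ∈ Finset.range J, min ((v ⬝ᵥ runExcitation Q R Θstar w ν Θt (2 * j) ω) ^ 2) 1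
        ≤ q / 2 * J} ⊆ {ω | ENNReal.ofReal (Real.exp (-(q / 2 * J)))
        ≤ ∏ j ∈ Finset.range J, ENNReal.ofReal (Real.exp (-min
        ((v ⬝ᵥ runExcitation Q R Θstar w ν Θt (2 * j) ω) ^ 2) 1))} := by
    intro ω hω
    rw [Set.mem_ofPred_eq] at hω ⊢
    rw [← ENNReal.ofReal_prod_of_nonneg (fun _ _ => (Real.exp_pos _).le), ← Real.exp_sum]
    apply ENNReal.ofReal_le_ofReal
    apply Real.exp_le_exp.2
    rw [Finset.sum_neg_distrib]
    linarith
  have h4 : ENNReal.ofReal (1 - q) ^ J ≤ ENNReal.ofReal (Real.exp (-(q * J))) := by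
    have : ENNReal.ofReal (1 - q) ≤ ENNReal.ofReal (Real.exp (-q)) :=
      ENNReal.ofReal_le_ofReal (by linarith [Real.add_one_le_exp (-q)])
    refine (pow_le_pow_left₀ zero_le this J).trans (le_of_eq ?_)
    rw [← ENNReal.ofReal_pow (Real.exp_pos _).le, ← Real.exp_nat_mul]
    congr 2
    ring
  have h5 := ((mul_le_mul_right (measure_mono h3) _).trans h2).trans (h1.trans h4)
  have h6 : ENNReal.ofReal (Real.exp (-(q * J)))
      = ENNReal.ofReal (Real.exp (-(q / 2 * J))) * ENNReal.ofReal (Real.exp (-(q / 2 * J))) := by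
    rw [← ENNReal.ofReal_mul (Real.exp_pos _).le, ← Real.exp_add]
    congr 2
    ring
  rw [h6] at h5
  exact (ENNReal.mul_le_mul_iff_right (by simp [Real.exp_pos]) (by simp)).1 h5

end Excitation

end StabL

namespace StabL

/-! ### Failure of the noise and net events -/

section NoiseTails

variable {Ω : Type*} {mΩ : MeasurableSpace Ω} {P : Measure Ω} [IsProbabilityMeasure P]

/-- Chernoff at s = ±1 only. The resulting tail exp(-W) is enough, since W will be T. -/
theorem measure_abs_gt_le_of_mgf_le {X : Ω → ℝ} {v : ℝ}
    (hint : ∀ s : ℝ, Integrable (fun ω => Real.exp (s * X ω)) P)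
    (hv : ∀ s : ℝ, mgf X P s ≤ Real.exp (s ^ 2 * v / 2)) (W : ℝ) :
    P {ω | W < |X ω|} ≤ ENNReal.ofReal (2 * Real.exp (v / 2 - W)) := by
  have h1 := measure_ge_le_exp_mul_mgf (X := X) (μ := P) W zero_le_one (hint 1)
  have h2 := measure_le_le_exp_mul_mgf (X := X) (μ := P) (t := -1) (-W) (by norm_num) (hint (-1))
  have h3 := hv 1
  have h4 := hv (-1)
  have hexp : Real.exp (v / 2 - W) = Real.exp (-W) * Real.exp (v / 2) := by
    rw [← Real.exp_add]
    congr 1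
    ring
  norm_num at h1 h2 h3 h4
  have hsub : {ω | W < |X ω|} ⊆ {ω | W ≤ X ω} ∪ {ω | X ω ≤ -W} := by
    intro ω hω
    rcases lt_abs.1 (show W < |X ω| from hω) with h | h
    · exact Or.inl h.le
    · exact Or.inr (show X ω ≤ -W by linarith)
  have h5 : P.real {ω | W < |X ω|} ≤ 2 * Real.exp (v / 2 - W) := by
    refine (measureReal_mono hsub).trans ((measureReal_union_le _ _).trans ?_)
    have h6 : Real.exp (-W) * mgf X P 1 ≤ Real.exp (-W) * Real.exp (v / 2) := by gcongr
    have h7 : Real.exp (-W) * mgf X P (-1) ≤ Real.exp (-W) * Real.exp (v / 2) := by gcongr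
    linarith
  rw [← ofReal_measureReal]
  exact ENNReal.ofReal_le_ofReal h5

variable {ℱ : Filtration ℕ mΩ} {n d : ℕ} {σw σbar σνsq : ℝ}
  {w : ℕ → Ω → Fin n → ℝ} {ν : ℕ → Ω → Fin d → ℝ}

theorem IsNoise.measure_abs_gt_le (hw : IsNoise P ℱ σw σbar w) (t : ℕ) (i : Fin n) (W : ℝ) :
    P {ω | W < |w t ω i|} ≤ ENNReal.ofReal (2 * Real.exp (σw ^ 2 / 2 - W)) := by
  refine measure_abs_gt_le_of_mgf_le (hw.integrable_exp t i) (fun s => ?_) W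
  rw [mgf, ← integral_condExp (ℱ.le t)]
  refine (integral_mono_ae integrable_condExp (integrable_const _) (hw.subGaussian t i s)).trans ?_
  simp

theorem IsPerturbation.measure_abs_gt_le (hs : 0 ≤ σνsq) (hν : IsPerturbation P ℱ σνsq w ν)
    (t : ℕ) (i : Fin d) (W : ℝ) :
    P {ω | W < |ν t ω i|} ≤ ENNReal.ofReal (2 * Real.exp (σνsq / 2 - W)) := by
  have hm := hν.measurable' t
  have hlaw : P.map (fun ω => ν t ω i) = gaussianReal 0 σνsq.toNNReal := by
    have : (fun ω => ν t ω i) = (Function.eval i) ∘ ν t := rfl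
    rw [this, ← Measure.map_map (measurable_pi_apply i) hm, hν.law t]
    exact (measurePreserving_eval (fun _ : Fin d => gaussianReal 0 σνsq.toNNReal) i).map_eq
  refine measure_abs_gt_le_of_mgf_le (fun s => ?_) (fun s => ?_) W
  · have h := integrable_exp_mul_gaussianReal (μ := 0) (v := σνsq.toNNReal) s
    rw [← hlaw] at h
    exact h.comp_measurable (by fun_prop)
  · rw [mgf_gaussianReal hlaw, Real.coe_toNNReal _ hs]
    apply le_of_eq
    congr 1
    ring

theorem measure_exists_abs_gt_le (hs : 0 ≤ σνsq) (hw : IsNoise P ℱ σw σbar w)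
    (hν : IsPerturbation P ℱ σνsq w ν) (T : ℕ) (W : ℝ) :
    P {ω | ∃ t < T, (∃ i, W < |w t ω i|) ∨ ∃ i, W < |ν t ω i|}
      ≤ ENNReal.ofReal (T * ((n + d) * (2 * Real.exp ((σw ^ 2 + σνsq) / 2 - W)))) := by
  have hsub : {ω | ∃ t < T, (∃ i, W < |w t ω i|) ∨ ∃ i, W < |ν t ω i|}
      ⊆ ⋃ t ∈ Finset.range T, ((⋃ i ∈ (Finset.univ : Finset (Fin n)), {ω | W < |w t ω i|})
        ∪ ⋃ i ∈ (Finset.univ : Finset (Fin d)), {ω | W < |ν t ω i|}) := by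
    rintro ω ⟨t, ht, h⟩
    simp only [Set.mem_iUnion, Finset.mem_range, Finset.mem_univ, Set.mem_union]
    refine ⟨t, ht, h.imp ?_ ?_⟩
    · rintro ⟨i, hi⟩
      exact ⟨i, trivial, hi⟩
    · rintro ⟨i, hi⟩
      exact ⟨i, trivial, hi⟩
  set e := 2 * Real.exp ((σw ^ 2 + σνsq) / 2 - W) with he
  have he0 : 0 ≤ e := by positivity
  have hmul : ∀ (k : ℕ) (y : ℝ), 0 ≤ y → (k : ENNReal) * ENNReal.ofReal y
      = ENNReal.ofReal (k * y) := fun k y _ => by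
    rw [ENNReal.ofReal_mul (Nat.cast_nonneg k), ENNReal.ofReal_natCast]
  have h1 : ∀ t i, P {ω | W < |w t ω i|} ≤ ENNReal.ofReal e := fun t i => by
    refine (hw.measure_abs_gt_le t i W).trans (ENNReal.ofReal_le_ofReal ?_)
    rw [he]
    gcongr
    linarith
  have h2 : ∀ t i, P {ω | W < |ν t ω i|} ≤ ENNReal.ofReal e := fun t i => by
    refine (hν.measure_abs_gt_le hs t i W).trans (ENNReal.ofReal_le_ofReal ?_)
    rw [he]
    gcongr
    nlinarith [sq_nonneg σw]
  refine (measure_mono hsub).trans ((measure_biUnion_finset_le _ _).trans ?_)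
  refine (Finset.sum_le_sum (g := fun _ => ENNReal.ofReal ((n + d) * e)) fun t _ => ?_).trans ?_
  · refine (measure_union_le _ _).trans ((add_le_add (measure_biUnion_finset_le _ _)
      (measure_biUnion_finset_le _ _)).trans ((add_le_add (Finset.sum_le_sum fun i _ => h1 t i)
      (Finset.sum_le_sum fun i _ => h2 t i)).trans (le_of_eq ?_)))
    simp only [Finset.sum_const, Finset.card_univ, Fintype.card_fin, nsmul_eq_mul]
    rw [add_mul, ENNReal.ofReal_add (by positivity) (by positivity), hmul n _ he0, hmul d _ he0]
  · simp only [Finset.sum_const, Finset.card_range, nsmul_eq_mul]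
    rw [hmul T _ (by positivity)]

end NoiseTails

/-! ### Simultaneous excitation of all grid directions. -/

section GridEvent

variable {Ω : Type*} {mΩ : MeasurableSpace Ω} {P : Measure Ω} [IsProbabilityMeasure P]
  {ℱ : Filtration ℕ mΩ} {N d : ℕ} {σw σbar κ γ S lam δ : ℝ} {Tw : ℕ}
  {Q : Matrix (Fin (N + 1)) (Fin (N + 1)) ℝ} {R : Matrix (Fin d) (Fin d) ℝ}
  {Θstar : Param (N + 1) d} {w : ℕ → Ω → Fin (N + 1) → ℝ} {ν : ℕ → Ω → Fin d → ℝ}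
  {x : ℕ → Ω → Fin (N + 1) → ℝ} {u : ℕ → Ω → Fin d → ℝ} {Θt : ℕ → Ω → Param (N + 1) d}

theorem IsRun.measure_exists_grid_sum_lt_le (hσ : 0 < σw) (hσbar : 0 < σbar) (hκ : 1 ≤ κ)
    (hw : IsNoise P ℱ σw σbar w) (hν : IsPerturbation P ℱ (2 * κ ^ 2 * σbar ^ 2) w ν)
    (hr : IsRun ℱ Q R σw σbar κ γ S lam δ Tw Θstar w ν x u Θt) (k J : ℕ) :
    P {ω | ∃ v ∈ cubeGrid (Fin (N + 1) ⊕ Fin d) k, 1 / 2 ≤ eucNorm v ∧ eucNorm v ≤ 2 ∧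
        ∑ j ∈ Finset.range J, min ((v ⬝ᵥ runExcitation Q R Θstar w ν Θt (2 * j) ω) ^ 2) 1
          < excitationRate (N + 1) d σw σbar κ / 2 * J}
      ≤ ENNReal.ofReal ((2 * k + 1) ^ (N + 1 + d)
          * Real.exp (-(excitationRate (N + 1) d σw σbar κ / 2 * J))) := by
  classical
  set q := excitationRate (N + 1) d σw σbar κ
  set G := (cubeGrid (Fin (N + 1) ⊕ Fin d) k).filter fun v => 1 / 2 ≤ eucNorm v ∧ eucNorm v ≤ 2
  have hsub : {ω | ∃ v ∈ cubeGrid (Fin (N + 1) ⊕ Fin d) k, 1 / 2 ≤ eucNorm v ∧ eucNorm v ≤ 2 ∧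
        ∑ j ∈ Finset.range J, min ((v ⬝ᵥ runExcitation Q R Θstar w ν Θt (2 * j) ω) ^ 2) 1
          < q / 2 * J}
      ⊆ ⋃ v ∈ G, {ω | ∑ j ∈ Finset.range J,
          min ((v ⬝ᵥ runExcitation Q R Θstar w ν Θt (2 * j) ω) ^ 2) 1 ≤ q / 2 * J} := by
    rintro ω ⟨v, hv, h1, h2, h3⟩
    simp only [Set.mem_iUnion]
    exact ⟨v, Finset.mem_filter.2 ⟨hv, h1, h2⟩, h3.le⟩
  refine (measure_mono hsub).trans ((measure_biUnion_finset_le _ _).trans ?_)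
  refine (Finset.sum_le_sum (g := fun _ => ENNReal.ofReal (Real.exp (-(q / 2 * J))))
    fun v hv => ?_).trans ?_
  · obtain ⟨-, h1, h2⟩ := Finset.mem_filter.1 hv
    exact hr.measure_sum_runExcitation_le hσ hσbar hκ hw hν h1 h2 J
  · rw [Finset.sum_const, nsmul_eq_mul, ENNReal.ofReal_mul (by positivity)]
    gcongr
    have h1 : G.card ≤ (2 * k + 1) ^ (N + 1 + d) := by
      refine (Finset.card_filter_le _ _).trans ((card_cubeGrid_le k).trans (le_of_eq ?_))
      simp
    rw [← ENNReal.ofReal_natCast]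
    exact ENNReal.ofReal_le_ofReal (by exact_mod_cast h1)

end GridEvent

end StabL

namespace StabL

/-! ### Counting policy updates -/

section PolicyUpdates

variable {n d : ℕ} {κ γ lam : ℝ} {x : ℕ → Fin n → ℝ} {u : ℕ → Fin d → ℝ}

open Classical in
/-- The number of policy updates before time `t`. -/
noncomputable def updateCount (κ γ lam : ℝ) (x : ℕ → Fin n → ℝ) (u : ℕ → Fin d → ℝ) (t : ℕ) : ℕ :=
  ((Finset.range t).filter fun s => UpdatesAt κ γ lam x u s).card

theorem updateCount_zero : updateCount κ γ lam x u 0 = 0 := by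
  simp [updateCount]

theorem updateCount_succ_of_updatesAt {t : ℕ} (h : UpdatesAt κ γ lam x u t) :
    updateCount κ γ lam x u (t + 1) = updateCount κ γ lam x u t + 1 := by
  rw [updateCount, Finset.range_add_one, Finset.filter_insert, if_pos h,
    Finset.card_insert_of_notMem (by simp), updateCount]

theorem updateCount_succ_of_not_updatesAt {t : ℕ} (h : ¬UpdatesAt κ γ lam x u t) :
    updateCount κ γ lam x u (t + 1) = updateCount κ γ lam x u t := by
  rw [updateCount, Finset.range_add_one, Finset.filter_insert, if_neg h, updateCount]

theorem lastUpdate_succ_of_updatesAt {t : ℕ} (h : UpdatesAt κ γ lam x u t) :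
    lastUpdate κ γ lam x u (t + 1) = t := by
  rw [lastUpdate]
  exact if_pos h

theorem lastUpdate_succ_of_not_updatesAt {t : ℕ} (h : ¬UpdatesAt κ γ lam x u t) :
    lastUpdate κ γ lam x u (t + 1) = lastUpdate κ γ lam x u t := by
  rw [lastUpdate]
  exact if_neg h

theorem lastUpdate_succ_le (t : ℕ) : lastUpdate κ γ lam x u (t + 1) ≤ t := by
  induction t with
  | zero =>
    by_cases h : UpdatesAt κ γ lam x u 0
    · exact (lastUpdate_succ_of_updatesAt h).le
    · rw [lastUpdate_succ_of_not_updatesAt h]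
      exact le_rfl
  | succ t ih =>
    by_cases h : UpdatesAt κ γ lam x u (t + 1)
    · exact (lastUpdate_succ_of_updatesAt h).le
    · rw [lastUpdate_succ_of_not_updatesAt h]
      omega

theorem lastUpdate_le (t : ℕ) : lastUpdate κ γ lam x u t ≤ t := by
  cases t with
  | zero => exact le_rfl
  | succ t => exact (lastUpdate_succ_le t).trans (Nat.le_succ t)

theorem lastUpdate_eq_of_lt {s t : ℕ} (hst : s ≤ t) (h : lastUpdate κ γ lam x u t < s) :
    lastUpdate κ γ lam x u s = lastUpdate κ γ lam x u t := by
  induction t, hst using Nat.le_induction with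
  | base => rfl
  | succ t hst ih =>
    by_cases hu : UpdatesAt κ γ lam x u t
    · rw [lastUpdate_succ_of_updatesAt hu] at h
      omega
    · rw [lastUpdate_succ_of_not_updatesAt hu] at h ⊢
      exact ih h

/-- Every update advances the register by more than H₀. -/
theorem updateCount_mul_minDuration_le (t : ℕ) :
    updateCount κ γ lam x u t * minDuration κ γ ≤ lastUpdate κ γ lam x u t := by
  induction t with
  | zero => simp [updateCount_zero, lastUpdate]
  | succ t ih =>
    by_cases h : UpdatesAt κ γ lam x u t
    · rw [updateCount_succ_of_updatesAt h, lastUpdate_succ_of_updatesAt h]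
      have h2 := h.2
      push_cast
      linarith
    · rw [updateCount_succ_of_not_updatesAt h, lastUpdate_succ_of_not_updatesAt h]
      exact ih

/-- Every update doubles the determinant stored at the register. -/
theorem two_pow_updateCount_mul_le (t : ℕ) :
    2 ^ updateCount κ γ lam x u t * (designMat lam x u 0).det
      ≤ (designMat lam x u (lastUpdate κ γ lam x u t)).det := by
  induction t with
  | zero => simp [updateCount_zero, lastUpdate]
  | succ t ih =>
    by_cases h : UpdatesAt κ γ lam x u t
    · rw [updateCount_succ_of_updatesAt h, lastUpdate_succ_of_updatesAt h]
      have h1 := h.1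
      rw [pow_succ]
      linarith
    · rw [updateCount_succ_of_not_updatesAt h, lastUpdate_succ_of_not_updatesAt h]
      exact ih

-- A block with an update is encoded by the pair (update time, offset in the block), from which j is
-- recovered; hence each update spoils at most m blocks.
open Classical in
theorem card_filter_exists_updatesAt_le (m J T : ℕ) (hJ : 2 * J + m ≤ T + 1) :
    ((Finset.range J).filter fun j => ∃ i < m, UpdatesAt κ γ lam x u (2 * j + i)).card
      ≤ m * updateCount κ γ lam x u T := by
  rw [updateCount, mul_comm]
  refine (Finset.card_le_card_of_injOn (t := ((Finset.range T).filter fun s =>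
    UpdatesAt κ γ lam x u s) ×ˢ Finset.range m) (fun j => if h : ∃ i < m,
      UpdatesAt κ γ lam x u (2 * j + i) then (2 * j + h.choose, h.choose) else (0, 0)) ?_ ?_).trans ?_
  · intro j hj
    obtain ⟨hj1, hj2⟩ := Finset.mem_filter.1 (Finset.mem_coe.1 hj)
    have hj1 := Finset.mem_range.1 hj1
    simp only [hj2, dif_pos]
    have := hj2.choose_spec
    refine Finset.mem_coe.2 (Finset.mem_product.2 ⟨Finset.mem_filter.2 ⟨Finset.mem_range.2 ?_,
      this.2⟩, Finset.mem_range.2 this.1⟩)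
    dsimp only
    omega
  · intro j hj j' hj' hjj
    have hj2 := (Finset.mem_filter.1 (Finset.mem_coe.1 hj)).2
    have hj2' := (Finset.mem_filter.1 (Finset.mem_coe.1 hj')).2
    simp only [hj2, hj2', dif_pos, Prod.mk.injEq] at hjj
    omega
  · rw [Finset.card_product, Finset.card_range]

end PolicyUpdates

/-! ### From excited blocks to excited covariates. -/

section ExcitationToCovariates

variable {n d : ℕ} {κ γ lam : ℝ}

/-- Many excited blocks and few policy updates make all directions of the covariates excited. -/
theorem sum_dotProduct_covariate_sq_ge {Θ : Param n d} {G : ℕ → Param n d}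
    {Q : Matrix (Fin n) (Fin n) ℝ} {R : Matrix (Fin d) (Fin d) ℝ}
    {w x : ℕ → Fin n → ℝ} {ν u : ℕ → Fin d → ℝ} {T J : ℕ} (hJ : 2 * J + n ≤ T + 1) {C : ℝ}
    (hC : ∀ t, ∀ j ∈ Finset.range (n + 1),
      |(closedLoop Θ (gain Q R (G (t - 1)))).charpoly.coeff j| ≤ C)
    (hx : ∀ t, x (t + 1) = stateMat Θ *ᵥ x t + inputMat Θ *ᵥ u t + w t)
    (hu : ∀ t < T, u t = gain Q R (G (t - 1)) *ᵥ x t + ν t)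
    (hG : ∀ t, ¬UpdatesAt κ γ lam x u t → G t = G (t - 1)) (v : Fin n ⊕ Fin d → ℝ) :
    ∑ j ∈ Finset.range J, min ((v ⬝ᵥ excitation Θ (gain Q R (G (2 * j - 1)))
        (fun i => w (2 * j + i)) (fun i => ν (2 * j + i))) ^ 2) 1
      ≤ ((n + 1) * C) ^ 2 * ∑ s ∈ Finset.range T, (v ⬝ᵥ covariate x u s) ^ 2
        + n * updateCount κ γ lam x u T := by
  classical
  set Z : ℕ → Fin n ⊕ Fin d → ℝ := fun j => excitation Θ (gain Q R (G (2 * j - 1)))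
        (fun i => w (2 * j + i)) (fun i => ν (2 * j + i)) with hZ
  -- The input at offset i uses the parameter of time 2j+i-1, so an update at offset n does not
  -- affect the block: only offsets below n matter.
  set bad : ℕ → Prop := fun j => ∃ i < n, UpdatesAt κ γ lam x u (2 * j + i) with hbad
  have hgood : ∀ j < J, ¬bad j → (v ⬝ᵥ Z j) ^ 2
      ≤ (n + 1) * C ^ 2 * ∑ i ∈ Finset.range (n + 1), (v ⬝ᵥ covariate x u (2 * j + i)) ^ 2 := by
    intro j hj hb
    have hconst : ∀ i ≤ n, G (2 * j + i - 1) = G (2 * j - 1) := by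
      intro i
      induction i with
      | zero => intro _; rfl
      | succ i ih =>
        intro hi
        rw [← ih (by omega), ← hG (2 * j + i) fun h => hb ⟨i, by omega, h⟩]
        rfl
    exact dotProduct_excitation_sq_le (x := fun i => x (2 * j + i)) (u := fun i => u (2 * j + i))
      (hC (2 * j)) (fun i _ => hx (2 * j + i))
      (fun i hi => by rw [hu (2 * j + i) (by omega), hconst i hi]) v
  have hterm : ∀ j ∈ Finset.range J, min ((v ⬝ᵥ Z j) ^ 2) 1
      ≤ (n + 1) * C ^ 2 * ∑ i ∈ Finset.range (n + 1), (v ⬝ᵥ covariate x u (2 * j + i)) ^ 2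
        + if bad j then 1 else 0 := by
    intro j hj
    by_cases hb : bad j
    · rw [if_pos hb]
      have : 0 ≤ (n + 1) * C ^ 2 *
          ∑ i ∈ Finset.range (n + 1), (v ⬝ᵥ covariate x u (2 * j + i)) ^ 2 := by
        have := Finset.sum_nonneg fun i (_ : i ∈ Finset.range (n + 1)) =>
          sq_nonneg (v ⬝ᵥ covariate x u (2 * j + i))
        positivity
      linarith [min_le_right ((v ⬝ᵥ Z j) ^ 2) 1]
    · rw [if_neg hb, add_zero]
      exact (min_le_left _ _).trans (hgood j (Finset.mem_range.1 hj) hb)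
  refine (Finset.sum_le_sum hterm).trans ?_
  rw [Finset.sum_add_distrib, ← Finset.mul_sum, Finset.sum_comm, Finset.sum_boole]
  have hcount : (((Finset.range J).filter bad).card : ℝ) ≤ n * updateCount κ γ lam x u T := by
    exact_mod_cast card_filter_exists_updatesAt_le n J T hJ
  -- For each fixed offset the times 2j+i are distinct, so summing over offsets counts a covariate
  -- at most n+1 times.
  have hrow : ∀ i ∈ Finset.range (n + 1),
      ∑ j ∈ Finset.range J, (v ⬝ᵥ covariate x u (2 * j + i)) ^ 2
        ≤ ∑ s ∈ Finset.range T, (v ⬝ᵥ covariate x u s) ^ 2 := by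
    intro i hi
    have hi := Finset.mem_range.1 hi
    rw [← Finset.sum_image (s := Finset.range J) (g := fun j => 2 * j + i)
      (f := fun s => (v ⬝ᵥ covariate x u s) ^ 2) (fun a _ b _ h => by dsimp only at h; omega)]
    refine Finset.sum_le_sum_of_subset_of_nonneg ?_ fun _ _ _ => sq_nonneg _
    intro s hs
    obtain ⟨j, hj, rfl⟩ := Finset.mem_image.1 hs
    have hj := Finset.mem_range.1 hj
    exact Finset.mem_range.2 (by omega)
  refine add_le_add ?_ hcount
  refine (mul_le_mul_of_nonneg_left (Finset.sum_le_sum hrow) (by positivity)).trans (le_of_eq ?_)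
  rw [Finset.sum_const, Finset.card_range, nsmul_eq_mul]
  push_cast
  ring

end ExcitationToCovariates

end StabL

namespace StabL

/-! ### Determinants, rare large steps and Lyapunov norms -/

section DeterminantGrowth

variable {m : Type*} [Fintype m] [DecidableEq m]

theorem posDef_add_sum_vecMulVec_self {α : Type*} {V : Matrix m m ℝ} (hV : V.PosDef)
    (s : Finset α) (z : α → m → ℝ) : (V + ∑ a ∈ s, vecMulVec (z a) (z a)).PosDef := by
  classical
  induction s using Finset.induction_on with
  | empty => simpa using hV
  | insert a s ha ih =>
    rw [Finset.sum_insert ha, add_comm (vecMulVec _ _), ← add_assoc]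
    exact posDef_add_vecMulVec_self ih (z a)

theorem det_le_det_add_sum_vecMulVec_self {α : Type*} {V : Matrix m m ℝ} (hV : V.PosDef)
    (s : Finset α) (z : α → m → ℝ) : V.det ≤ (V + ∑ a ∈ s, vecMulVec (z a) (z a)).det := by
  classical
  induction s using Finset.induction_on with
  | empty => simp
  | insert a s ha ih =>
    have hs := posDef_add_sum_vecMulVec_self hV s z
    rw [Finset.sum_insert ha, add_comm (vecMulVec _ _), ← add_assoc, det_add_vecMulVec_self hs]
    have h1 := inv_quad_nonneg hs (z a)
    have h2 := hs.det_pos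
    nlinarith

variable {n d : ℕ} {lam : ℝ}

/-- V_t dominates zzᵀ. Testing with y = V_t⁻¹z gives (y·z)² ≤ y·z. -/
theorem covariate_inv_quad_le_one (hl : 0 < lam) (x : ℕ → Fin n → ℝ) (u : ℕ → Fin d → ℝ)
    {s t : ℕ} (hst : s < t) :
    covariate x u s ⬝ᵥ (designMat lam x u t)⁻¹ *ᵥ covariate x u s ≤ 1 := by
  have hV := designMat_posDef hl x u t
  set z := covariate x u s
  set y := (designMat lam x u t)⁻¹ *ᵥ z with hy
  have h1 := dotProduct_designMat_mulVec lam x u t y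
  rw [hy, posDef_mulVec_inv_mulVec hV z, ← hy] at h1
  have h2 : (y ⬝ᵥ z) ^ 2 ≤ ∑ r ∈ Finset.range t, (y ⬝ᵥ covariate x u r) ^ 2 :=
    Finset.single_le_sum (f := fun r => (y ⬝ᵥ covariate x u r) ^ 2) (fun _ _ => sq_nonneg _)
      (Finset.mem_range.2 hst)
  have h3 : 0 ≤ lam * eucNorm y ^ 2 := by positivity
  rw [dotProduct_comm]
  nlinarith

/-- Adding the single term zzᵀ multiplies det V_τ by 1 + zᵀV_τ⁻¹z, and this must not exceed the
factor 2 allowed up to time t. -/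
theorem covariate_inv_quad_le_one_of_det_le (hl : 0 < lam) (x : ℕ → Fin n → ℝ)
    (u : ℕ → Fin d → ℝ) {τ s t : ℕ} (hτ : τ ≤ s) (hst : s < t)
    (hdet : (designMat lam x u t).det ≤ 2 * (designMat lam x u τ).det) :
    covariate x u s ⬝ᵥ (designMat lam x u τ)⁻¹ *ᵥ covariate x u s ≤ 1 := by
  have hV := designMat_posDef hl x u τ
  set z := covariate x u
  have hsplit : designMat lam x u t = designMat lam x u τ + vecMulVec (z s) (z s)
      + ∑ r ∈ (Finset.Ico τ t).erase s, vecMulVec (z r) (z r) := by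
    rw [add_assoc, Finset.add_sum_erase _ (fun r => vecMulVec (z r) (z r)) (Finset.mem_Ico.2 ⟨hτ, hst⟩), designMat, designMat,
      add_assoc, Finset.sum_range_add_sum_Ico _ (hτ.trans hst.le)]
  have h1 := det_le_det_add_sum_vecMulVec_self (posDef_add_vecMulVec_self hV (z s))
    ((Finset.Ico τ t).erase s) z
  rw [← hsplit, det_add_vecMulVec_self hV] at h1
  have h2 := h1.trans hdet
  have h3 := hV.det_pos
  by_contra! h4
  nlinarith

end DeterminantGrowth

/-! ### A majorant that grows only at rare times. -/

section Envelope

open Classical in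
/-- The sequence that starts at `r` and is multiplied by `b` whenever `f` exceeds `a` times it. -/
noncomputable def envelope (a b r : ℝ) (f : ℕ → ℝ) : ℕ → ℝ
  | 0 => r
  | t + 1 => if f t ≤ a * envelope a b r f t then envelope a b r f t
      else b * envelope a b r f t

variable {a b r : ℝ} {f : ℕ → ℝ}

open Classical in
theorem envelope_eq (t : ℕ) : envelope a b r f t
    = b ^ ((Finset.range t).filter fun s => a * envelope a b r f s < f s).card * r := by
  induction t with
  | zero => simp [envelope]
  | succ t ih =>
    rw [Finset.range_add_one, Finset.filter_insert, envelope]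
    by_cases h : f t ≤ a * envelope a b r f t
    · rw [if_pos h, if_neg (not_lt.2 h)]
      exact ih
    · rw [if_neg h, if_pos (not_le.1 h), Finset.card_insert_of_notMem (by simp), pow_succ,
        mul_comm _ b, mul_assoc, ← ih]

theorem le_envelope (hb : 1 ≤ b) (hr : 0 ≤ r) (t : ℕ) : r ≤ envelope a b r f t := by
  classical
  rw [envelope_eq]
  exact le_mul_of_one_le_left hr (one_le_pow₀ hb)

end Envelope

/-! ### Pigeonhole bound on the number of large prediction errors. -/

section FarPairs

variable {ι : Type*} [Fintype ι] [DecidableEq ι] {m : Type*} [Fintype m]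

open Classical in
/-- If the matrices `M t` are small on the vectors `z s` of the past `s + h ≤ t`, then `M t` can be
large on `z t` only a bounded number of times. -/
theorem card_filter_lt_eucNorm_le {M : ℕ → Matrix ι m ℝ} {z : ℕ → ι → ℝ} {X : ℕ → ℝ}
    {T h k : ℕ} (hh : 0 < h) (hk : 0 < k) {B F c r : ℝ} (hr : 0 < r) (hB : 2 * B ≤ c * r)
    (hc : 0 ≤ c)
    (hX : ∀ t < T, r ≤ X t) (hz : ∀ t < T, eucNorm (z t) ≤ X t)
    (hM : ∀ t < T, frobNorm (M t) ≤ F)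
    (hfar : ∀ s t, s + h ≤ t → t < T → eucNorm ((M t)ᵀ *ᵥ z s) ≤ B)
    (hF : F * (Fintype.card ι * (2 / k)) ≤ c / 2) :
    ((Finset.range T).filter fun t => c * X t < eucNorm ((M t)ᵀ *ᵥ z t)).card
      ≤ h * (2 * k + 1) ^ Fintype.card ι := by
  have hk' : (0 : ℝ) < k := by exact_mod_cast hk
  have hcell : ∀ t : ℕ, ∃ g ∈ cubeGrid ι k, t < T → ∀ i, |((X t)⁻¹ • z t) i - g i| ≤ 1 / k := by
    intro t
    by_cases ht : t < T
    · have hXt : 0 < X t := hr.trans_le (hX t ht)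
      obtain ⟨g, hg, hg'⟩ := exists_mem_cubeGrid hk (v := (X t)⁻¹ • z t) (fun i => by
        refine (abs_apply_le_eucNorm _ i).trans ?_
        rw [eucNorm_smul, abs_of_pos (inv_pos.2 hXt), inv_mul_le_iff₀ hXt, mul_one]
        exact hz t ht)
      exact ⟨g, hg, fun _ => hg'⟩
    · obtain ⟨g, hg, -⟩ := exists_mem_cubeGrid hk (v := (0 : ι → ℝ)) (by simp)
      exact ⟨g, hg, fun h => absurd h ht⟩
  choose g hg hclose using hcell
  -- If the normalized vectors of s and t share a cell, M t is small on the older one by `hfar` and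
  -- on their difference by the mesh, so t is not a bad time.
  have hne : ∀ s t, s + h ≤ t → t < T → c * X t < eucNorm ((M t)ᵀ *ᵥ z t) → g s ≠ g t := by
    intro s t hst ht hbad heq
    have hs : s < T := by omega
    have hXs : 0 < X s := hr.trans_le (hX s hs)
    have hXt : 0 < X t := hr.trans_le (hX t ht)
    have hdist : eucNorm ((X t)⁻¹ • z t - (X s)⁻¹ • z s) ≤ Fintype.card ι * (2 / k) := by
      refine eucNorm_le_of_abs_le (by positivity) fun i => ?_
      have h1 := hclose t ht i
      have h2 := hclose s hs i
      rw [heq] at h2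
      rw [Pi.sub_apply]
      have h3 := abs_sub_le (((X t)⁻¹ • z t) i) (g t i) (((X s)⁻¹ • z s) i)
      rw [abs_sub_comm (g t i)] at h3
      have h4 : (2 : ℝ) / k = 1 / k + 1 / k := by ring
      linarith
    have h1 : eucNorm ((M t)ᵀ *ᵥ ((X t)⁻¹ • z t - (X s)⁻¹ • z s)) ≤ c / 2 := by
      refine (eucNorm_mulVec_le_frobNorm _ _).trans ?_
      rw [frobNorm_transpose]
      exact (mul_le_mul (hM t ht) hdist (eucNorm_nonneg _)
        ((frobNorm_nonneg _).trans (hM t ht))).trans hF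
    have h2 : eucNorm ((M t)ᵀ *ᵥ ((X s)⁻¹ • z s)) ≤ c / 2 := by
      rw [mulVec_smul, eucNorm_smul, abs_of_pos (inv_pos.2 hXs), inv_mul_le_iff₀ hXs]
      have h3 := hfar s t hst ht
      have h4 : c * r ≤ c * X s := by gcongr; exact hX s hs
      linarith
    have h3 : eucNorm ((M t)ᵀ *ᵥ ((X t)⁻¹ • z t)) ≤ c := by
      have : (M t)ᵀ *ᵥ ((X t)⁻¹ • z t) = (M t)ᵀ *ᵥ ((X t)⁻¹ • z t - (X s)⁻¹ • z s)
          + (M t)ᵀ *ᵥ ((X s)⁻¹ • z s) := by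
        rw [← mulVec_add, sub_add_cancel]
      rw [this]
      refine (eucNorm_add_le _ _).trans ?_
      linarith
    rw [mulVec_smul, eucNorm_smul, abs_of_pos (inv_pos.2 hXt), inv_mul_le_iff₀ hXt] at h3
    linarith
  -- Distinct times with the same residue mod h are at least h apart, so residue and cell together
  -- determine a bad time.
  refine (Finset.card_le_card_of_injOn (t := Finset.range h ×ˢ cubeGrid ι k)
    (fun t => (t % h, g t)) ?_ ?_).trans ?_
  · intro t _
    exact Finset.mem_coe.2 (Finset.mem_product.2
      ⟨Finset.mem_range.2 (Nat.mod_lt _ hh), hg t⟩)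
  · intro s hs t ht hst
    obtain ⟨hs1, hs2⟩ := Finset.mem_filter.1 (Finset.mem_coe.1 hs)
    obtain ⟨ht1, ht2⟩ := Finset.mem_filter.1 (Finset.mem_coe.1 ht)
    simp only [Prod.mk.injEq] at hst
    have key : ∀ a b : ℕ, a < b → a % h = b % h → a + h ≤ b := by
      intro a b hab hmod
      have h1 : h ∣ b - a := (Nat.modEq_iff_dvd' hab.le).1 hmod
      have := Nat.le_of_dvd (by omega) h1
      omega
    rcases lt_trichotomy s t with h1 | h1 | h1
    · exact absurd hst.2 (hne s t (key s t h1 hst.1) (Finset.mem_range.1 ht1) ht2)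
    · exact h1
    · exact absurd hst.2.symm (hne t s (key t s h1 hst.1.symm) (Finset.mem_range.1 hs1) hs2)
  · rw [Finset.card_product, Finset.card_range]
    exact Nat.mul_le_mul_left _ (card_cubeGrid_le k)

end FarPairs

/-! ### Weighted Lyapunov norms under a fixed policy and across a switch. -/

section Lyapunov

variable {n d : ℕ}

/-- The weighted Lyapunov norm of `x` under the policy of the parameter `G` is at most `Y`. -/
def LyapunovLe (Q : Matrix (Fin n) (Fin n) ℝ) (R : Matrix (Fin d) (Fin d) ℝ) (κ γ : ℝ)
    (G : Param n d) (a : ℝ) (x : Fin n → ℝ) (Y : ℝ) : Prop :=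
  ∃ H L : Matrix (Fin n) (Fin n) ℝ, H.PosDef ∧ closedLoop G (gain Q R G) = H * L * H⁻¹ ∧
    specNorm L ≤ 1 - γ ∧ specNorm H * specNorm H⁻¹ ≤ κ ∧
    a * (specNorm H * eucNorm (H⁻¹ *ᵥ x)) ≤ Y

variable {Q : Matrix (Fin n) (Fin n) ℝ} {R : Matrix (Fin d) (Fin d) ℝ} {κ γ S : ℝ}
  {G G' : Param n d} {a a' Y E : ℝ} {x e : Fin n → ℝ}

theorem LyapunovLe.mono (h : LyapunovLe Q R κ γ G a x Y) {Y' : ℝ} (hY : Y ≤ Y') :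
    LyapunovLe Q R κ γ G a x Y' := by
  obtain ⟨H, L, h1, h2, h3, h4, h5⟩ := h
  exact ⟨H, L, h1, h2, h3, h4, h5.trans hY⟩

theorem lyapunovLe_zero (hG : G ∈ stabSet Q R κ γ S) (hY : 0 ≤ Y) :
    LyapunovLe Q R κ γ G a 0 Y := by
  obtain ⟨⟨-, -, H, L, h1, h2, h3, h4⟩, -⟩ := hG
  exact ⟨H, L, h1, h2, h3, h4, by simpa [eucNorm] using hY⟩

theorem eucNorm_le_specNorm_mul_eucNorm_inv_mulVec {H : Matrix (Fin n) (Fin n) ℝ} (hH : H.PosDef)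
    (x : Fin n → ℝ) : eucNorm x ≤ specNorm H * eucNorm (H⁻¹ *ᵥ x) := by
  have := eucNorm_mulVec_le_specNorm H (H⁻¹ *ᵥ x)
  rwa [posDef_mulVec_inv_mulVec hH] at this

theorem LyapunovLe.eucNorm_le (h : LyapunovLe Q R κ γ G a x Y) (ha : 1 ≤ a) :
    eucNorm x ≤ Y := by
  obtain ⟨H, L, h1, -, -, -, h5⟩ := h
  have h6 := eucNorm_le_specNorm_mul_eucNorm_inv_mulVec h1 x
  have h7 := mul_nonneg (specNorm_nonneg H) (eucNorm_nonneg (H⁻¹ *ᵥ x))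
  nlinarith

/-- The contraction 1-γ ≤ exp(-γ) is shared: half of it shrinks Y, the other half lets the weight
grow by exp(γ/2). -/
theorem LyapunovLe.step (h : LyapunovLe Q R κ γ G a x Y) (ha : 0 ≤ a) (ha' : 0 ≤ a')
    (haa : a' ≤ Real.exp (γ / 2) * a) (hκ : a' ≤ κ) (he : eucNorm e ≤ E) :
    LyapunovLe Q R κ γ G a' (closedLoop G (gain Q R G) *ᵥ x + e)
      (Real.exp (-(γ / 2)) * Y + κ ^ 2 * E) := by
  obtain ⟨H, L, h1, h2, h3, h4, h5⟩ := h
  refine ⟨H, L, h1, h2, h3, h4, ?_⟩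
  have hκ0 : 0 ≤ κ := ha'.trans hκ
  set p := specNorm H * eucNorm (H⁻¹ *ᵥ x) with hp
  have hp0 : 0 ≤ p := mul_nonneg (specNorm_nonneg H) (eucNorm_nonneg _)
  have h6 : H⁻¹ *ᵥ (closedLoop G (gain Q R G) *ᵥ x + e)
      = L *ᵥ (H⁻¹ *ᵥ x) + H⁻¹ *ᵥ e := by
    rw [mulVec_add, h2, ← mulVec_mulVec, ← mulVec_mulVec, posDef_inv_mulVec_mulVec h1]
  have h7 : specNorm H * eucNorm (H⁻¹ *ᵥ (closedLoop G (gain Q R G) *ᵥ x + e))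
      ≤ (1 - γ) * p + κ * E := by
    rw [h6]
    have h8 : eucNorm (L *ᵥ (H⁻¹ *ᵥ x)) ≤ (1 - γ) * eucNorm (H⁻¹ *ᵥ x) :=
      (eucNorm_mulVec_le_specNorm _ _).trans (by gcongr; exact eucNorm_nonneg _)
    have h9 := eucNorm_mulVec_le_specNorm H⁻¹ e
    have h10 := eucNorm_add_le (L *ᵥ (H⁻¹ *ᵥ x)) (H⁻¹ *ᵥ e)
    calc specNorm H * eucNorm (L *ᵥ (H⁻¹ *ᵥ x) + H⁻¹ *ᵥ e)
        ≤ specNorm H * ((1 - γ) * eucNorm (H⁻¹ *ᵥ x) + specNorm H⁻¹ * eucNorm e) := by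
          gcongr
          · exact specNorm_nonneg H
          · linarith
      _ = (1 - γ) * p + (specNorm H * specNorm H⁻¹) * eucNorm e := by rw [hp]; ring
      _ ≤ (1 - γ) * p + κ * E := by
          gcongr
          exact eucNorm_nonneg e
  have hγ : 0 ≤ 1 - γ := (specNorm_nonneg L).trans h3
  have hexp : Real.exp (γ / 2) * (1 - γ) ≤ Real.exp (-(γ / 2)) := by
    have h8 : 1 - γ ≤ Real.exp (-γ) := Real.one_sub_le_exp_neg γ
    calc Real.exp (γ / 2) * (1 - γ) ≤ Real.exp (γ / 2) * Real.exp (-γ) := by gcongr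
      _ = Real.exp (-(γ / 2)) := by rw [← Real.exp_add]; congr 1; ring
  have hE : 0 ≤ E := (eucNorm_nonneg e).trans he
  calc a' * (specNorm H * eucNorm (H⁻¹ *ᵥ (closedLoop G (gain Q R G) *ᵥ x + e)))
      ≤ a' * ((1 - γ) * p + κ * E) := by gcongr
    _ = a' * ((1 - γ) * p) + a' * (κ * E) := by ring
    _ ≤ Real.exp (γ / 2) * a * ((1 - γ) * p) + κ * (κ * E) := by gcongr
    _ = Real.exp (γ / 2) * (1 - γ) * (a * p) + κ ^ 2 * E := by ring
    _ ≤ Real.exp (-(γ / 2)) * (a * p) + κ ^ 2 * E := by gcongr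
    _ ≤ Real.exp (-(γ / 2)) * Y + κ ^ 2 * E := by gcongr

/-- Passing between the norms of two policies through the Euclidean norm costs the condition number
κ, which the weight reached before the switch pays. -/
theorem LyapunovLe.switch (h : LyapunovLe Q R κ γ G κ x Y) (hκ : 0 ≤ κ)
    (hG' : G' ∈ stabSet Q R κ γ S) : LyapunovLe Q R κ γ G' 1 x Y := by
  obtain ⟨H, L, h1, -, -, -, h5⟩ := h
  obtain ⟨⟨-, -, H', L', h1', h2', h3', h4'⟩, -⟩ := hG'
  refine ⟨H', L', h1', h2', h3', h4', ?_⟩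
  rw [one_mul]
  calc specNorm H' * eucNorm (H'⁻¹ *ᵥ x) ≤ specNorm H' * (specNorm H'⁻¹ * eucNorm x) := by
        gcongr
        · exact specNorm_nonneg _
        · exact eucNorm_mulVec_le_specNorm _ _
    _ = specNorm H' * specNorm H'⁻¹ * eucNorm x := by ring
    _ ≤ κ * (specNorm H * eucNorm (H⁻¹ *ᵥ x)) := by
        gcongr
        · exact eucNorm_nonneg _
        · exact eucNorm_le_specNorm_mul_eucNorm_inv_mulVec h1 x
    _ ≤ Y := h5

end Lyapunov

end StabL

namespace StabL

/-! ### State bounds on good trajectories -/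

/-- A trajectory of the algorithm up to time `T`, fully explored, whose confidence sets all contain
the true parameter. -/
structure IsGoodTrajectory {n d : ℕ} (Q : Matrix (Fin n) (Fin n) ℝ) (R : Matrix (Fin d) (Fin d) ℝ)
    (σw κ γ S lam δ : ℝ) (T : ℕ) (Θ : Param n d) (w : ℕ → Fin n → ℝ) (ν : ℕ → Fin d → ℝ)
    (x : ℕ → Fin n → ℝ) (u : ℕ → Fin d → ℝ) (G : ℕ → Param n d) : Prop where
  init_state : x 0 = 0
  dynamics : ∀ t, x (t + 1) = stateMat Θ *ᵥ x t + inputMat Θ *ᵥ u t + w t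
  input : ∀ t < T, u t = gain Q R (G (t - 1)) *ᵥ x t + ν t
  mem_stabSet : ∀ t, G t ∈ stabSet Q R κ γ S
  frobNorm_le : frobNorm Θ ≤ S
  mem_confSet_of_updatesAt : ∀ t < T, UpdatesAt κ γ lam x u t → G t ∈ confSet σw lam S δ x u t
  keep : ∀ t, ¬UpdatesAt κ γ lam x u t → G t = G (t - 1)
  mem_confSet : ∀ t ≤ T, Θ ∈ confSet σw lam S δ x u t

section GoodTrajectory

variable {n d : ℕ} {Q : Matrix (Fin n) (Fin n) ℝ} {R : Matrix (Fin d) (Fin d) ℝ}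
  {σw κ γ S lam δ : ℝ} {T : ℕ} {Θ : Param n d} {w : ℕ → Fin n → ℝ} {ν : ℕ → Fin d → ℝ}
  {x : ℕ → Fin n → ℝ} {u : ℕ → Fin d → ℝ} {G : ℕ → Param n d}

/-- At time 0 the estimate is 0 and V is λI, so the term √λ S of the radius alone admits the ball of
radius S. This treats the initial parameter like one selected at an update. -/
theorem mem_confSet_zero (hl : 0 < lam) (hσ : 0 ≤ σw) {Θ : Param n d} (hΘ : frobNorm Θ ≤ S) :
    Θ ∈ confSet σw lam S δ x u 0 := by
  have h1 : rlsEstimate lam x u 0 = 0 := by simp [rlsEstimate]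
  have h2 : (Θᵀ * designMat lam x u 0 * Θ).trace = lam * frobNorm Θ ^ 2 := by
    rw [designMat_zero, trace_quad_eq_sum, frobNorm_sq, Finset.sum_comm, Finset.mul_sum]
    refine Finset.sum_congr rfl fun i _ => ?_
    rw [smul_mulVec, one_mulVec, dotProduct_smul, ← eucNorm_sq_eq_dotProduct, eucNorm_sq,
      smul_eq_mul]
  show √(((Θ - rlsEstimate lam x u 0)ᵀ * designMat lam x u 0
      * (Θ - rlsEstimate lam x u 0)).trace) ≤ confRadius σw lam S δ x u 0
  rw [h1, sub_zero, h2, Real.sqrt_mul hl.le, Real.sqrt_sq (frobNorm_nonneg Θ), confRadius]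
  have h3 : √lam * frobNorm Θ ≤ √lam * S := by gcongr
  have h4 : ∀ y : ℝ, 0 ≤ σw * √y := fun y => by positivity
  linarith [h4 (2 * n * Real.log (δ⁻¹ * √((designMat lam x u 0).det /
      (lam • (1 : Matrix (Fin n ⊕ Fin d) (Fin n ⊕ Fin d) ℝ)).det)))]

theorem sqrt_trace_sub_le_of_mem_confSet (hl : 0 < lam) {t : ℕ} {Θ₁ Θ₂ : Param n d}
    (h1 : Θ₁ ∈ confSet σw lam S δ x u t) (h2 : Θ₂ ∈ confSet σw lam S δ x u t) :
    √(((Θ₁ - Θ₂)ᵀ * designMat lam x u t * (Θ₁ - Θ₂)).trace)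
      ≤ 2 * confRadius σw lam S δ x u t := by
  have h3 := trace_quad_sub_le (designMat_posDef hl x u t) (Θ₁ - rlsEstimate lam x u t)
    (Θ₂ - rlsEstimate lam x u t)
  rw [sub_sub_sub_cancel_right] at h3
  have h1' : √(((Θ₁ - rlsEstimate lam x u t)ᵀ * designMat lam x u t
      * (Θ₁ - rlsEstimate lam x u t)).trace) ≤ confRadius σw lam S δ x u t := h1
  have h2' : √(((Θ₂ - rlsEstimate lam x u t)ᵀ * designMat lam x u t
      * (Θ₂ - rlsEstimate lam x u t)).trace) ≤ confRadius σw lam S δ x u t := h2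
  linarith

theorem IsGoodTrajectory.policy_mem_confSet (hl : 0 < lam) (hσ : 0 ≤ σw)
    (hr : IsGoodTrajectory Q R σw κ γ S lam δ T Θ w ν x u G) {t : ℕ} (ht : t ≤ T) :
    G (t - 1) ∈ confSet σw lam S δ x u (lastUpdate κ γ lam x u t) := by
  induction t with
  | zero => exact mem_confSet_zero hl hσ (hr.mem_stabSet 0).2
  | succ t ih =>
    by_cases h : UpdatesAt κ γ lam x u t
    · rw [lastUpdate_succ_of_updatesAt h]
      exact hr.mem_confSet_of_updatesAt t ht h
    · rw [lastUpdate_succ_of_not_updatesAt h, Nat.add_sub_cancel, hr.keep t h]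
      exact ih (by omega)

/-- The policy and Θ lie in the confidence set of the last update τ, so zᵀV_τ⁻¹z ≤ 1 suffices. If s
< τ, then z is part of V_τ. Otherwise no update took place at t-1 although more than H₀ steps had
passed since τ, so the determinant had not doubled. -/
theorem IsGoodTrajectory.eucNorm_sub_transpose_mulVec_le (hl : 0 < lam) (hσ : 0 ≤ σw)
    (hr : IsGoodTrajectory Q R σw κ γ S lam δ T Θ w ν x u G) {β : ℝ}
    (hβ : ∀ t ≤ T, confRadius σw lam S δ x u t ≤ β) {h : ℕ} (hh : 2 ≤ h)
    (hH : minDuration κ γ + 1 < h) {s t : ℕ} (hst : s + h ≤ t) (ht : t ≤ T) :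
    eucNorm ((G (t - 1) - Θ)ᵀ *ᵥ covariate x u s) ≤ 2 * β := by
  set τ := lastUpdate κ γ lam x u t with hτ
  have hτt : τ ≤ t := lastUpdate_le t
  have h1 := sqrt_trace_sub_le_of_mem_confSet hl (hr.policy_mem_confSet hl hσ ht)
    (hr.mem_confSet τ (hτt.trans ht))
  have h1 := h1.trans (mul_le_mul_of_nonneg_left (hβ τ (hτt.trans ht)) zero_le_two)
  have hz : covariate x u s ⬝ᵥ (designMat lam x u τ)⁻¹ *ᵥ covariate x u s ≤ 1 := by
    rcases lt_or_ge s τ with hs | hs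
    · exact covariate_inv_quad_le_one hl x u hs
    · have h2 : lastUpdate κ γ lam x u (t - 1) = τ :=
        lastUpdate_eq_of_lt (Nat.sub_le t 1) (by omega)
      have h3 : ¬UpdatesAt κ γ lam x u (t - 1) := by
        intro hup
        have h4 := lastUpdate_succ_of_updatesAt hup
        rw [Nat.sub_add_cancel (by omega)] at h4
        omega
      rw [UpdatesAt, h2, UpdateTest, not_and_or, not_lt, not_lt] at h3
      refine covariate_inv_quad_le_one_of_det_le hl x u hs (t := t - 1) (by omega)
        (h3.resolve_right ?_)
      rw [not_le, Nat.cast_sub (by omega)]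
      have h5 : (τ : ℝ) + h ≤ t := by exact_mod_cast (by omega : τ + h ≤ t)
      push_cast
      linarith
  have hV := designMat_posDef hl x u τ
  have h6 := eucNorm_transpose_mulVec_sq_le hV (G (t - 1) - Θ) (covariate x u s)
  have h7 := trace_quad_nonneg hV (G (t - 1) - Θ)
  refine (Real.le_sqrt_of_sq_le (h6.trans (mul_le_of_le_one_right h7 hz))).trans h1

theorem IsGoodTrajectory.eucNorm_covariate_le
    (hr : IsGoodTrajectory Q R σw κ γ S lam δ T Θ w ν x u G) {W : ℝ}
    (hν : ∀ t < T, eucNorm (ν t) ≤ W) {t : ℕ} (ht : t < T) :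
    eucNorm (covariate x u t) ≤ (1 + κ) * eucNorm (x t) + W := by
  have h1 := eucNorm_sumElim_le (x t) (u t)
  have h2 : eucNorm (u t) ≤ κ * eucNorm (x t) + W := by
    rw [hr.input t ht]
    refine (eucNorm_add_le _ _).trans (add_le_add ?_ (hν t ht))
    exact (eucNorm_mulVec_le_specNorm _ _).trans
      (mul_le_mul_of_nonneg_right (hr.mem_stabSet _).1.2.1 (eucNorm_nonneg _))
  rw [covariate]
  linarith

/-- The crude exponential bound on the states. -/
theorem IsGoodTrajectory.eucNorm_state_le_pow (hκ : 0 ≤ κ)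
    (hr : IsGoodTrajectory Q R σw κ γ S lam δ T Θ w ν x u G) {W : ℝ} (hW : 0 ≤ W)
    (hw : ∀ t < T, eucNorm (w t) ≤ W) (hν : ∀ t < T, eucNorm (ν t) ≤ W) {t : ℕ} (ht : t ≤ T) :
    eucNorm (x t) + W ≤ (S * (1 + κ) + S + 2) ^ t * W := by
  have hS : 0 ≤ S := (frobNorm_nonneg Θ).trans hr.frobNorm_le
  induction t with
  | zero => rw [hr.init_state, eucNorm_zero]; simp
  | succ t ih =>
    have ih := ih (by omega)
    have h1 := hr.eucNorm_covariate_le hν ht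
    have h2 : eucNorm (x (t + 1)) ≤ S * eucNorm (covariate x u t) + W := by
      rw [hr.dynamics t, stateMat_mulVec_add_inputMat_mulVec]
      refine (eucNorm_add_le _ _).trans (add_le_add ?_ (hw t ht))
      refine (eucNorm_mulVec_le_frobNorm _ _).trans ?_
      rw [frobNorm_transpose]
      exact mul_le_mul_of_nonneg_right hr.frobNorm_le (eucNorm_nonneg _)
    have h3 : S * eucNorm (covariate x u t) ≤ S * ((1 + κ) * eucNorm (x t) + W) := by gcongr
    have h4 := eucNorm_nonneg (x t)
    have h5 : (S * (1 + κ) + S + 2) * (eucNorm (x t) + W)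
        ≤ (S * (1 + κ) + S + 2) * ((S * (1 + κ) + S + 2) ^ t * W) := by gcongr
    have h6 : 0 ≤ S * (1 + κ) * W := by positivity
    have h7 : 0 ≤ S * eucNorm (x t) := by positivity
    rw [pow_succ]
    nlinarith

/-- The weight of the Lyapunov norm at time `t`. -/
noncomputable def policyWeight (κ γ lam : ℝ) (x : ℕ → Fin n → ℝ) (u : ℕ → Fin d → ℝ)
    (t : ℕ) : ℝ :=
  min κ (Real.exp (γ / 2 * (t - lastUpdate κ γ lam x u t - 1)))

theorem policyWeight_nonneg (hκ : 0 ≤ κ) (t : ℕ) : 0 ≤ policyWeight κ γ lam x u t :=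
  le_min hκ (Real.exp_pos _).le

theorem one_le_policyWeight (hκ : 1 ≤ κ) (hγ : 0 ≤ γ) (t : ℕ) :
    1 ≤ policyWeight κ γ lam x u (t + 1) := by
  refine le_min hκ (Real.one_le_exp ?_)
  have h : (lastUpdate κ γ lam x u (t + 1) : ℝ) ≤ t := by exact_mod_cast lastUpdate_succ_le t
  push_cast
  have : (0 : ℝ) ≤ (t : ℝ) + 1 - lastUpdate κ γ lam x u (t + 1) - 1 := by linarith
  positivity

/-- The weight restarts at 1 after an update, grows by exp(γ/2) per step and is capped at κ. The
duration H₀ guarantees that it can reach κ by the next update, where `LyapunovLe.switch` spends it.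
-/
theorem lyapunovLe_succ (hκ : 1 ≤ κ) (hγ : 0 < γ)
    (hG : ∀ t, G t ∈ stabSet Q R κ γ S)
    (hkeep : ∀ t, ¬UpdatesAt κ γ lam x u t → G t = G (t - 1)) {t : ℕ} {Y E : ℝ} {e : Fin n → ℝ}
    (he : eucNorm e ≤ E)
    (hx : x (t + 1) = closedLoop (G (t - 1)) (gain Q R (G (t - 1))) *ᵥ x t + e)
    (h : LyapunovLe Q R κ γ (G (t - 1)) (policyWeight κ γ lam x u t) (x t) Y) :
    LyapunovLe Q R κ γ (G (t + 1 - 1)) (policyWeight κ γ lam x u (t + 1)) (x (t + 1))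
      (Real.exp (-(γ / 2)) * Y + κ ^ 2 * E) := by
  have hκ0 : 0 ≤ κ := zero_le_one.trans hκ
  have hexp1 : 1 ≤ Real.exp (γ / 2) := Real.one_le_exp (by positivity)
  have hmin : ∀ b : ℝ, min κ (Real.exp (γ / 2) * b) ≤ Real.exp (γ / 2) * min κ b := fun b => by
    rw [mul_min_of_nonneg _ _ (Real.exp_pos _).le]
    exact min_le_min_right _ (le_mul_of_one_le_left hκ0 hexp1)
  rw [Nat.add_sub_cancel]
  by_cases hu : UpdatesAt κ γ lam x u t
  · have hw : policyWeight κ γ lam x u (t + 1) = 1 := by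
      rw [policyWeight, lastUpdate_succ_of_updatesAt hu]
      push_cast
      rw [show γ / 2 * ((t : ℝ) + 1 - t - 1) = 0 by ring, Real.exp_zero]
      exact min_eq_right hκ
    rw [hw]
    refine LyapunovLe.switch (G := G (t - 1)) (S := S) ?_ hκ0 (hG t)
    rw [hx]
    refine h.step (policyWeight_nonneg hκ0 t) hκ0 ?_ le_rfl he
    refine le_trans ?_ (hmin _)
    rw [← Real.exp_add]
    refine le_min le_rfl ?_
    have h1 := hu.2
    set τ := lastUpdate κ γ lam x u t
    -- Over more than H₀ steps the weight gains more than the factor 2κ√2, which exceeds κ.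
    have h2 : γ / 2 * minDuration κ γ = Real.log (2 * κ * √2) := by
      rw [minDuration]
      field_simp
    have h3 : Real.log (2 * κ * √2) ≤ γ / 2 + γ / 2 * ((t : ℝ) - τ - 1) := by
      rw [← h2]
      nlinarith
    have hs2 : 1 ≤ √2 := Real.one_le_sqrt.2 one_le_two
    have h4 : κ ≤ 2 * κ * √2 := by nlinarith
    refine h4.trans ?_
    rw [← Real.log_le_iff_le_exp (by positivity)]
    exact h3
  · rw [hkeep t hu, hx]
    refine h.step (policyWeight_nonneg hκ0 t) (policyWeight_nonneg hκ0 _) ?_ (min_le_left _ _) he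
    rw [policyWeight, policyWeight, lastUpdate_succ_of_not_updatesAt hu]
    refine le_trans (le_of_eq ?_) (hmin _)
    rw [← Real.exp_add]
    congr 2
    push_cast
    ring

/-- Rewrites the true dynamics as the closed loop that the policy believes in, whose contraction is
known, with the prediction error as a disturbance. -/
theorem IsGoodTrajectory.state_succ
    (hr : IsGoodTrajectory Q R σw κ γ S lam δ T Θ w ν x u G) {t : ℕ} (ht : t < T) :
    x (t + 1) = closedLoop (G (t - 1)) (gain Q R (G (t - 1))) *ᵥ x t
      + (inputMat (G (t - 1)) *ᵥ ν t + w t - (G (t - 1) - Θ)ᵀ *ᵥ covariate x u t) := by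
  rw [hr.dynamics t, stateMat_mulVec_add_inputMat_mulVec, transpose_sub, sub_mulVec, covariate,
    ← stateMat_mulVec_add_inputMat_mulVec (G (t - 1)), closedLoop, add_mulVec, ← mulVec_mulVec]
  nth_rewrite 2 [hr.input t ht]
  rw [mulVec_add]
  abel

/-- The linear-in-`r` bound on the states when the duration of the policies is bounded: `r` bounds
the confidence radius and the noise up to constants. -/
theorem IsGoodTrajectory.eucNorm_state_le (hl : 0 < lam) (hσ : 0 ≤ σw) (hκ : 1 ≤ κ)
    (hr : IsGoodTrajectory Q R σw κ γ S lam δ T Θ w ν x u G) {W β γ₀ θ c r : ℝ}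
    (hw : ∀ t < T, eucNorm (w t) ≤ W) (hν : ∀ t < T, eucNorm (ν t) ≤ W)
    (hγ₀ : 0 < γ₀) (hγ : γ₀ ≤ γ) (hθ : θ = 1 - Real.exp (-(γ₀ / 2)))
    (hc : c = θ / (2 * κ ^ 2 * (2 + κ)))
    (hβ : ∀ t ≤ T, confRadius σw lam S δ x u t ≤ β) {h k : ℕ} (hh : 2 ≤ h)
    (hH : minDuration κ γ + 1 < h) (hk : 0 < k)
    (hF : 2 * S * (Fintype.card (Fin n ⊕ Fin d) * (2 / k)) ≤ c / 2)
    (hr0 : 0 < r) (hrW : W ≤ r) (hrθ : 2 * κ ^ 2 * ((S + 1) * W) ≤ θ * r)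
    (hrβ : 4 * β ≤ c * r) {t : ℕ} (ht : t ≤ T) :
    eucNorm (x t) ≤ (1 + κ ^ 2 * (2 * S * (2 + κ) + S + 1)) ^
      (h * (2 * k + 1) ^ Fintype.card (Fin n ⊕ Fin d)) * r := by
  classical
  have hκ0 : 0 ≤ κ := zero_le_one.trans hκ
  have hS : 0 ≤ S := (frobNorm_nonneg Θ).trans hr.frobNorm_le
  have hγ' : 0 < γ := hγ₀.trans_le hγ
  have hθ0 : 0 < θ := by
    rw [hθ]
    have : Real.exp (-(γ₀ / 2)) < Real.exp 0 := Real.exp_lt_exp.2 (by linarith)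
    rw [Real.exp_zero] at this
    linarith
  have hc0 : 0 < c := by rw [hc]; positivity
  have hexp : Real.exp (-(γ / 2)) ≤ 1 - θ := by
    rw [hθ, sub_sub_cancel]
    exact Real.exp_le_exp.2 (by linarith)
  set b := 1 + κ ^ 2 * (2 * S * (2 + κ) + S + 1) with hb
  have hb1 : 1 ≤ b := by
    rw [hb]
    have : 0 ≤ κ ^ 2 * (2 * S * (2 + κ) + S + 1) := by positivity
    linarith
  set f : ℕ → ℝ := fun t => eucNorm ((G (t - 1) - Θ)ᵀ *ᵥ covariate x u t) with hf
  set Y := envelope (c * (2 + κ)) b r f with hY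
  have hYr : ∀ t, r ≤ Y t := fun t => le_envelope hb1 hr0.le t
  have hF' : ∀ t, frobNorm (G (t - 1) - Θ) ≤ 2 * S := fun t => by
    have h1 := frobNorm_sub_le (G (t - 1)) Θ
    have h2 := (hr.mem_stabSet (t - 1)).2
    have h3 := hr.frobNorm_le
    linarith
  have hcov : ∀ t < T, eucNorm (x t) ≤ Y t → eucNorm (covariate x u t) ≤ (2 + κ) * Y t := by
    intro t ht hxY
    have h1 := hr.eucNorm_covariate_le hν ht
    have h2 : (1 + κ) * eucNorm (x t) ≤ (1 + κ) * Y t := by gcongr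
    linarith [hYr t]
  have hxY : ∀ t ≤ T, eucNorm (x t) ≤ Y t ∧
      LyapunovLe Q R κ γ (G (t - 1)) (policyWeight κ γ lam x u t) (x t) (Y t) := by
    intro t
    induction t with
    | zero =>
      intro _
      rw [hr.init_state, eucNorm_zero]
      exact ⟨hr0.le.trans (hYr 0), lyapunovLe_zero (hr.mem_stabSet 0) (hr0.le.trans (hYr 0))⟩
    | succ t ih =>
      intro ht
      obtain ⟨ih1, ih2⟩ := ih (by omega)
      have hz := hcov t ht ih1
      have he : eucNorm (inputMat (G (t - 1)) *ᵥ ν t + w t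
          - (G (t - 1) - Θ)ᵀ *ᵥ covariate x u t) ≤ (S + 1) * W + f t := by
        refine (eucNorm_sub_le _ _).trans (add_le_add ((eucNorm_add_le _ _).trans ?_) le_rfl)
        have h1 := eucNorm_inputMat_mulVec_le (hr.mem_stabSet (t - 1)).2 (ν t)
        have h2 : S * eucNorm (ν t) ≤ S * W := mul_le_mul_of_nonneg_left (hν t ht) hS
        linarith [hw t ht]
      have hstep := lyapunovLe_succ hκ hγ' hr.mem_stabSet hr.keep he (hr.state_succ ht) ih2
      have hYt := hYr t
      have hY0 : 0 ≤ Y t := hr0.le.trans hYt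
      have hmain : Real.exp (-(γ / 2)) * Y t + κ ^ 2 * ((S + 1) * W + f t) ≤ Y (t + 1) := by
        have h1 : Real.exp (-(γ / 2)) * Y t ≤ (1 - θ) * Y t := by gcongr
        have h2 : θ * r ≤ θ * Y t := by gcongr
        -- The contraction frees θ Y t: half absorbs the noise by `hrθ`, half the prediction error
        -- by the choice of c. If the error is larger, its crude bound 2S|z| is absorbed by the
        -- factor b.
        by_cases hft : f t ≤ c * (2 + κ) * Y t
        · have h3 : Y (t + 1) = Y t := by
            rw [hY, envelope]
            exact if_pos hft
          have h4 : κ ^ 2 * f t ≤ κ ^ 2 * (c * (2 + κ) * Y t) := by gcongr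
          have h5 : κ ^ 2 * (c * (2 + κ) * Y t) = θ / 2 * Y t := by
            rw [hc]
            field_simp
          rw [h3]
          linarith
        · have h3 : Y (t + 1) = b * Y t := by
            rw [hY, envelope]
            exact if_neg hft
          have h4 : f t ≤ 2 * S * ((2 + κ) * Y t) := by
            refine (eucNorm_mulVec_le_frobNorm _ _).trans ?_
            rw [frobNorm_transpose]
            exact mul_le_mul (hF' t) hz (eucNorm_nonneg _) (by positivity)
          have h5 : κ ^ 2 * ((S + 1) * W + f t)
              ≤ κ ^ 2 * ((S + 1) * Y t + 2 * S * ((2 + κ) * Y t)) := by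
            gcongr
            linarith
          have h6 : (1 - θ) * Y t ≤ Y t := by nlinarith
          rw [h3, hb]
          linarith
      refine ⟨?_, hstep.mono hmain⟩
      exact (hstep.mono hmain).eucNorm_le (one_le_policyWeight hκ hγ'.le t)
  refine (hxY t ht).1.trans ?_
  rw [hY, envelope_eq]
  refine mul_le_mul_of_nonneg_right (pow_le_pow_right₀ hb1 ?_) hr0.le
  -- The envelope jumps only at bad times, and pigeonhole bounds their number independently of T.
  have hcount := card_filter_lt_eucNorm_le (M := fun t => G (t - 1) - Θ) (z := covariate x u)
    (X := fun t => (2 + κ) * Y t) (T := T) (h := h) (by omega) hk (B := 2 * β) (F := 2 * S)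
    (c := c) (r := r) hr0 (by linarith) hc0.le
    (fun t _ => by nlinarith [hYr t]) (fun t ht => hcov t ht (hxY t ht.le).1)
    (fun t _ => hF' t)
    (fun s t hst ht => hr.eucNorm_sub_transpose_mulVec_le hl hσ hβ hh hH hst ht.le) hF
  refine le_trans (Finset.card_le_card ?_) hcount
  intro s hs
  obtain ⟨hs1, hs2⟩ := Finset.mem_filter.1 hs
  refine Finset.mem_filter.2 ⟨Finset.mem_range.2 ((Finset.mem_range.1 hs1).trans_le ht), ?_⟩
  rw [← mul_assoc]
  exact hs2

end GoodTrajectory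

end StabL

namespace StabL

/-! ### Asymptotic bounds -/

section Asymptotics

open Filter

/-- Half of the rate kills the polynomial and the other half beats √T. The factor 1/2 lets two such
terms fit under exp(-√T). -/
theorem eventually_pow_mul_exp_neg_le (A a : ℝ) (ha : 0 < a) (p : ℕ) :
    ∀ᶠ T : ℕ in atTop, A * (T : ℝ) ^ p * Real.exp (-(a * T)) ≤ Real.exp (-√T) / 2 := by
  have h1 : Tendsto (fun T : ℕ => a / 2 * (T : ℝ)) atTop atTop :=
    tendsto_natCast_atTop_atTop.const_mul_atTop (by positivity)
  have h2 := ((Real.tendsto_pow_mul_exp_neg_atTop_nhds_zero p).comp h1).const_mul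
    (|A| * (2 / a) ^ p)
  rw [mul_zero] at h2
  have h3 := h2.eventually (ge_mem_nhds (show (0 : ℝ) < 1 / 2 by norm_num))
  have h4 := tendsto_natCast_atTop_atTop.eventually (eventually_ge_atTop ((2 / a) ^ 2 : ℝ))
  filter_upwards [h3, h4] with T h3 h4
  have h5 : √(T : ℝ) ≤ a / 2 * T := by
    have h6 : 2 / a ≤ √T := Real.le_sqrt_of_sq_le h4
    have h7 : (T : ℝ) = √T * √T := (Real.mul_self_sqrt (Nat.cast_nonneg T)).symm
    have h8 : 1 ≤ a / 2 * √T := by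
      have h9 : a / 2 * (2 / a) ≤ a / 2 * √T := by gcongr
      rwa [show a / 2 * (2 / a) = 1 by field_simp] at h9
    have h10 := Real.sqrt_nonneg (T : ℝ)
    nlinarith
  have h6 : A * (T : ℝ) ^ p * Real.exp (-(a / 2 * T)) ≤ 1 / 2 := by
    have h7 : |A| * (T : ℝ) ^ p * Real.exp (-(a / 2 * T)) ≤ 1 / 2 := by
      refine le_trans (le_of_eq ?_) h3
      simp only [Function.comp]
      rw [mul_pow, div_pow, div_pow]
      field_simp
    refine le_trans ?_ h7
    gcongr
    exact le_abs_self A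
  calc A * (T : ℝ) ^ p * Real.exp (-(a * T))
      = A * (T : ℝ) ^ p * Real.exp (-(a / 2 * T)) * Real.exp (-(a / 2 * T)) := by
        have h7 : Real.exp (-(a * T)) = Real.exp (-(a / 2 * T)) * Real.exp (-(a / 2 * T)) := by
          rw [← Real.exp_add]
          congr 1
          ring
        rw [h7]
        ring
    _ ≤ 1 / 2 * Real.exp (-√T) := by
        gcongr
    _ = Real.exp (-√T) / 2 := by ring

end Asymptotics

/-! ### Growth of the design matrix, the confidence radius and the update count. -/

section Bounds

variable {n d : ℕ}

theorem det_designMat_le {lam : ℝ} (hl : 0 < lam) {x : ℕ → Fin n → ℝ} {u : ℕ → Fin d → ℝ}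
    {B : ℝ} {t T : ℕ} (htT : t ≤ T) (hB : ∀ s < t, eucNorm (covariate x u s) ≤ B) :
    (designMat lam x u t).det ≤ (lam + T * B ^ 2) ^ (n + d) := by
  have h := det_le_of_quad_le (designMat_posDef hl x u t) (c := lam + T * B ^ 2) fun v => by
    rw [dotProduct_designMat_mulVec, add_mul]
    gcongr
    calc ∑ s ∈ Finset.range t, (v ⬝ᵥ covariate x u s) ^ 2
        ≤ ∑ s ∈ Finset.range t, B ^ 2 * eucNorm v ^ 2 := by
          refine Finset.sum_le_sum fun s hs => ?_
          refine (dotProduct_sq_le _ _).trans ?_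
          rw [mul_comm]
          gcongr
          · exact eucNorm_nonneg _
          · exact hB s (Finset.mem_range.1 hs)
      _ = t * (B ^ 2 * eucNorm v ^ 2) := by simp
      _ ≤ T * (B ^ 2 * eucNorm v ^ 2) := by gcongr
      _ = T * B ^ 2 * eucNorm v ^ 2 := by ring
  simpa using h

theorem det_smul_one_eq (lam : ℝ) :
    (lam • (1 : Matrix (Fin n ⊕ Fin d) (Fin n ⊕ Fin d) ℝ)).det = lam ^ (n + d) := by
  simp

/-- The crude exponential growth of the design matrix. -/
theorem exists_log_det_designMat_le (n d : ℕ) {κ S lam : ℝ} (hκ : 1 ≤ κ) (hS : 0 ≤ S)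
    (hl : 0 < lam) :
    ∃ L : ℝ, 0 ≤ L ∧ ∀ {σw γ δ : ℝ} {Q : Matrix (Fin n) (Fin n) ℝ}
      {R : Matrix (Fin d) (Fin d) ℝ} {T : ℕ} {Θ : Param n d} {w x : ℕ → Fin n → ℝ}
      {ν u : ℕ → Fin d → ℝ} {G : ℕ → Param n d},
      IsGoodTrajectory Q R σw κ γ S lam δ T Θ w ν x u G → 1 ≤ T →
      (∀ t < T, eucNorm (w t) ≤ (n + d) * T) → (∀ t < T, eucNorm (ν t) ≤ (n + d) * T) →
      ∀ t ≤ T, Real.log ((designMat lam x u t).det /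
        (lam • (1 : Matrix (Fin n ⊕ Fin d) (Fin n ⊕ Fin d) ℝ)).det) ≤ L * T := by
  have hg1 : 1 ≤ S * (1 + κ) + S + 2 := by
    have : 0 ≤ S * (1 + κ) := by positivity
    linarith
  obtain ⟨g, hg⟩ : ∃ g, g = S * (1 + κ) + S + 2 := ⟨_, rfl⟩
  rw [← hg] at hg1
  obtain ⟨M, hM⟩ : ∃ M, M = (1 + κ) * ((n : ℝ) + d) := ⟨_, rfl⟩
  obtain ⟨A, hA⟩ : ∃ A, A = (lam + M ^ 2) / lam := ⟨_, rfl⟩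
  have hA1 : 1 ≤ A := by
    rw [hA, le_div_iff₀ hl, one_mul]
    exact le_add_of_nonneg_right (sq_nonneg M)
  have hg8 : 1 ≤ 8 * g ^ 2 := by
    have := one_le_pow₀ hg1 (n := 2)
    linarith
  have hlA := Real.log_nonneg hA1
  have hlg := Real.log_nonneg hg8
  refine ⟨(n + d) * (Real.log A + Real.log (8 * g ^ 2)), by positivity, ?_⟩
  intro σw γ δ Q R T Θ w x ν u G hr hT hw hν t ht
  have hT' : (1 : ℝ) ≤ T := by exact_mod_cast hT
  have hκ1 : 0 ≤ 1 + κ := by linarith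
  have hcov : ∀ s < t, eucNorm (covariate x u s) ≤ g ^ T * (M * T) := by
    intro s hs
    have h1 := hr.eucNorm_covariate_le hν (t := s) (by omega)
    have h2 := hr.eucNorm_state_le_pow (by linarith) (by positivity) hw hν (t := s) (by omega)
    rw [← hg] at h2
    have h3 : g ^ s * (((n : ℝ) + d) * T) ≤ g ^ T * ((n + d) * T) := by
      gcongr
      omega
    have h4 : 0 ≤ κ * (((n : ℝ) + d) * T) := by positivity
    have h5 := mul_le_mul_of_nonneg_left (h2.trans h3) hκ1
    have h6 : g ^ T * (M * T) = (1 + κ) * (g ^ T * ((n + d) * T)) := by rw [hM]; ring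
    rw [h6]
    linarith
  have hdet := det_designMat_le hl ht hcov
  have hpos := (designMat_posDef hl x u t).det_pos
  have hratio : (designMat lam x u t).det /
      (lam • (1 : Matrix (Fin n ⊕ Fin d) (Fin n ⊕ Fin d) ℝ)).det
      ≤ (A * (8 * g ^ 2) ^ T) ^ (n + d) := by
    rw [det_smul_one_eq, div_le_iff₀ (by positivity), ← mul_pow]
    refine hdet.trans (pow_le_pow_left₀ (by positivity) ?_ _)
    -- Absorbs the polynomial factor into the exponential, whence the base 8g².
    have h1 : (T : ℝ) ^ 3 ≤ 8 ^ T := by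
      have : (T : ℝ) ≤ 2 ^ T := by exact_mod_cast Nat.lt_two_pow_self.le
      calc (T : ℝ) ^ 3 ≤ (2 ^ T) ^ 3 := by gcongr
        _ = 8 ^ T := by rw [← pow_mul, mul_comm, pow_mul]; norm_num
    have h3 : A * (8 * g ^ 2) ^ T * lam
        = lam * (8 * g ^ 2) ^ T + M ^ 2 * (8 ^ T * (g ^ T) ^ 2) := by
      rw [hA, div_mul_eq_mul_div, div_mul_cancel₀ _ hl.ne', mul_pow]
      ring
    have h4 : T * (g ^ T * (M * T)) ^ 2 = M ^ 2 * ((T : ℝ) ^ 3 * (g ^ T) ^ 2) := by ring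
    rw [h3, h4]
    have h6 : lam ≤ lam * (8 * g ^ 2) ^ T := le_mul_of_one_le_right hl.le (one_le_pow₀ hg8)
    gcongr
  have hρ : 0 < (designMat lam x u t).det /
      (lam • (1 : Matrix (Fin n ⊕ Fin d) (Fin n ⊕ Fin d) ℝ)).det :=
    div_pos hpos (det_smul_one_pos hl)
  refine (Real.log_le_log hρ hratio).trans ?_
  rw [Real.log_pow, Real.log_mul (by positivity) (by positivity), Real.log_pow, mul_assoc]
  push_cast
  gcongr
  rw [add_mul, mul_comm (T : ℝ)]
  gcongr
  exact le_mul_of_one_le_right hlA hT'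

/-- On good trajectories the confidence radius grows at most linearly. -/
theorem exists_confRadius_le (n d : ℕ) {σw κ S lam : ℝ} (hσ : 0 < σw) (hκ : 1 ≤ κ) (hS : 0 ≤ S)
    (hl : 0 < lam) :
    ∃ b : ℝ, 0 ≤ b ∧ ∀ {γ δ : ℝ} {Q : Matrix (Fin n) (Fin n) ℝ} {R : Matrix (Fin d) (Fin d) ℝ}
      {T : ℕ} {Θ : Param n d} {w x : ℕ → Fin n → ℝ} {ν u : ℕ → Fin d → ℝ} {G : ℕ → Param n d},
      IsGoodTrajectory Q R σw κ γ S lam δ T Θ w ν x u G → 0 < δ → 1 ≤ T → -Real.log δ ≤ T →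
      (∀ t < T, eucNorm (w t) ≤ (n + d) * T) → (∀ t < T, eucNorm (ν t) ≤ (n + d) * T) →
      ∀ t ≤ T, confRadius σw lam S δ x u t ≤ b * T := by
  obtain ⟨L, hL0, hL⟩ := exists_log_det_designMat_le n d hκ hS hl
  obtain ⟨b₁, hb₁⟩ : ∃ b₁ : ℝ, b₁ = 2 * n * (1 + L / 2) := ⟨_, rfl⟩
  have hb₁0 : 0 ≤ b₁ := by rw [hb₁]; positivity
  refine ⟨σw * √b₁ + √lam * S, by positivity, ?_⟩
  intro γ δ Q R T Θ w x ν u G hr hδ hT hlog hw hν t ht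
  have hT' : (1 : ℝ) ≤ T := by exact_mod_cast hT
  have hlogρ := hL hr hT hw hν t ht
  have hρ : 0 < (designMat lam x u t).det /
      (lam • (1 : Matrix (Fin n ⊕ Fin d) (Fin n ⊕ Fin d) ℝ)).det :=
    div_pos (designMat_posDef hl x u t).det_pos (det_smul_one_pos hl)
  rw [confRadius]
  generalize (designMat lam x u t).det /
      (lam • (1 : Matrix (Fin n ⊕ Fin d) (Fin n ⊕ Fin d) ℝ)).det = ρ at hlogρ hρ
  have hlog2 : 2 * n * Real.log (δ⁻¹ * √ρ) ≤ b₁ * T := by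
    rw [Real.log_mul (by positivity) (by positivity), Real.log_inv, Real.log_sqrt hρ.le, hb₁]
    have : -Real.log δ + Real.log ρ / 2 ≤ (1 + L / 2) * T := by linarith
    calc 2 * (n : ℝ) * (-Real.log δ + Real.log ρ / 2)
        ≤ 2 * n * ((1 + L / 2) * T) := by gcongr
      _ = _ := by ring
  have hsqrt : √(2 * n * Real.log (δ⁻¹ * √ρ)) ≤ √b₁ * T := by
    refine (Real.sqrt_le_sqrt hlog2).trans ?_
    rw [Real.sqrt_mul hb₁0]
    gcongr
    rw [Real.sqrt_le_left (by positivity), sq]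
    exact le_mul_of_one_le_left (by positivity) hT'
  have h1 : σw * √(2 * n * Real.log (δ⁻¹ * √ρ)) ≤ σw * (√b₁ * T) := by gcongr
  have h2 : √lam * S ≤ √lam * S * T := le_mul_of_one_le_right (by positivity) hT'
  linarith

set_option maxHeartbeats 1000000 in
/-- On good trajectories the number of policy updates is a small fraction of the time. -/
theorem exists_updateCount_le (n d : ℕ) {σw κ S lam η : ℝ} (hσ : 0 < σw) (hκ : 1 ≤ κ)
    (hS : 0 ≤ S) (hl : 0 < lam) (hη : 0 < η) :
    ∃ T₀ : ℕ, ∀ {γ δ : ℝ} {Q : Matrix (Fin n) (Fin n) ℝ} {R : Matrix (Fin d) (Fin d) ℝ}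
      {T : ℕ} {Θ : Param n d} {w x : ℕ → Fin n → ℝ} {ν u : ℕ → Fin d → ℝ} {G : ℕ → Param n d},
      IsGoodTrajectory Q R σw κ γ S lam δ T Θ w ν x u G → 0 < γ → 0 < δ → 1 ≤ T →
      -Real.log δ ≤ T → T₀ ≤ T →
      (∀ t < T, eucNorm (w t) ≤ (n + d) * T) → (∀ t < T, eucNorm (ν t) ≤ (n + d) * T) →
      updateCount κ γ lam x u T ≤ η * T := by
  obtain ⟨b, hb0, hb⟩ := exists_confRadius_le n d hσ hκ hS hl
  have hlog2κ : 0 < Real.log (2 * κ * √2) := by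
    refine Real.log_pos ?_
    have hs2 : 1 ≤ √2 := Real.one_le_sqrt.2 one_le_two
    nlinarith
  -- The value of γ at which H₀ equals 1/η. All later constants depend on γ₀ in place of γ.
  set γ₀ := 2 * η * Real.log (2 * κ * √2) with hγ₀
  have hγ₀0 : 0 < γ₀ := by positivity
  set θ := 1 - Real.exp (-(γ₀ / 2)) with hθ
  have hθ0 : 0 < θ := by
    have : Real.exp (-(γ₀ / 2)) < Real.exp 0 := Real.exp_lt_exp.2 (by linarith)
    rw [Real.exp_zero] at this
    rw [hθ]
    linarith
  set c := θ / (2 * κ ^ 2 * (2 + κ)) with hc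
  have hc0 : 0 < c := by positivity
  obtain ⟨h, hh⟩ := exists_nat_gt (1 / η + 2)
  have hh2 : 2 ≤ h := by
    have : (2 : ℝ) < h := lt_trans (by linarith [one_div_pos.2 hη]) hh
    exact_mod_cast this.le
  obtain ⟨k, hk⟩ := exists_nat_gt (8 * S * (n + d) / c)
  have hk0 : 0 < k := by
    have : (0 : ℝ) < k := lt_of_le_of_lt (by positivity) hk
    exact_mod_cast this
  have hk0' : (0 : ℝ) < k := by exact_mod_cast hk0
  have hF : 2 * S * (Fintype.card (Fin n ⊕ Fin d) * (2 / k)) ≤ c / 2 := by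
    rw [div_lt_iff₀ hc0] at hk
    have : (Fintype.card (Fin n ⊕ Fin d) : ℝ) = n + d := by simp
    rw [this]
    have h1 : 2 * S * (((n : ℝ) + d) * (2 / k)) = 8 * S * (n + d) / k / 2 := by
      field_simp
      ring
    rw [h1]
    have h2 : 8 * S * ((n : ℝ) + d) / k ≤ c := by
      rw [div_le_iff₀ hk0']
      linarith
    linarith
  set ρ := (n + d : ℝ) + 2 * κ ^ 2 * ((S + 1) * (n + d)) / θ + 4 * b / c + 1 with hρ
  have e1 : 0 ≤ 2 * κ ^ 2 * ((S + 1) * ((n : ℝ) + d)) / θ := by positivity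
  have e2 : 0 ≤ 4 * b / c := by positivity
  have e3 : (0 : ℝ) ≤ n + d := by positivity
  have hρ0 : 0 < ρ := by linarith
  have hρθ : 2 * κ ^ 2 * ((S + 1) * ((n : ℝ) + d)) ≤ θ * ρ := by
    have : 2 * κ ^ 2 * ((S + 1) * ((n : ℝ) + d)) / θ ≤ ρ := by linarith
    rw [div_le_iff₀ hθ0] at this
    linarith
  have hρc : 4 * b ≤ c * ρ := by
    have : 4 * b / c ≤ ρ := by linarith
    rw [div_le_iff₀ hc0] at this
    linarith
  set D := (1 + κ ^ 2 * (2 * S * (2 + κ) + S + 1)) ^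
      (h * (2 * k + 1) ^ Fintype.card (Fin n ⊕ Fin d)) * ρ with hD
  have hD0 : 0 ≤ D := by positivity
  set A := (lam + ((1 + κ) * D + (n + d)) ^ 2) / lam with hA
  obtain ⟨T₀, hT₀⟩ := Filter.eventually_atTop.1 (eventually_pow_mul_exp_neg_le (A ^ (n + d))
    (η * Real.log 2) (mul_pos hη (Real.log_pos one_lt_two)) (3 * (n + d)))
  refine ⟨T₀, ?_⟩
  intro γ δ Q R T Θ w x ν u G hr hγ hδ hT hlog hTT hw hν
  have hT' : (1 : ℝ) ≤ T := by exact_mod_cast hT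
  have hcountH := updateCount_mul_minDuration_le (κ := κ) (γ := γ) (lam := lam) (x := x) (u := u) T
  have hlast : (lastUpdate κ γ lam x u T : ℝ) ≤ T := by exact_mod_cast lastUpdate_le T
  -- Long policies are few by duration alone. Short minimal durations force γ ≥ γ₀, hence linear
  -- states, a polynomial determinant and logarithmically many doublings.
  rcases le_or_gt (1 / η) (minDuration κ γ) with hH | hH
  · have h1 : (updateCount κ γ lam x u T : ℝ) * (1 / η) ≤ T := by
      have : (updateCount κ γ lam x u T : ℝ) * (1 / η)
          ≤ updateCount κ γ lam x u T * minDuration κ γ := by gcongr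
      linarith
    rw [mul_one_div, div_le_iff₀ hη] at h1
    linarith
  · have hγγ : γ₀ ≤ γ := by
      rw [minDuration, lt_div_iff₀ hη] at hH
      have h1 : 2 * γ⁻¹ * Real.log (2 * κ * √2) * η * γ = γ₀ := by
        rw [hγ₀]
        field_simp
      have h2 := mul_le_mul_of_nonneg_right hH.le hγ.le
      rwa [h1, one_mul] at h2
    have hstate := fun t (ht : t ≤ T) => hr.eucNorm_state_le hl hσ.le hκ hw hν hγ₀0 hγγ hθ hc
      (hb hr hδ hT hlog hw hν) hh2 (by linarith) hk0 hF (r := ρ * T) (by positivity)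
      (by gcongr; linarith)
      (by
        calc 2 * κ ^ 2 * ((S + 1) * (((n : ℝ) + d) * T))
            = 2 * κ ^ 2 * ((S + 1) * ((n : ℝ) + d)) * T := by ring
          _ ≤ θ * ρ * T := by gcongr
          _ = θ * (ρ * T) := by ring)
      (by
        calc 4 * (b * T) = 4 * b * T := by ring
          _ ≤ c * ρ * T := by gcongr
          _ = c * (ρ * T) := by ring) (t := t) ht
    have hcov : ∀ s < lastUpdate κ γ lam x u T, eucNorm (covariate x u s)
        ≤ ((1 + κ) * D + (n + d)) * T := by
      intro s hs
      have hsT : s < T := hs.trans_le (lastUpdate_le T)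
      have h1 := hr.eucNorm_covariate_le hν hsT
      have h2 : (1 + κ) * eucNorm (x s) ≤ (1 + κ) * (D * T) := by
        gcongr
        rw [hD, mul_assoc]
        exact hstate s hsT.le
      linarith
    have hdet := det_designMat_le hl (lastUpdate_le T) hcov
    have hcount := two_pow_updateCount_mul_le (κ := κ) (γ := γ) (lam := lam) (x := x) (u := u) T
    rw [designMat_zero, det_smul_one_eq] at hcount
    have h3 := hcount.trans hdet
    have h4 : lam + T * (((1 + κ) * D + (n + d)) * T) ^ 2 ≤ A * (T : ℝ) ^ 3 * lam := by
      have h5 : A * (T : ℝ) ^ 3 * lam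
          = lam * (T : ℝ) ^ 3 + ((1 + κ) * D + (n + d)) ^ 2 * (T : ℝ) ^ 3 := by
        rw [hA]
        field_simp
      have h6 : lam ≤ lam * (T : ℝ) ^ 3 := le_mul_of_one_le_right hl.le (one_le_pow₀ hT')
      rw [h5]
      linarith
    have h5 : (2 : ℝ) ^ updateCount κ γ lam x u T * lam ^ (n + d)
        ≤ (A * (T : ℝ) ^ 3) ^ (n + d) * lam ^ (n + d) := by
      rw [← mul_pow]
      exact h3.trans (pow_le_pow_left₀ (by positivity) h4 _)
    have h6 := le_of_mul_le_mul_right h5 (by positivity)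
    rw [mul_pow, ← pow_mul] at h6
    have h7 := hT₀ T hTT
    have h8 : Real.exp (-√(T : ℝ)) ≤ 1 := Real.exp_le_one_iff.2 (neg_nonpos.2 (Real.sqrt_nonneg _))
    rw [Real.exp_neg, ← div_eq_mul_inv, div_le_iff₀ (Real.exp_pos _)] at h7
    have h9 : (2 : ℝ) ^ updateCount κ γ lam x u T ≤ Real.exp (η * Real.log 2 * T) := by
      refine h6.trans (h7.trans (mul_le_of_le_one_left (Real.exp_pos _).le ?_))
      linarith
    have h10 := Real.log_le_log (by positivity) h9
    rw [Real.log_pow, Real.log_exp] at h10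
    refine le_of_mul_le_mul_right ?_ (Real.log_pos one_lt_two)
    linarith

end Bounds

end StabL

namespace StabL

/-! ### The estimation error -/

section EstimationError

variable {n d : ℕ}

/-- The lower bound on V_T makes its weighted norm at least σ√T times the Frobenius norm, which
dominates the spectral norm. -/
theorem specNorm_rlsEstimate_sub_le {σw lam S δ σ : ℝ} (hσ : 0 < σ)
    {x : ℕ → Fin n → ℝ} {u : ℕ → Fin d → ℝ} {Θ : Param n d} {T : ℕ} (hT : 0 < T)
    (hΘ : Θ ∈ confSet σw lam S δ x u T)
    (hquad : ∀ v, σ ^ 2 * T * eucNorm v ^ 2 ≤ v ⬝ᵥ designMat lam x u T *ᵥ v) :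
    specNorm (rlsEstimate lam x u T - Θ) ≤ confRadius σw lam S δ x u T / (σ * √T) := by
  have hT' : (0 : ℝ) < T := by exact_mod_cast hT
  refine (specNorm_le_frobNorm _).trans ?_
  rw [le_div_iff₀ (by positivity)]
  have hneg : frobNorm (rlsEstimate lam x u T - Θ) = frobNorm (Θ - rlsEstimate lam x u T) := by
    have h := frobNorm_smul (-1) (Θ - rlsEstimate lam x u T)
    rwa [abs_neg, abs_one, one_mul, neg_smul, one_smul, neg_sub] at h
  rw [hneg]
  refine le_trans ?_ (show √(((Θ - rlsEstimate lam x u T)ᵀ * designMat lam x u T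
      * (Θ - rlsEstimate lam x u T)).trace) ≤ confRadius σw lam S δ x u T from hΘ)
  apply Real.le_sqrt_of_sq_le
  rw [trace_quad_eq_sum, mul_pow, mul_pow, Real.sq_sqrt hT'.le, frobNorm_sq, Finset.sum_comm,
    Finset.sum_mul]
  refine Finset.sum_le_sum fun i _ => ?_
  refine le_trans (le_of_eq ?_) (hquad fun k => (Θ - rlsEstimate lam x u T) k i)
  rw [eucNorm_sq]
  ring

theorem designMat_quad_ge {lam c : ℝ} (hl : 0 < lam) {x : ℕ → Fin n → ℝ} {u : ℕ → Fin d → ℝ}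
    {T : ℕ} (h : ∀ v, eucNorm v = 1 → c ≤ ∑ s ∈ Finset.range T, (v ⬝ᵥ covariate x u s) ^ 2)
    (v : Fin n ⊕ Fin d → ℝ) : c * eucNorm v ^ 2 ≤ v ⬝ᵥ designMat lam x u T *ᵥ v := by
  rw [dotProduct_designMat_mulVec]
  rcases (eucNorm_nonneg v).eq_or_lt with h0 | h0
  · rw [← h0]
    have := Finset.sum_nonneg fun s (_ : s ∈ Finset.range T) => sq_nonneg (v ⬝ᵥ covariate x u s)
    simpa using this
  · have h1 := h ((eucNorm v)⁻¹ • v) (by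
      rw [eucNorm_smul, abs_of_pos (inv_pos.2 h0), inv_mul_cancel₀ h0.ne'])
    simp only [smul_dotProduct, smul_eq_mul, mul_pow] at h1
    rw [← Finset.mul_sum, inv_pow, ← div_eq_inv_mul, le_div_iff₀ (by positivity)] at h1
    have : 0 ≤ lam * eucNorm v ^ 2 := by positivity
    linarith

/-- Noise of linear size and excited grid directions make the covariates of a good trajectory
excited in all directions. -/
theorem exists_sum_dotProduct_covariate_sq_ge (n d : ℕ) {σw κ S lam q : ℝ} (hσ : 0 < σw)
    (hκ : 1 ≤ κ) (hS : 0 ≤ S) (hl : 0 < lam) (hq : 0 < q) :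
    ∃ (c : ℝ) (k T₀ : ℕ), 0 < c ∧ ∀ {γ δ : ℝ} {Q : Matrix (Fin n) (Fin n) ℝ}
      {R : Matrix (Fin d) (Fin d) ℝ} {T : ℕ} {Θ : Param n d} {w x : ℕ → Fin n → ℝ}
      {ν u : ℕ → Fin d → ℝ} {G : ℕ → Param n d},
      IsGoodTrajectory Q R σw κ γ S lam δ T Θ w ν x u G → 0 < γ → 0 < δ → 1 ≤ T →
      -Real.log δ ≤ T → T₀ ≤ T →
      (∀ t < T, ∀ i, |w t i| ≤ T) → (∀ t < T, ∀ i, |ν t i| ≤ T) →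
      (∀ v ∈ cubeGrid (Fin n ⊕ Fin d) (k * T), 1 / 2 ≤ eucNorm v → eucNorm v ≤ 2 →
        q / 2 * ((T - n) / 2 : ℕ) ≤ ∑ j ∈ Finset.range ((T - n) / 2),
          min ((v ⬝ᵥ excitation Θ (gain Q R (G (2 * j - 1))) (fun i => w (2 * j + i))
            (fun i => ν (2 * j + i))) ^ 2) 1) →
      ∀ v, eucNorm v = 1 → c * T ≤ ∑ s ∈ Finset.range T, (v ⬝ᵥ covariate x u s) ^ 2 := by
  obtain ⟨C, hC1, hC⟩ := exists_excitation_bound n d S κ (zero_le_one.trans hκ)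
  -- The grid yields qJ/4 ≥ qT/16; with this η the spoiled blocks cost at most qT/32, leaving half.
  have hη : 0 < q / (32 * ((n : ℝ) + 1)) := by positivity
  obtain ⟨T₁, hT₁⟩ := exists_updateCount_le n d hσ hκ hS hl hη
  -- The excitation can have size C(n+d)T, so the mesh is 1/(kT). The net then has only polynomially
  -- many points in T.
  obtain ⟨k, hk⟩ := exists_nat_gt (8 * (n + d : ℝ) * (C * (n + d)) / q + 2 * (n + d))
  have hkq : 8 * (n + d : ℝ) * (C * (n + d)) ≤ q * k := by
    have : 8 * (n + d : ℝ) * (C * (n + d)) / q ≤ k := by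
      have : (0 : ℝ) ≤ 2 * (n + d) := by positivity
      linarith
    rw [div_le_iff₀ hq] at this
    linarith
  have hk2 : 2 * (n + d : ℝ) ≤ k := by
    have : 0 ≤ 8 * (n + d : ℝ) * (C * (n + d)) / q := by positivity
    linarith
  have hk0 : 0 < k := by
    have : (0 : ℝ) < k := lt_of_le_of_lt (by positivity) hk
    exact_mod_cast this
  refine ⟨q / (32 * (((n : ℝ) + 1) * C) ^ 2), k, max T₁ (2 * n + 2), by positivity, ?_⟩
  intro γ δ Q R T Θ w x ν u G hr hγ hδ hT hlog hTT hw hν hgrid v hv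
  have hT' : (1 : ℝ) ≤ T := by exact_mod_cast hT
  have hT₁' : T₁ ≤ T := (le_max_left _ _).trans hTT
  have hTn : 2 * n + 2 ≤ T := (le_max_right _ _).trans hTT
  have hw' : ∀ t < T, eucNorm (w t) ≤ (n + d) * T := fun t ht => by
    have h := eucNorm_le_of_abs_le (Nat.cast_nonneg T) (hw t ht)
    rw [Fintype.card_fin] at h
    have : (0 : ℝ) ≤ d * T := by positivity
    linarith
  have hν' : ∀ t < T, eucNorm (ν t) ≤ (n + d) * T := fun t ht => by
    have h := eucNorm_le_of_abs_le (Nat.cast_nonneg T) (hν t ht)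
    rw [Fintype.card_fin] at h
    have : (0 : ℝ) ≤ n * T := by positivity
    linarith
  have hcount := hT₁ hr hγ hδ hT hlog hT₁' hw' hν'
  -- All J blocks end before T, and T ≥ 2n+2 gives J ≥ T/4 despite the rounding.
  obtain ⟨J, hJ⟩ : ∃ J, J = (T - n) / 2 := ⟨_, rfl⟩
  rw [← hJ] at hgrid
  have hJT : (T : ℝ) ≤ 4 * J := by exact_mod_cast (by omega : T ≤ 4 * J)
  have hgain : ∀ t, specNorm (gain Q R (G t)) ≤ κ := fun t => (hr.mem_stabSet t).1.2.1
  have hcard : (Fintype.card (Fin n ⊕ Fin d) : ℝ) = n + d := by simp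
  have h1 := sum_min_sq_one_ge_of_grid (k := k * T) (J := J) (Nat.mul_pos hk0 hT)
    (B := C * ((n + d) * T))
    (fun j hj => (hC Θ _ hr.frobNorm_le (hgain (2 * j - 1))).2 (fun i => w (2 * j + i))
      (fun i => ν (2 * j + i)) _ (fun i hi => hw' _ (by omega)) (fun i hi => hν' _ (by omega)))
    (by
      rw [hcard]
      push_cast
      exact hk2.trans (le_mul_of_one_le_right (Nat.cast_nonneg k) hT'))
    (by
      rw [hcard]
      push_cast
      calc 8 * ((n : ℝ) + d) * (C * ((n + d) * T)) = 8 * (n + d) * (C * (n + d)) * T := by ring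
        _ ≤ q * k * T := by gcongr
        _ = q * (k * T) := by ring)
    hgrid hv
  have h2 := sum_dotProduct_covariate_sq_ge (J := J) (T := T) (by omega) (C := C)
    (fun t => (hC Θ _ hr.frobNorm_le (hgain (t - 1))).1) hr.dynamics hr.input hr.keep v
  have h3 : (n : ℝ) * updateCount κ γ lam x u T ≤ q / 32 * T := by
    have h4 : (n : ℝ) * updateCount κ γ lam x u T ≤ (n + 1) * (q / (32 * (n + 1)) * T) := by
      gcongr
      linarith
    refine h4.trans (le_of_eq ?_)
    field_simp
  have h5 := h1.trans h2
  have h6 : q * T ≤ q * (4 * J) := by gcongr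
  have h7 : q / 32 * T ≤ ((n + 1) * C) ^ 2 * ∑ s ∈ Finset.range T, (v ⬝ᵥ covariate x u s) ^ 2 := by
    linarith
  have h8 : q / (32 * (((n : ℝ) + 1) * C) ^ 2) * T = q / 32 * T / (((n : ℝ) + 1) * C) ^ 2 := by
    field_simp
  rw [h8, div_le_iff₀ (by positivity)]
  linarith

end EstimationError

/-! ### Total failure probability of the noise and grid events. -/

section FailureProbability

open Filter

theorem eventually_failure_le (n d k : ℕ) (v : ℝ) {q : ℝ} (hq : 0 < q) :
    ∀ᶠ T : ℕ in atTop, (T : ℝ) * ((n + d) * (2 * Real.exp (v / 2 - T)))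
      + (2 * ((k * T : ℕ) : ℝ) + 1) ^ (n + d) * Real.exp (-(q / 2 * ((T - n) / 2 : ℕ)))
      ≤ Real.exp (-√T) := by
  filter_upwards [eventually_pow_mul_exp_neg_le ((n + d) * (2 * Real.exp (v / 2))) 1 one_pos 1,
    eventually_pow_mul_exp_neg_le ((2 * (k : ℝ) + 1) ^ (n + d)) (q / 8) (by positivity) (n + d),
    eventually_ge_atTop (2 * n + 2)] with T h1 h2 h3
  have h4 : (T : ℝ) * ((n + d) * (2 * Real.exp (v / 2 - T)))
      = (n + d) * (2 * Real.exp (v / 2)) * (T : ℝ) ^ 1 * Real.exp (-(1 * T)) := by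
    rw [show v / 2 - T = v / 2 + -(1 * T) by ring, Real.exp_add]
    ring
  have hT : (1 : ℝ) ≤ T := by exact_mod_cast (by omega : 1 ≤ T)
  have h5 : (2 * ((k * T : ℕ) : ℝ) + 1) ^ (n + d) * Real.exp (-(q / 2 * ((T - n) / 2 : ℕ)))
      ≤ (2 * (k : ℝ) + 1) ^ (n + d) * (T : ℝ) ^ (n + d) * Real.exp (-(q / 8 * T)) := by
    rw [← mul_pow]
    gcongr ?_ ^ _ * Real.exp (-?_)
    · push_cast
      linarith
    · have h6 : (T : ℝ) ≤ 4 * ((T - n) / 2 : ℕ) := by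
        exact_mod_cast (by omega : T ≤ 4 * ((T - n) / 2))
      have h7 : q / 8 * T ≤ q / 8 * (4 * ((T - n) / 2 : ℕ)) := by gcongr
      linarith
  rw [h4]
  linarith

end FailureProbability

/-! ### Assembly of the two events. -/

section Main

variable {Ω : Type*} {mΩ : MeasurableSpace Ω} {ℱ : Filtration ℕ mΩ} {n d : ℕ} {σw σbar κ γ S lam δ : ℝ} {Tw : ℕ}
  {Q : Matrix (Fin n) (Fin n) ℝ} {R : Matrix (Fin d) (Fin d) ℝ}
  {Θstar : Param n d} {w : ℕ → Ω → Fin n → ℝ} {ν : ℕ → Ω → Fin d → ℝ}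
  {x : ℕ → Ω → Fin n → ℝ} {u : ℕ → Ω → Fin d → ℝ} {Θt : ℕ → Ω → Param n d}

/-- The true parameter itself witnesses that the feasible set is nonempty at each update before T,
so the parameter is then taken from the confidence set. -/
theorem IsRun.isGoodTrajectory (hr : IsRun ℱ Q R σw σbar κ γ S lam δ Tw Θstar w ν x u Θt)
    (hΘ : Θstar ∈ stabSet Q R κ γ S) {T : ℕ} (hT : T ≤ Tw + 1) {ω : Ω}
    (hconf : ∀ t ≤ T, Θstar ∈ confSet σw lam S δ (fun s => x s ω) (fun s => u s ω) t) :
    IsGoodTrajectory Q R σw κ γ S lam δ T Θstar (fun t => w t ω) (fun t => ν t ω)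
      (fun t => x t ω) (fun t => u t ω) (fun t => Θt t ω) where
  init_state := hr.init_state ω
  dynamics t := hr.dynamics t ω
  input t ht := by
    have h := hr.input t ω
    rwa [if_pos (by omega)] at h
  mem_stabSet t := hr.mem_stabSet t ω
  frobNorm_le := hΘ.2
  mem_confSet_of_updatesAt t ht hup := (hr.optimistic t ω hup ⟨Θstar, hconf t ht.le, hΘ⟩).1.1
  keep t hup := hr.keep t ω fun h => hup h.1
  mem_confSet := hconf

theorem one_sub_two_mul_le_measureReal {P : Measure Ω} [IsProbabilityMeasure P] {A B₁ B₂ : Set Ω} (hδ : 0 ≤ δ)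
    (h1 : P B₁ ≤ ENNReal.ofReal δ) (h2 : P B₂ ≤ ENNReal.ofReal δ)
    (h : ∀ ω, ω ∉ B₁ → ω ∉ B₂ → ω ∈ A) : 1 - 2 * δ ≤ P.real A := by
  have hu : (Set.univ : Set Ω) ⊆ A ∪ (B₁ ∪ B₂) := by
    intro ω _
    by_cases hω1 : ω ∈ B₁
    · exact Or.inr (Or.inl hω1)
    by_cases hω2 : ω ∈ B₂
    · exact Or.inr (Or.inr hω2)
    · exact Or.inl (h ω hω1 hω2)
  have h3 := measureReal_mono (μ := P) hu
  rw [probReal_univ] at h3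
  have h4 := measureReal_union_le (μ := P) A (B₁ ∪ B₂)
  have h5 := measureReal_union_le (μ := P) B₁ B₂
  have h6 : P.real B₁ ≤ δ := ENNReal.toReal_le_of_le_ofReal hδ h1
  have h7 : P.real B₂ ≤ δ := ENNReal.toReal_le_of_le_ofReal hδ h2
  linarith

end Main

/-- The estimation error bound in positive state dimension. -/
theorem exists_estimation_error_le (N d : ℕ) {σw σbar κ S lam : ℝ} (hσ : 0 < σw)
    (hσbar : 0 < σbar) (hκ : 1 ≤ κ) (hS : 0 ≤ S) (hl : 0 < lam) :
    ∃ σstar : ℝ, 0 < σstar ∧ ∀ {γ : ℝ}, 0 < γ →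
      ∀ {Q : Matrix (Fin (N + 1)) (Fin (N + 1)) ℝ} {R : Matrix (Fin d) (Fin d) ℝ},
      ∀ {Θstar}, Θstar ∈ stabSet Q R κ γ S →
      ∀ {Ω : Type*} {mΩ : MeasurableSpace Ω} {P : Measure Ω} [IsProbabilityMeasure P]
        {ℱ : Filtration ℕ mΩ} {w : ℕ → Ω → Fin (N + 1) → ℝ} {ν : ℕ → Ω → Fin d → ℝ}
        {x : ℕ → Ω → Fin (N + 1) → ℝ} {u : ℕ → Ω → Fin d → ℝ} {Θt : ℕ → Ω → Param (N + 1) d}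
        {δ : ℝ} {T Tw : ℕ}, 0 < δ →
        IsNoise P ℱ σw σbar w → IsPerturbation P ℱ (2 * κ ^ 2 * σbar ^ 2) w ν →
        IsRun ℱ Q R σw σbar κ γ S lam δ Tw Θstar w ν x u Θt →
        1 ≤ T → -Real.log δ ≤ √T → T ≤ Tw + 1 →
        1 - 2 * δ ≤ P.real {ω |
          specNorm (rlsEstimate lam (fun s => x s ω) (fun s => u s ω) T - Θstar)
            ≤ confRadius σw lam S δ (fun s => x s ω) (fun s => u s ω) T / (σstar * √T)} := by
  have hq := excitationRate_pos (N + 1) d σw κ hσbar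
  set q := excitationRate (N + 1) d σw σbar κ with hq_def
  obtain ⟨c, k, T₁, hc, hmain⟩ :=
    exists_sum_dotProduct_covariate_sq_ge (N + 1) d hσ hκ hS hl hq
  obtain ⟨T₂, hT₂⟩ := Filter.eventually_atTop.1
    (eventually_failure_le (N + 1) d k (σw ^ 2 + 2 * κ ^ 2 * σbar ^ 2) hq)
  set T₀ := max T₁ T₂
  -- The second entry makes σ⋆²T ≤ λ for T < T₀, where regularization alone suffices and no
  -- excitation is needed.
  have hσs : 0 < min c (lam / (T₀ + 1)) := lt_min hc (by positivity)
  refine ⟨√(min c (lam / (T₀ + 1))), Real.sqrt_pos.2 hσs, ?_⟩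
  intro γ hγ Q R Θstar hΘ Ω mΩ P _ ℱ w ν x u Θt δ T Tw hδ hw hν hr hT hlog hTw
  have hT' : (1 : ℝ) ≤ T := by exact_mod_cast hT
  have hB₁ := hr.measure_notMem_confSet_le (Nat.succ_pos N) hl hσ hδ hΘ.2 hw hν (T + 1)
  rcases lt_or_ge T T₀ with hTT | hTT
  · refine one_sub_two_mul_le_measureReal hδ.le hB₁ (B₂ := ∅) (by simp) fun ω h1 _ => ?_
    have hconf : Θstar ∈ confSet σw lam S δ (fun s => x s ω) (fun s => u s ω) T := by
      by_contra h2
      exact h1 ⟨T, Nat.lt_succ_self T, h2⟩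
    refine specNorm_rlsEstimate_sub_le (Real.sqrt_pos.2 hσs) hT hconf fun v => ?_
    rw [Real.sq_sqrt hσs.le, dotProduct_designMat_mulVec]
    have h3 : min c (lam / (T₀ + 1)) * T ≤ lam := by
      have hle : (T : ℝ) ≤ T₀ + 1 := by exact_mod_cast (by omega : T ≤ T₀ + 1)
      calc min c (lam / (T₀ + 1)) * T ≤ lam / (T₀ + 1) * (T₀ + 1) := by
            gcongr
            exact min_le_right _ _
        _ = lam := by field_simp
    have h4 : min c (lam / (T₀ + 1)) * T * eucNorm v ^ 2 ≤ lam * eucNorm v ^ 2 := by gcongr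
    have h5 := Finset.sum_nonneg fun s (_ : s ∈ Finset.range T) =>
      sq_nonneg (v ⬝ᵥ covariate (fun s => x s ω) (fun s => u s ω) s)
    linarith
  · have hB₂ := (measure_union_le _ _).trans (add_le_add
      (measure_exists_abs_gt_le (by positivity) hw hν T T)
      (hr.measure_exists_grid_sum_lt_le hσ hσbar hκ hw hν (k * T) ((T - (N + 1)) / 2)))
    have hfail := hT₂ T ((le_max_right _ _).trans hTT)
    rw [← ENNReal.ofReal_add (by positivity) (by positivity)] at hB₂
    -- The failure bound depends on T alone; comparing it with δ is what requires T ≥ log(1/δ)².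
    have hδT : Real.exp (-√T) ≤ δ := by
      rw [← Real.le_log_iff_exp_le hδ]
      linarith
    have hB₂ := hB₂.trans (ENNReal.ofReal_le_ofReal (hfail.trans hδT))
    refine one_sub_two_mul_le_measureReal hδ.le hB₁ hB₂ fun ω h1 h2 => ?_
    have hconf : ∀ t ≤ T,
        Θstar ∈ confSet σw lam S δ (fun s => x s ω) (fun s => u s ω) t := by
      intro t ht
      by_contra h3
      exact h1 ⟨t, Nat.lt_succ_of_le ht, h3⟩
    rw [Set.mem_union, not_or] at h2
    obtain ⟨h2, h3⟩ := h2
    have hsqrtT : √(T : ℝ) ≤ T := by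
      rw [Real.sqrt_le_left (by positivity), sq]
      exact le_mul_of_one_le_left (by positivity) hT'
    have hexc := hmain (hr.isGoodTrajectory hΘ hTw hconf) hγ hδ hT (hlog.trans hsqrtT)
      ((le_max_left _ _).trans hTT)
      (fun t ht i => by
        by_contra! h4
        exact h2 ⟨t, ht, Or.inl ⟨i, h4⟩⟩)
      (fun t ht i => by
        by_contra! h4
        exact h2 ⟨t, ht, Or.inr ⟨i, h4⟩⟩)
      (fun v hv hv1 hv2 => by
        by_contra! h4
        exact h3 ⟨v, hv, hv1, hv2, h4⟩)
    refine specNorm_rlsEstimate_sub_le (Real.sqrt_pos.2 hσs) hT (hconf T le_rfl) fun v => ?_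
    refine le_trans ?_ (designMat_quad_ge hl hexc v)
    rw [Real.sq_sqrt hσs.le]
    gcongr
    exact min_le_left _ _

end StabL

theorem lemma2 :
    ∃ p : MvPolynomial (Fin 4) ℝ,
    ∀ (n d : ℕ) (σw σbar κ S lam : ℝ), 0 < σw → 0 < σbar → 1 ≤ κ → 0 < lam →
    ∃ σstar : ℝ, 0 < σstar ∧
    ∀ (γ : ℝ), 0 < γ → γ ≤ 1 →
    ∀ (Q : Matrix (Fin n) (Fin n) ℝ) (R : Matrix (Fin d) (Fin d) ℝ), Q.PosDef → R.PosDef →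
    ∀ Θstar ∈ StabL.stabSet Q R κ γ S,
    ∀ {Ω : Type*} {mΩ : MeasurableSpace Ω} (P : Measure Ω) [IsProbabilityMeasure P]
      (ℱ : Filtration ℕ mΩ) (w : ℕ → Ω → Fin n → ℝ) (ν : ℕ → Ω → Fin d → ℝ)
      (x : ℕ → Ω → Fin n → ℝ) (u : ℕ → Ω → Fin d → ℝ) (Θt : ℕ → Ω → StabL.Param n d)
      (δ : ℝ) (T Tw : ℕ), 0 < δ → δ < 1 →
      StabL.IsNoise P ℱ σw σbar w →
      StabL.IsPerturbation P ℱ (2 * κ ^ 2 * σbar ^ 2) w ν →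
      StabL.IsRun ℱ Q R σw σbar κ γ S lam δ Tw Θstar w ν x u Θt →
      MvPolynomial.eval ![σw ^ 2, 2 * κ ^ 2 * σbar ^ 2, (n : ℝ), Real.log (1 / δ)] p ≤ (T : ℝ) →
      T ≤ Tw + 1 →
      1 - 2 * δ ≤ P.real {ω |
        StabL.specNorm (StabL.rlsEstimate lam (fun s => x s ω) (fun s => u s ω) T - Θstar)
          ≤ StabL.confRadius σw lam S δ (fun s => x s ω) (fun s => u s ω) T
              / (σstar * Real.sqrt T)} := by
  -- Only log(1/δ) enters; the other thresholds are absorbed into σ⋆. The summand 1 ensures T ≥ 1.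
  refine ⟨MvPolynomial.X 3 ^ 2 + 1, ?_⟩
  intro n d σw σbar κ S lam hσ hσbar hκ hl
  -- For S < 0 the set of admissible parameters is empty.
  by_cases hS : 0 ≤ S
  swap
  · refine ⟨1, one_pos, ?_⟩
    intro γ _ _ Q R _ _ Θstar hΘ
    exact absurd ((StabL.frobNorm_nonneg Θstar).trans hΘ.2) hS
  rcases n with _ | N
  -- For n = 0 the estimation error has no columns, so its norm is 0 and the bound holds surely.
  -- This case is apart because the confidence argument divides by n.
  · refine ⟨1, one_pos, ?_⟩
    intro γ _ _ Q R _ _ Θstar hΘ Ω mΩ P _ ℱ w ν x u Θt δ T Tw hδ _ _ _ _ _ _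
    have huniv : {ω | StabL.specNorm (StabL.rlsEstimate lam (fun s => x s ω) (fun s => u s ω) T
        - Θstar) ≤ StabL.confRadius σw lam S δ (fun s => x s ω) (fun s => u s ω) T
          / (1 * Real.sqrt T)} = Set.univ := by
      refine Set.eq_univ_of_forall fun ω => ?_
      refine (StabL.specNorm_le_frobNorm _).trans ?_
      have h0 : 0 ≤ √lam * S := by positivity
      simp only [StabL.frobNorm, StabL.confRadius, Finset.univ_eq_empty, Finset.sum_empty,
        Finset.sum_const_zero, Real.sqrt_zero, Nat.cast_zero, mul_zero, zero_mul, zero_add]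
      positivity
    rw [huniv, probReal_univ]
    linarith
  · obtain ⟨σstar, h1, h2⟩ := StabL.exists_estimation_error_le N d hσ hσbar hκ hS hl
    refine ⟨σstar, h1, ?_⟩
    intro γ hγ _ Q R _ _ Θstar hΘ Ω mΩ P _ ℱ w ν x u Θt δ T Tw hδ _ hw hν hr hp hTw
    have hp' : (-Real.log δ) ^ 2 + 1 ≤ (T : ℝ) := by
      refine le_trans (le_of_eq ?_) hp
      rw [map_add, map_pow, MvPolynomial.eval_X, map_one, one_div, Real.log_inv]
      rfl
    have hT : 1 ≤ T := by
      have : (1 : ℝ) ≤ T := by linarith [sq_nonneg (-Real.log δ)]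
      exact_mod_cast this
    exact h2 hγ hΘ hδ hw hν hr hT (Real.le_sqrt_of_sq_le (by linarith)) hTw
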